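/- **Setting.** Let $\mathcal S,\mathcal A$ be measurable spaces, $d,H,K\ge 1$ integers, $\lambda>0$, $\delta\in(0,1)$. A finite-horizon linear MDP has a measurable feature map $\phi:\mathcal S\times\mathcal A\to\mathbb R^d$ with $\phi_i\ge 0$, $\sum_i\phi_i=1$; rewards $r_h(s,a)=\langle\phi(s,a),\theta_h\rangle\in[0,1]$ with $\|\theta_h\|_2\le\sqrt d$; and nominal transitions $P^0_h(\cdot|s,a)=\sum_i\phi_i(s,a)\mu^0_{h,i}$ with probability measures $\mu^0_{h,i}$ on $\mathcal S$, $h=1,\dots,H$. Let $D$ be one of the divergences TV ($D(\mu\|\nu)=\sup_E|\mu(E)-\nu(E)|$), KL, or $\chi^2$ ($D(\mu\|\nu)=\int(\frac{d\mu}{d\nu}-1)^2d\nu$), where KL and $\chi^2$ are $\infty$ unless $\mu\ll\nu$. For a randomized Markov policy $\pi$ put $$V_h^{\pi,\lambda}(s)=\inf_{\mu}\mathbb E^{\pi,P^\mu}\Big[\sum_{t=h}^H r_t(s_t,a_t)+\lambda\sum_{i}\phi_i(s_t,a_t)D(\mu_{t,i}\|\mu^0_{t,i})\,\Big|\,s_h=s\Big],$$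 the infimum being over all probability measures $(\mu_{t,i})$ on $\mathcal S$, with $P^\mu_t(\cdot|s,a)=\sum_i\phi_i(s,a)\mu_{t,i}$. Let $V_h^{\star,\lambda}(s)=\sup_\pi V_h^{\pi,\lambda}(s)$ and $\mathrm{SubOpt}(\pi,s,\lambda)=V_1^{\star,\lambda}(s)-V_1^{\pi,\lambda}(s)$. A policy $\pi^\star$ is optimal if $V_1^{\pi^\star,\lambda}(s)=V_1^{\star,\lambda}(s)$ for all $s$. **Data and algorithm.** The data are $K$ i.i.d. trajectories $(s_h^\tau,a_h^\tau)_{h}$, $\tau=1,\dots,K$, of the nominal MDP under an arbitrary behavior policy and initial distribution. Put $\Lambda_h=\sum_\tau\phi(s_h^\tau,a_h^\tau)\phi(s_h^\tau,a_h^\tau)^\top+I$, and for $f:\mathcal S\to\mathbb R$ let $R_h[f]=\Lambda_h^{-1}\sum_\tau\phi(s_h^\tau,a_h^\tau)f(s_{h+1}^\tau)\in\mathbb R^d$ (ridge regression with parameter $1$). Start from $\hat V_{H+1}=0$. For $h=H,\dots,1$, with $V=\hat V_{h+1}$, $[V]_\alpha=\min\{V,\alpha\}$ and $[x]_{[0,b]}=\max\{0,\min\{x,b\}\}$,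 set * (TV) $\hat w_h=R_h\big[[V]_{\inf V+\lambda}\big]$; * (KL) $\hat w_{h,i}=-\lambda\log\max\{R_h[e^{-V/\lambda}]_i,\,e^{-H/\lambda}\}$; * ($\chi^2$) $\hat w_{h,i}=\sup_{\alpha\in[\inf V,\sup V]}\big\{E_i(\alpha)+\tfrac1{4\lambda}E_i(\alpha)^2-\tfrac1{4\lambda}F_i(\alpha)\big\}$, where $E_i(\alpha)=\big[R_h[[V]_\alpha]_i\big]_{[0,H]}$ and $F_i(\alpha)=\big[R_h[[V]_\alpha^2]_i\big]_{[0,H^2]}$. Set $\Gamma_h(s,a)=\beta\sum_i\|\phi_i(s,a)\mathbf 1_i\|_{\Lambda_h^{-1}}$, where $\mathbf 1_i$ is the $i$-th standard basis vector and $\|v\|_B=\sqrt{v^\top Bv}$, and $\hat Q_h(s,a)=[\langle\phi(s,a),\theta_h+\hat w_h\rangle-\Gamma_h(s,a)]_{[0,H-h+1]}$. Let $\hat\pi_h(\cdot|s)$ maximize $\langle\hat Q_h(s,\cdot),\pi_h(\cdot|s)\rangle$ over action distributions and $\hat V_h(s)=\langle\hat Q_h(s,\cdot),\hat\pi_h(\cdot|s)\rangle$.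 The penalty parameter is * (TV) $\beta=16Hd\sqrt{\xi_{\mathrm{TV}}}$, $\ \xi_{\mathrm{TV}}=2\log(1024Hd^{1/2}K^2/\delta)$; * (KL) $\beta=16d\lambda e^{H/\lambda}\sqrt{H/\lambda+\xi_{\mathrm{KL}}}$, $\ \xi_{\mathrm{KL}}=\log(1024d\lambda^2K^3H/\delta)$; * ($\chi^2$) $\beta=8dH\big(1+\tfrac{3H}{4\lambda}\big)\sqrt{\xi_{\chi^2}}$, $\ \xi_{\chi^2}=\log\big(192K^5H^6d^3(1+\tfrac H{2\lambda})^3/\delta\big)$. **Coverage.** Let $\mathcal U^\lambda(P^0)$ be the set of transition families $P$ such that for all $h\in[H]$ and $(s,a)$ there are probability measures $\nu_1,\dots,\nu_d$ with $P_h(\cdot|s,a)=\sum_i\phi_i(s,a)\nu_i$ and $D(\nu_i\|\mu^0_{h,i})\le\sup_{s'}V^{\star,\lambda}_{h+1}(s')/\lambda$ for all $i$. For $c^\dagger>0$ and an optimal policy $\pi^\star$, robust regularized partial coverage holds for the dataset if, in the Loewner order, $$\Lambda_h\succeq I+K\,c^\dagger\,\mathbb E^{\pi^\star,P}\big[\phi_i^2(s_h,a_h)\mathbf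 1_i\mathbf 1_i^\top\,\big|\,s_1=s\big]\quad\text{for all }h\in[H],\ s\in\mathcal S,\ P\in\mathcal U^\lambda(P^0),\ i\in[d].$$ **Statement.** For each of the three divergences, with probability at least $1-\delta$ over the data, the following holds for every output $\hat\pi$ of the algorithm: for every optimal policy $\pi^\star$ and every $c^\dagger>0$ for which robust regularized partial coverage holds, and for every $s\in\mathcal S$, * (TV) $\mathrm{SubOpt}(\hat\pi,s,\lambda)\le 32H^2d^2\sqrt{\xi_{\mathrm{TV}}}/\sqrt{c^\dagger K}$; * (KL) $\mathrm{SubOpt}(\hat\pi,s,\lambda)\le 32\lambda e^{H/\lambda}d^2H\big(\tfrac H\lambda+\xi_{\mathrm{KL}}\big)^{1/2}/\sqrt{c^\dagger K}$; * ($\chi^2$) $\mathrm{SubOpt}(\hat\pi,s,\lambda)\le 16d^2H^2\big(1+\tfrac{3H}{4\lambda}\big)\sqrt{\xi_{\chi^2}}/\sqrt{c^\dagger K}$. -/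

import Mathlib

open MeasureTheory ProbabilityTheory
open scoped ENNReal

noncomputable section

namespace RRMDP

/-! ### Divergences between probability measures -/

/-- The three divergences under consideration. -/
inductive Divergence where
  | tv
  | kl
  | chiSq

/-- Total variation distance `sup_E |μ(E) - ν(E)|`. -/
def tvDiv {X : Type*} [MeasurableSpace X] (μ ν : Measure X) : ℝ≥0∞ :=
  ⨆ (E : Set X) (_ : MeasurableSet E), ENNReal.ofReal |μ.real E - ν.real E|

open Classical in
/-- Chi-square divergence `∫ (dμ/dν - 1)² dν`, infinite unless `μ ≪ ν`. -/
def chiSqDiv {X : Type*} [MeasurableSpace X] (μ ν : Measure X) : ℝ≥0∞ :=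
  if μ ≪ ν then ∫⁻ x, ENNReal.ofReal (((μ.rnDeriv ν x).toReal - 1) ^ 2) ∂ν else ⊤

/-- The divergence `D(μ‖ν)`, with values in `[0, ∞]`. -/
def Divergence.eval {X : Type*} [MeasurableSpace X] :
    Divergence → Measure X → Measure X → ℝ≥0∞
  | .tv => tvDiv
  | .kl => InformationTheory.klDiv
  | .chiSq => chiSqDiv

/-! ### Policies, transition kernels, trajectories -/

/-- A (randomized, Markov) policy: `π_h(· | s)` for every step `h`. -/
structure Policy (S A : Type*) [MeasurableSpace S] [MeasurableSpace A] where
  toKernel : ℕ → Kernel S A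
  isMarkov : ∀ h, IsMarkovKernel (toKernel h)

/-- A family of transition kernels `P_h(· | s, a)`. -/
structure Transition (S A : Type*) [MeasurableSpace S] [MeasurableSpace A] where
  toKernel : ℕ → Kernel (S × A) S
  isMarkov : ∀ h, IsMarkovKernel (toKernel h)

attribute [instance] Policy.isMarkov Transition.isMarkov

section Trajectories

variable {S A : Type*} [MeasurableSpace S] [MeasurableSpace A]

/-- One step of the controlled chain: from `(s_h, a_h)` draw `s_{h+1} ∼ P_h(· | s_h, a_h)` and then
`a_{h+1} ∼ π_{h+1}(· | s_{h+1})`. -/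
def stepKernel (P : Transition S A) (π : Policy S A) (h : ℕ) : Kernel (S × A) (S × A) :=
  (Kernel.id ×ₖ π.toKernel (h + 1)) ∘ₖ P.toKernel h

instance (P : Transition S A) (π : Policy S A) (h : ℕ) :
    IsMarkovKernel (stepKernel P π h) := by
  unfold stepKernel; infer_instance

/-- The kernel giving `(s_{h+n+1}, a_{h+n+1})` from the history
`(s_h, a_h), …, (s_{h+n}, a_{h+n})`. -/
def historyKernel (P : Transition S A) (π : Policy S A) (h n : ℕ) :
    Kernel (Finset.Iic n → S × A) (S × A) :=
  (stepKernel P π (h + n)).comap (fun ω => ω ⟨n, Finset.mem_Iic.2 le_rfl⟩)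
    (measurable_pi_apply _)

instance (P : Transition S A) (π : Policy S A) (h n : ℕ) :
    IsMarkovKernel (historyKernel P π h n) := by
  unfold historyKernel; infer_instance

/-- The law of the trajectory `ω`, `ω k = (s_{h+k}, a_{h+k})`, started at step `h` with
`s_h ∼ ρ`, under the policy `π` and the transitions `P`. -/
def trajLaw (P : Transition S A) (π : Policy S A) (h : ℕ) (ρ : Measure S) :
    Measure (ℕ → S × A) :=
  Kernel.trajMeasure (X := fun _ => S × A) (ρ ⊗ₘ π.toKernel h) (historyKernel P π h)

end Trajectories

/-! ### Linear MDPs with a simplex feature space -/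

/-- A finite-horizon linear MDP. Steps are `h = 1, …, H`; the data at other indices plays no
role. -/
structure LinearMDP (S A : Type*) [MeasurableSpace S] [MeasurableSpace A] (d H : ℕ) where
  /-- feature map -/
  φ : S × A → Fin d → ℝ
  measurable_φ : Measurable φ
  φ_nonneg : ∀ x i, 0 ≤ φ x i
  φ_sum : ∀ x, ∑ i, φ x i = 1
  /-- reward parameters -/
  θ : ℕ → EuclideanSpace ℝ (Fin d)
  θ_norm : ∀ h ∈ Finset.Icc 1 H, ‖θ h‖ ≤ √(d : ℝ)
  reward_mem : ∀ h ∈ Finset.Icc 1 H, ∀ x, ∑ i, φ x i * θ h i ∈ Set.Icc (0 : ℝ) 1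
  /-- nominal factor distributions -/
  μ₀ : ℕ → Fin d → ProbabilityMeasure S

/-- A choice of factor distributions `μ_{h,i}`. -/
abbrev Factors (S : Type*) [MeasurableSpace S] (d : ℕ) := ℕ → Fin d → ProbabilityMeasure S

namespace LinearMDP

variable {S A : Type*} [MeasurableSpace S] [MeasurableSpace A] {d H : ℕ}

/-- The reward `r_h(s,a) = ⟨φ(s,a), θ_h⟩`. -/
def reward (M : LinearMDP S A d H) (h : ℕ) (x : S × A) : ℝ := ∑ i, M.φ x i * M.θ h i

/-- The mixture `⟨φ(s,a), ν⟩ = ∑ i, φ_i(s,a) ν_i` of probability measures. -/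
def mixture (M : LinearMDP S A d H) (ν : Fin d → ProbabilityMeasure S) (x : S × A) :
    Measure S :=
  ∑ i, ENNReal.ofReal (M.φ x i) • (ν i : Measure S)

/-- The transitions `P_h(· | s,a) = ⟨φ(s,a), μ_h(·)⟩`. -/
def linearTransition (M : LinearMDP S A d H) (μ : Factors S d) : Transition S A where
  toKernel h :=
    { toFun := M.mixture (μ h)
      measurable' := by
        refine Measure.measurable_of_measurable_coe _ fun s _ => ?_
        simp only [mixture, Measure.coe_finsetSum, Measure.coe_smul, Finset.sum_apply,
          Pi.smul_apply, smul_eq_mul]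
        refine Finset.measurable_fun_sum _ fun i _ => ?_
        exact (((measurable_pi_apply i).comp M.measurable_φ).ennreal_ofReal).mul_const _ }
  isMarkov h := by
    refine ⟨fun x => ⟨?_⟩⟩
    change M.mixture (μ h) x Set.univ = 1
    simp only [mixture, Measure.coe_finsetSum, Measure.coe_smul, Finset.sum_apply,
      Pi.smul_apply, smul_eq_mul, measure_univ, mul_one]
    rw [← ENNReal.ofReal_sum_of_nonneg fun i _ => M.φ_nonneg x i, M.φ_sum, ENNReal.ofReal_one]

/-- The nominal transitions `P⁰`. -/
def nominal (M : LinearMDP S A d H) : Transition S A := M.linearTransition M.μ₀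

/-! ### Robust regularized values -/

/-- The regularized reward at step `h`:
`r_h(s,a) + λ ⟨φ(s,a), D(μ_h ‖ μ_h⁰)⟩`. -/
def regReward (M : LinearMDP S A d H) (D : Divergence) (lam : ℝ) (μ : Factors S d) (h : ℕ)
    (x : S × A) : ℝ≥0∞ :=
  ENNReal.ofReal (M.reward h x) +
    ENNReal.ofReal lam * ∑ i, ENNReal.ofReal (M.φ x i) * D.eval (μ h i : Measure S) (M.μ₀ h i)

/-- The robust regularized value `V_h^{π,λ}(s)`: the infimum over all factor distributions of the
expected sum of regularized rewards over the steps `h, …, H`, started from `s_h = s`. -/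
def value (M : LinearMDP S A d H) (D : Divergence) (lam : ℝ) (π : Policy S A) (h : ℕ) (s : S) :
    ℝ≥0∞ :=
  ⨅ μ : Factors S d,
    ∫⁻ ω, ∑ k ∈ Finset.range (H + 1 - h), M.regReward D lam μ (h + k) (ω k)
      ∂(trajLaw (M.linearTransition μ) π h (Measure.dirac s))

/-- The optimal robust regularized value `V_h^{⋆,λ}(s)`. -/
def optValue (M : LinearMDP S A d H) (D : Divergence) (lam : ℝ) (h : ℕ) (s : S) : ℝ≥0∞ :=
  ⨆ π : Policy S A, M.value D lam π h s

/-- `π` is an optimal robust policy. -/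
def IsOptimal (M : LinearMDP S A d H) (D : Divergence) (lam : ℝ) (π : Policy S A) : Prop :=
  ∀ s, M.value D lam π 1 s = M.optValue D lam 1 s

/-- Suboptimality gap; both values lie in `[0, H]`. -/
def subOpt (M : LinearMDP S A d H) (D : Divergence) (lam : ℝ) (π : Policy S A) (s : S) : ℝ :=
  (M.optValue D lam 1 s).toReal - (M.value D lam π 1 s).toReal

/-- The robustly admissible set `𝒰^λ(P⁰)`, a product over all `(h, s, a)`. -/
def admissible (M : LinearMDP S A d H) (D : Divergence) (lam : ℝ) : Set (Transition S A) :=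
  {P | ∀ h ∈ Finset.Icc 1 H, ∀ x : S × A, ∃ ν : Fin d → ProbabilityMeasure S,
    P.toKernel h x = M.mixture ν x ∧
    ∀ i, D.eval (ν i : Measure S) (M.μ₀ h i) ≤
      (⨆ s, M.optValue D lam (h + 1) s) / ENNReal.ofReal lam}

end LinearMDP

/-! ### Offline data and the algorithm -/

/-- `K` recorded trajectories; `data τ k = (s_{k+1}^τ, a_{k+1}^τ)`. Rewards are known functions of
these. Only steps `1, …, H` and the final state `s_{H+1}` matter. -/
abbrev Dataset (S A : Type*) (K : ℕ) := Fin K → ℕ → S × A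

/-- The pair `(s_h^τ, a_h^τ)`, for `h ≥ 1`. -/
def Dataset.pair {S A : Type*} {K : ℕ} (data : Dataset S A K) (τ : Fin K) (h : ℕ) : S × A :=
  data τ (h - 1)

/-- The weighted norm `‖v‖_B = √(vᵀ B v)`. -/
def weightedNorm {d : ℕ} (B : Matrix (Fin d) (Fin d) ℝ) (v : Fin d → ℝ) : ℝ :=
  √(v ⬝ᵥ (B.mulVec v))

/-- Clipping to the interval `[0, b]`. -/
def clip (b x : ℝ) : ℝ := max 0 (min x b)

namespace LinearMDP

variable {S A : Type*} [MeasurableSpace S] [MeasurableSpace A] {d H : ℕ}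

/-- The law of `K` i.i.d. trajectories from the nominal environment, with initial distribution
`ρ` and behavior policy `πb`. -/
def dataLaw (M : LinearMDP S A d H) (ρ : Measure S) (πb : Policy S A) (K : ℕ) :
    Measure (Dataset S A K) :=
  Measure.pi fun _ : Fin K => trajLaw M.nominal πb 1 ρ

/-- `Λ_h = ∑_τ φ(s_h^τ,a_h^τ) φ(s_h^τ,a_h^τ)ᵀ + γ I`. -/
def gram (M : LinearMDP S A d H) {K : ℕ} (γ : ℝ) (data : Dataset S A K) (h : ℕ) :
    Matrix (Fin d) (Fin d) ℝ :=
  ∑ τ, Matrix.vecMulVec (M.φ (data.pair τ h)) (M.φ (data.pair τ h)) +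
    γ • (1 : Matrix (Fin d) (Fin d) ℝ)

/-- The ridge regression `argmin_w ∑_τ (y_τ - φ(s_h^τ,a_h^τ)ᵀ w)² + γ ‖w‖²`, in closed form
`Λ_h⁻¹ ∑_τ φ(s_h^τ,a_h^τ) y_τ`. -/
def ridge (M : LinearMDP S A d H) {K : ℕ} (γ : ℝ) (data : Dataset S A K) (h : ℕ)
    (y : Fin K → ℝ) : Fin d → ℝ :=
  (M.gram γ data h)⁻¹.mulVec (∑ τ, y τ • M.φ (data.pair τ h))

/-- The ridge regression of `f(s_{h+1}^τ)` on the features at step `h`. -/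
def ridgeNext (M : LinearMDP S A d H) {K : ℕ} (γ : ℝ) (data : Dataset S A K) (h : ℕ)
    (f : S → ℝ) : Fin d → ℝ :=
  M.ridge γ data h fun τ => f (data.pair τ (h + 1)).1

/-- Parameter estimate `ŵ_h` from the estimated next value function `V`, for each divergence. -/
def wHat (M : LinearMDP S A d H) {K : ℕ} (D : Divergence) (lam γ : ℝ) (data : Dataset S A K)
    (h : ℕ) (V : S → ℝ) : Fin d → ℝ :=
  match D with
  | .tv => M.ridgeNext γ data h fun s => min (V s) ((⨅ s', V s') + lam)
  | .kl => fun i =>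
      -lam * Real.log (max (M.ridgeNext γ data h (fun s => Real.exp (-V s / lam)) i)
        (Real.exp (-(H : ℝ) / lam)))
  | .chiSq => fun i =>
      sSup ((fun α : ℝ =>
          clip H (M.ridgeNext γ data h (fun s => min (V s) α) i) +
          1 / (4 * lam) * clip H (M.ridgeNext γ data h (fun s => min (V s) α) i) ^ 2 -
          1 / (4 * lam) * clip ((H : ℝ) ^ 2) (M.ridgeNext γ data h (fun s => min (V s) α ^ 2) i))
        '' Set.Icc (⨅ s, V s) (⨆ s, V s))

/-- The penalty `Γ_h(s,a) = β ∑_i ‖φ_i(s,a) 1_i‖_{Λ_h⁻¹}`. -/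
def penalty (M : LinearMDP S A d H) {K : ℕ} (γ β : ℝ) (data : Dataset S A K) (h : ℕ)
    (x : S × A) : ℝ :=
  β * ∑ i, weightedNorm (M.gram γ data h)⁻¹ (Pi.single i (M.φ x i))

/-- `Q̂_h(s,a) = min{⟨φ(s,a), θ_h + ŵ_h⟩ - Γ_h(s,a), H - h + 1}⁺`, where `V` is the estimated value
function at step `h + 1`. -/
def qHat (M : LinearMDP S A d H) {K : ℕ} (D : Divergence) (lam γ β : ℝ) (data : Dataset S A K)
    (h : ℕ) (V : S → ℝ) (x : S × A) : ℝ :=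
  clip ((H : ℝ) - h + 1)
    (∑ i, M.φ x i * (M.θ h i + M.wHat D lam γ data h V i) - M.penalty γ β data h x)

/-- `πhat` is an output of robust regularized pessimistic value iteration on `data`: with
`V̂_{H+1} = 0`, backward in `h = H, …, 1`, `πhat_h(· | s)` maximizes `⟨Q̂_h(s,·), π_h(· | s)⟩` over
all action distributions and `V̂_h(s) = ⟨Q̂_h(s,·), πhat_h(· | s)⟩`. -/
def IsOutput (M : LinearMDP S A d H) {K : ℕ} (D : Divergence) (lam γ β : ℝ)
    (data : Dataset S A K) (πhat : Policy S A) : Prop :=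
  ∃ V : ℕ → S → ℝ, (∀ s, V (H + 1) s = 0) ∧ ∀ h ∈ Finset.Icc 1 H, ∀ s,
    (∀ q : ProbabilityMeasure A,
      ∫ a, M.qHat D lam γ β data h (V (h + 1)) (s, a) ∂(q : Measure A) ≤
        ∫ a, M.qHat D lam γ β data h (V (h + 1)) (s, a) ∂(πhat.toKernel h s)) ∧
    V h s = ∫ a, M.qHat D lam γ β data h (V (h + 1)) (s, a) ∂(πhat.toKernel h s)

/-- Robust regularized partial coverage with constant `c` for the optimal policy `πstar`:
`Λ_h ⪰ γ I + K c E^{πstar,P}[φ_i²(s_h,a_h) 1_i 1_iᵀ | s_1 = s]` in the Loewner order, for all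
`h`, `s`, `i` and all `P` in the robustly admissible set. -/
def Coverage (M : LinearMDP S A d H) {K : ℕ} (D : Divergence) (lam γ c : ℝ)
    (πstar : Policy S A) (data : Dataset S A K) : Prop :=
  ∀ h ∈ Finset.Icc 1 H, ∀ s : S, ∀ P ∈ M.admissible D lam, ∀ i : Fin d,
    (M.gram γ data h - (γ • (1 : Matrix (Fin d) (Fin d) ℝ) +
      ((K : ℝ) * c * ∫ ω, M.φ (ω (h - 1)) i ^ 2 ∂(trajLaw P πstar 1 (Measure.dirac s))) •
        Matrix.vecMulVec (Pi.single i 1) (Pi.single i 1))).PosSemidef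

/-- With probability at least `1 - δ` over the dataset: every output `πhat` of the algorithm (run
with `γ = 1` and penalty parameter `β`) satisfies `SubOpt(πhat, s, λ) ≤ B c` for all `s`, for every
optimal policy `πstar` and constant `c > 0` for which robust partial coverage holds. -/
def HighProbBound (M : LinearMDP S A d H) (ρ : Measure S) (πb : Policy S A) (K : ℕ)
    (D : Divergence) (lam β δ : ℝ) (B : ℝ → ℝ) : Prop :=
  ∃ G : Set (Dataset S A K), MeasurableSet G ∧
    1 - δ ≤ (M.dataLaw ρ πb K).real G ∧
    ∀ data ∈ G, ∀ πhat : Policy S A, M.IsOutput D lam 1 β data πhat →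
      ∀ πstar : Policy S A, M.IsOptimal D lam πstar →
      ∀ c : ℝ, 0 < c → M.Coverage D lam 1 c πstar data →
      ∀ s : S, M.subOpt D lam πhat s ≤ B c

end LinearMDP

end RRMDP

end

/-!
The suboptimality bound rests on one structural remark. The penalty `Γ_h(s,a)` equals
`β ∑ i, φ_i(s,a) √(Λ_h⁻¹)_ii`, which is linear in the features. Hence it suffices that each
coordinate of the estimate `ŵ_h` is within `β √(Λ_h⁻¹)_ii` of the robust regularized mean
`inf_μ (E_μ V̂_{h+1} + λ D(μ‖μ⁰_{h,i}))` (`LinearMDP.IsAccurate`), and every estimated value function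
has the form `V̂_h(s) = sup_a clip ⟨φ(s,a), u⟩` with `u ∈ ℝ^d`, a class with a small uniform cover.

*From accuracy to suboptimality* (`IsValueIteration.subOpt_le`). Whatever the factor distributions,
`Q̂_h` is at most the regularized reward plus the expected `V̂_{h+1}`; summing along trajectories,
`V̂` bounds the robust value of the output policy from below (`IsValueIteration.le_value`).
Conversely, for factor distributions nearly minimizing `E_μ V̂_{h+1} + λ D`, the one-step loss is at
most `2 Γ_h` (`IsValueIteration.le_qHat_add`). These transitions are admissible, since
`λ D ≤ sup V̂_{h+1} ≤ sup V⋆_{h+1}`, so partial coverage applies to them: it gives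
`(1 + K c E φ_i²) (Λ_h⁻¹)_ii ≤ 1`, whence `E Γ_h ≤ β d / √(c K)`. No Bellman equation and no
attained infimum are needed.

*Dual formulas.* The robust regularized means are computed in `isRobustMean_tv` (move the mass above
`inf V + λ` to a near-minimizer), `isRobustMean_kl` (Donsker-Varadhan) and `isRobustMean_chiSq` (a
truncated affine density). They express the means through nominal expectations, which ridge
regression estimates.

*Concentration* (`LinearMDP.exists_good_event_value`). The `i`-th ridge coefficient is a weighted sum
of the responses with weights depending on the design only, and
`Λ⁻¹ = Λ⁻¹ (Λ - I) Λ⁻¹ + Λ⁻²` bounds both the sum of the squared weights and the bias by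
`(Λ⁻¹)_ii` (`sum_sq_ridgeWeight_add`). Conditionally on the design the next states are independent,
so Hoeffding's inequality applies coordinate by coordinate. A union bound over steps, coordinates
and a grid of parameters `u`, together with Lipschitz continuity, gives uniformity over all value
functions; the parameters `ξ` of the three divergences absorb the size of the grid.
-/

namespace RRMDP

/-! ### Marginals of the trajectory law -/

section TrajectoryMarginals

variable {S A : Type*} [MeasurableSpace S] [MeasurableSpace A]

instance trajLaw_isProbabilityMeasure (P : Transition S A) (π : Policy S A) (h : ℕ)
    (ρ : Measure S) [IsProbabilityMeasure ρ] : IsProbabilityMeasure (trajLaw P π h ρ) := by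
  unfold trajLaw; infer_instance

lemma trajLaw_map_zero (P : Transition S A) (π : Policy S A) (h : ℕ) (ρ : Measure S)
    [IsProbabilityMeasure ρ] :
    (trajLaw P π h ρ).map (fun ω => ω 0) = ρ ⊗ₘ π.toKernel h := by
  have h0 : (fun ω : ℕ → S × A => ω 0) =
      (fun x : (Finset.Iic 0 → S × A) => x ⟨0, by simp⟩) ∘ Preorder.frestrictLe 0 := rfl
  rw [h0, ← Measure.map_map (by fun_prop) (by fun_prop), trajLaw, Kernel.trajMeasure,
    Measure.map_comp _ _ (by fun_prop), Kernel.traj_map_frestrictLe, Kernel.partialTraj_self,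
    Measure.id_comp, Measure.map_map (by fun_prop) (by fun_prop)]
  exact Measure.map_id

/-- Consecutive state-action pairs are linked by the one-step kernel. -/
lemma trajLaw_map_pair (P : Transition S A) (π : Policy S A) (h : ℕ) (ρ : Measure S)
    [IsProbabilityMeasure ρ] (k : ℕ) :
    (trajLaw P π h ρ).map (fun ω => (ω k, ω (k + 1))) =
      (trajLaw P π h ρ).map (fun ω => ω k) ⊗ₘ stepKernel P π (h + k) := by
  have key := Kernel.map_frestrictLe_trajMeasure_compProd_eq_map_trajMeasure
    (X := fun _ => S × A) (κ := historyKernel P π h) (μ₀ := ρ ⊗ₘ π.toKernel h) (a := k)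
  ext E hE
  have hg : Measurable (fun x : (Finset.Iic k → S × A) × (S × A) =>
    (x.1 ⟨k, by simp⟩, x.2)) := by fun_prop
  have h1 := congrArg (fun m : Measure ((Finset.Iic k → S × A) × (S × A)) =>
    m ((fun x => (x.1 ⟨k, by simp⟩, x.2)) ⁻¹' E)) key
  beta_reduce at h1
  rw [Measure.map_apply (by fun_prop) (hg hE), Measure.compProd_apply (hg hE),
    lintegral_map (Kernel.measurable_kernel_prodMk_left (hg hE)) (by fun_prop)] at h1
  rw [Measure.map_apply (by fun_prop) hE, Measure.compProd_apply hE,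
    lintegral_map (Kernel.measurable_kernel_prodMk_left hE) (by fun_prop)]
  exact h1.symm

lemma trajLaw_lintegral_action (P : Transition S A) (π : Policy S A) (h : ℕ) (ρ : Measure S)
    [IsProbabilityMeasure ρ] (k : ℕ) {g : S × A → ℝ≥0∞} (hg : Measurable g) :
    ∫⁻ ω, g (ω k) ∂(trajLaw P π h ρ) =
      ∫⁻ ω, ∫⁻ a, g ((ω k).1, a) ∂(π.toKernel (h + k) (ω k).1) ∂(trajLaw P π h ρ) := by
  have hg' : ∀ j, Measurable fun s : S => ∫⁻ a, g (s, a) ∂(π.toKernel j s) := fun j =>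
    Measurable.lintegral_kernel_prod_right' hg
  cases k with
  | zero =>
    rw [← lintegral_map (f := g) hg (g := fun ω : ℕ → S × A => ω 0) (by fun_prop),
      ← lintegral_map (f := fun x : S × A => ∫⁻ a, g (x.1, a) ∂(π.toKernel (h + 0) x.1))
        ((hg' _).comp measurable_fst) (g := fun ω : ℕ → S × A => ω 0) (by fun_prop),
      trajLaw_map_zero, Measure.lintegral_compProd hg,
      Measure.lintegral_compProd
        (f := fun x : S × A => ∫⁻ a, g (x.1, a) ∂(π.toKernel (h + 0) x.1))
        ((hg' _).comp measurable_fst)]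
    simp
  | succ k =>
    have main : ∀ f : S × A → ℝ≥0∞, Measurable f → ∫⁻ ω, f (ω (k + 1)) ∂(trajLaw P π h ρ) =
        ∫⁻ x, ∫⁻ s, ∫⁻ a, f (s, a) ∂(π.toKernel (h + k + 1) s) ∂(P.toKernel (h + k) x)
          ∂((trajLaw P π h ρ).map (fun ω => ω k)) := by
      intro f hf
      rw [← lintegral_map (f := fun p : (S × A) × (S × A) => f p.2) (hf.comp measurable_snd)
        (g := fun ω : ℕ → S × A => (ω k, ω (k + 1))) (by fun_prop), trajLaw_map_pair,
        Measure.lintegral_compProd (f := fun p : (S × A) × (S × A) => f p.2)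
          (hf.comp measurable_snd)]
      refine lintegral_congr fun x => ?_
      simp only [stepKernel]
      rw [Kernel.lintegral_comp _ _ _ hf]
      refine lintegral_congr fun s => ?_
      rw [Kernel.lintegral_prod _ _ _ hf, Kernel.id_apply,
        lintegral_dirac' _ (Measurable.lintegral_prod_right' hf)]
    rw [main g hg, main (fun x => ∫⁻ a, g (x.1, a) ∂(π.toKernel (h + (k + 1)) x.1))
      ((hg' _).comp measurable_fst)]
    simp [add_assoc]

lemma trajLaw_lintegral_next (P : Transition S A) (π : Policy S A) (h : ℕ) (ρ : Measure S)
    [IsProbabilityMeasure ρ] (k : ℕ) {f : S → ℝ≥0∞} (hf : Measurable f) :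
    ∫⁻ ω, f (ω (k + 1)).1 ∂(trajLaw P π h ρ) =
      ∫⁻ ω, ∫⁻ s, f s ∂(P.toKernel (h + k) (ω k)) ∂(trajLaw P π h ρ) := by
  have hf1 : Measurable fun p : (S × A) × (S × A) => f p.2.1 := by fun_prop
  rw [← lintegral_map (f := fun p : (S × A) × (S × A) => f p.2.1) hf1
        (g := fun ω : ℕ → S × A => (ω k, ω (k + 1))) (by fun_prop), trajLaw_map_pair,
        Measure.lintegral_compProd hf1, lintegral_map ?_ (by fun_prop)]
  · refine lintegral_congr fun ω => ?_
    have hf2 : Measurable fun p : S × A => f p.1 := by fun_prop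
    simp only [stepKernel]
    rw [Kernel.lintegral_comp _ _ _ hf2]
    refine lintegral_congr fun s => ?_
    rw [Kernel.lintegral_prod _ _ _ hf2, Kernel.id_apply,
        lintegral_dirac' _ (Measurable.lintegral_prod_right' hf2)]
    simp
  · exact Measurable.lintegral_kernel_prod_right' hf1

lemma trajLaw_lintegral_start (P : Transition S A) (π : Policy S A) (h : ℕ) (s : S)
    {f : S → ℝ≥0∞} (hf : Measurable f) :
    ∫⁻ ω, f (ω 0).1 ∂(trajLaw P π h (Measure.dirac s)) = f s := by
  have hf1 : Measurable fun p : S × A => f p.1 := by fun_prop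
  rw [← lintegral_map (f := fun p : S × A => f p.1) hf1
    (g := fun ω : ℕ → S × A => ω 0) (by fun_prop), trajLaw_map_zero,
    Measure.lintegral_compProd hf1]
  simp [lintegral_dirac' _ hf]

end TrajectoryMarginals

/-! ### Dual formulas for the regularized robust mean -/

section RobustMean

variable {S : Type*} [MeasurableSpace S]

/-- `w` is the infimum of `E_μ V + lam * D(μ‖ν)` over probability measures `μ`: a lower bound that
is approached by measures of finite divergence. The infimum need not be attained. -/
structure IsRobustMean (D : Divergence) (lam : ℝ) (ν : ProbabilityMeasure S) (V : S → ℝ)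
    (w : ℝ) : Prop where
  le_add : ∀ μ : ProbabilityMeasure S, D.eval (μ : Measure S) ν ≠ ⊤ →
    w ≤ ∫ s, V s ∂(μ : Measure S) + lam * (D.eval (μ : Measure S) ν).toReal
  exists_le : ∀ ε > 0, ∃ μ : ProbabilityMeasure S, D.eval (μ : Measure S) ν ≠ ⊤ ∧
    ∫ s, V s ∂(μ : Measure S) + lam * (D.eval (μ : Measure S) ν).toReal ≤ w + ε

lemma tvDiv_self (ν : Measure S) : tvDiv ν ν = 0 := by simp [tvDiv]

lemma chiSqDiv_self (ν : Measure S) [SigmaFinite ν] : chiSqDiv ν ν = 0 := by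
  rw [chiSqDiv, if_pos Measure.AbsolutelyContinuous.rfl,
    lintegral_eq_zero_iff (by fun_prop)]
  filter_upwards [ν.rnDeriv_self] with x hx
  simp [hx]

lemma Divergence.eval_self (D : Divergence) (ν : Measure S) [SigmaFinite ν] :
    D.eval ν ν = 0 := by
  cases D with
  | tv => exact tvDiv_self ν
  | kl => exact InformationTheory.klDiv_self ν
  | chiSq => exact chiSqDiv_self ν

lemma integrable_of_mem_Icc {μ : Measure S} [IsFiniteMeasure μ] {V : S → ℝ} (hV : Measurable V)
    {a b : ℝ} (h : ∀ s, V s ∈ Set.Icc a b) : Integrable V μ :=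
  Integrable.of_mem_Icc a b hV.aemeasurable (Filter.Eventually.of_forall h)

/-- Total variation controls differences of means of `[0,1]`-valued functions (layer cake). -/
lemma lintegral_le_add_tvDiv (μ ν : Measure S) [IsProbabilityMeasure μ] [IsProbabilityMeasure ν]
    {g : S → ℝ} (hg : Measurable g) (h0 : ∀ s, 0 ≤ g s) (h1 : ∀ s, g s ≤ 1) :
    ∫⁻ s, ENNReal.ofReal (g s) ∂ν ≤ ∫⁻ s, ENNReal.ofReal (g s) ∂μ + tvDiv μ ν := by
  have split : ∀ m : Measure S, ∫⁻ s, ENNReal.ofReal (g s) ∂m =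
      ∫⁻ t in Set.Ioc (0 : ℝ) 1, m {s | t < g s} := by
    intro m
    rw [lintegral_eq_lintegral_meas_lt m (Filter.Eventually.of_forall h0) hg.aemeasurable,
      ← Set.Ioc_union_Ioi_eq_Ioi zero_le_one, lintegral_union measurableSet_Ioi
        (Set.Ioc_disjoint_Ioi le_rfl)]
    have : ∫⁻ t in Set.Ioi (1 : ℝ), m {s | t < g s} = 0 := by
      rw [setLIntegral_congr_fun (g := fun _ => 0) measurableSet_Ioi]
      · simp
      · intro t ht
        have : {s | t < g s} = ∅ := by
          ext s; simpa using (h1 s).trans (le_of_lt ht)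
        simp [this]
    rw [this, add_zero]
  rw [split, split]
  calc ∫⁻ t in Set.Ioc (0 : ℝ) 1, ν {s | t < g s}
      ≤ ∫⁻ t in Set.Ioc (0 : ℝ) 1, (μ {s | t < g s} + tvDiv μ ν) := by
        refine lintegral_mono fun t => ?_
        have hE : MeasurableSet {s | t < g s} := measurableSet_lt measurable_const hg
        have h2 : ENNReal.ofReal |μ.real {s | t < g s} - ν.real {s | t < g s}| ≤ tvDiv μ ν :=
          le_iSup₂ (f := fun (E : Set S) (_ : MeasurableSet E) =>
            ENNReal.ofReal |μ.real E - ν.real E|) _ hE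
        refine le_trans ?_ (add_le_add_right h2 _)
        rw [← ofReal_measureReal (μ := μ), ← ofReal_measureReal (μ := ν),
          ← ENNReal.ofReal_add measureReal_nonneg (abs_nonneg _)]
        refine ENNReal.ofReal_le_ofReal ?_
        have := neg_abs_le (μ.real {s | t < g s} - ν.real {s | t < g s})
        linarith
    _ = _ := by
        rw [lintegral_add_right _ measurable_const]
        simp

lemma integral_le_add_tvDiv (μ ν : ProbabilityMeasure S) {g : S → ℝ} (hg : Measurable g)
    (h0 : ∀ s, 0 ≤ g s) (h1 : ∀ s, g s ≤ 1) (hfin : tvDiv (μ : Measure S) ν ≠ ⊤) :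
    ∫ s, g s ∂(ν : Measure S) ≤
      ∫ s, g s ∂(μ : Measure S) + (tvDiv (μ : Measure S) ν).toReal := by
  have hi : ∀ m : ProbabilityMeasure S, Integrable g (m : Measure S) := fun m =>
    integrable_of_mem_Icc hg (fun s => ⟨h0 s, h1 s⟩)
  have key := lintegral_le_add_tvDiv (μ : Measure S) ν hg h0 h1
  rw [← ofReal_integral_eq_lintegral_ofReal (hi ν) (Filter.Eventually.of_forall h0),
    ← ofReal_integral_eq_lintegral_ofReal (hi μ) (Filter.Eventually.of_forall h0),
    ← ENNReal.ofReal_toReal hfin,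
    ← ENNReal.ofReal_add (integral_nonneg h0) ENNReal.toReal_nonneg] at key
  exact (ENNReal.ofReal_le_ofReal_iff
    (add_nonneg (integral_nonneg h0) ENNReal.toReal_nonneg)).1 key

lemma tvDiv_le_of_forall {μ ν : Measure S} {p : ℝ}
    (h : ∀ E, MeasurableSet E → |μ.real E - ν.real E| ≤ p) : tvDiv μ ν ≤ ENNReal.ofReal p :=
  iSup₂_le fun E hE => ENNReal.ofReal_le_ofReal (h E hE)

/-- Dual formula for total variation: the worst case moves all mass sitting above level
`inf V + lam` to a near-minimizer of `V`. -/
lemma isRobustMean_tv [Nonempty S] {lam : ℝ} (hlam : 0 < lam) (ν : ProbabilityMeasure S)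
    {V : S → ℝ} (hV : Measurable V) {b : ℝ} (hb : ∀ s, V s ∈ Set.Icc 0 b) :
    IsRobustMean .tv lam ν V (∫ s, min (V s) ((⨅ s', V s') + lam) ∂(ν : Measure S)) := by
  have hbdd : BddBelow (Set.range V) := ⟨0, by rintro _ ⟨s, rfl⟩; exact (hb s).1⟩
  set m := ⨅ s', V s' with hm
  have hmV : ∀ s, m ≤ V s := fun s => ciInf_le hbdd s
  have hm0 : 0 ≤ m := le_ciInf fun s => (hb s).1
  set f : S → ℝ := fun s => min (V s) (m + lam) with hf
  have hfm : Measurable f := hV.min measurable_const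
  have hfI : ∀ s, f s ∈ Set.Icc m (m + lam) := fun s =>
    ⟨le_min (hmV s) (by linarith), min_le_right _ _⟩
  have hVi : ∀ μ : ProbabilityMeasure S, Integrable V (μ : Measure S) := fun μ =>
    integrable_of_mem_Icc hV hb
  have hfi : ∀ μ : ProbabilityMeasure S, Integrable f (μ : Measure S) := fun μ =>
    integrable_of_mem_Icc hfm hfI
  refine ⟨fun μ hμ => ?_, fun ε hε => ?_⟩
  · have key := integral_le_add_tvDiv μ ν (g := fun s => (f s - m) / lam)
      ((hfm.sub measurable_const).div_const _)
      (fun s => div_nonneg (by linarith [(hfI s).1]) hlam.le)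
      (fun s => by rw [div_le_one hlam]; linarith [(hfI s).2]) hμ
    have e : ∀ μ : ProbabilityMeasure S, ∫ s, (f s - m) / lam ∂(μ : Measure S) =
        ((∫ s, f s ∂(μ : Measure S)) - m) / lam := fun μ => by
      rw [integral_div, integral_sub (hfi μ) (integrable_const _)]; simp
    rw [e, e, div_le_iff₀ hlam, add_mul, div_mul_cancel₀ _ hlam.ne'] at key
    have h2 : ∫ s, f s ∂(μ : Measure S) ≤ ∫ s, V s ∂(μ : Measure S) :=
      integral_mono (hfi μ) (hVi μ) fun s => min_le_left _ _
    have : (Divergence.tv.eval (μ : Measure S) ν) = tvDiv (μ : Measure S) ν := rfl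
    rw [this]; linarith
  · obtain ⟨x0, hx0⟩ : ∃ x, V x < m + ε := exists_lt_of_ciInf_lt (by linarith)
    set G : Set S := {s | V s ≤ m + lam} with hG
    have hGm : MeasurableSet G := measurableSet_le hV measurable_const
    set p : ℝ := (ν : Measure S).real Gᶜ with hp
    set μ0 : Measure S := (ν : Measure S).restrict G + (ν : Measure S) Gᶜ • Measure.dirac x0
      with hμ0
    have hprob : IsProbabilityMeasure μ0 := ⟨by
      simp only [hμ0, Measure.add_apply, Measure.smul_apply, Measure.restrict_apply_univ,
        smul_eq_mul, measure_univ, mul_one]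
      rw [measure_add_measure_compl hGm, measure_univ]⟩
    have hp0 : 0 ≤ p := measureReal_nonneg
    have htv : tvDiv μ0 ν ≤ ENNReal.ofReal p := by
      refine tvDiv_le_of_forall fun E hE => ?_
      have h1 : μ0.real E = (ν : Measure S).real (E ∩ G) + p * (Measure.dirac x0).real E := by
        have hh : (Measure.dirac x0 : Measure S) E ≠ ⊤ := measure_ne_top _ _
        simp only [measureReal_def, hμ0, Measure.add_apply, Measure.smul_apply, smul_eq_mul,
          Measure.restrict_apply hE, hp]
        rw [ENNReal.toReal_add (measure_ne_top _ _)
          (ENNReal.mul_ne_top (measure_ne_top _ _) hh), ENNReal.toReal_mul]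
      have h2 : (ν : Measure S).real E =
          (ν : Measure S).real (E ∩ G) + (ν : Measure S).real (E ∩ Gᶜ) := by
        rw [← Set.sdiff_eq, measureReal_inter_add_sdiff hGm]
      have h3 : (ν : Measure S).real (E ∩ Gᶜ) ≤ p := measureReal_mono Set.inter_subset_right
      have h4 : 0 ≤ (ν : Measure S).real (E ∩ Gᶜ) := measureReal_nonneg
      have h5 : (Measure.dirac x0 : Measure S).real E ≤ 1 := measureReal_le_one
      have h6 : 0 ≤ (Measure.dirac x0 : Measure S).real E := measureReal_nonneg
      rw [h1, h2, abs_le]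
      constructor <;> nlinarith
    have hfin : tvDiv μ0 ν ≠ ⊤ := ne_top_of_le_ne_top ENNReal.ofReal_ne_top htv
    refine ⟨⟨μ0, hprob⟩, hfin, ?_⟩
    have htv' : (tvDiv μ0 (ν : Measure S)).toReal ≤ p := ENNReal.toReal_le_of_le_ofReal hp0 htv
    have hIV : ∫ s, V s ∂μ0 = (∫ s in G, V s ∂(ν : Measure S)) + p * V x0 := by
      rw [hμ0, integral_add_measure (hVi ν).restrict
        (((integrable_of_mem_Icc hV hb)).smul_measure (measure_ne_top _ _)),
        integral_smul_measure, integral_dirac' _ _ hV.stronglyMeasurable]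
      rfl
    have hIf : ∫ s, f s ∂(ν : Measure S) =
        (∫ s in G, V s ∂(ν : Measure S)) + p * (m + lam) := by
      rw [← integral_add_compl hGm (hfi ν)]
      congr 1
      · refine setIntegral_congr_fun hGm fun s hs => ?_
        exact min_eq_left hs
      · rw [setIntegral_congr_fun (g := fun _ => m + lam) hGm.compl]
        · simp [hp]
        · intro s hs
          have : ¬ V s ≤ m + lam := hs
          exact min_eq_right (not_le.1 this).le
    have hpl : p ≤ 1 := measureReal_le_one
    change ∫ s, V s ∂μ0 + lam * (tvDiv μ0 (ν : Measure S)).toReal ≤ _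
    rw [hIV, hIf]
    nlinarith

/-- Dual formula for the Kullback-Leibler divergence: the Donsker-Varadhan (Gibbs) variational
principle. -/
lemma isRobustMean_kl {lam : ℝ} (hlam : 0 < lam) (ν : ProbabilityMeasure S)
    {V : S → ℝ} (hV : Measurable V) {b : ℝ} (hb : ∀ s, V s ∈ Set.Icc 0 b) :
    IsRobustMean .kl lam ν V
      (-lam * Real.log (∫ s, Real.exp (-V s / lam) ∂(ν : Measure S))) := by
  set g : S → ℝ := fun s => -V s / lam with hg
  have hgm : Measurable g := hV.neg.div_const _
  have hgi : ∀ μ : ProbabilityMeasure S, Integrable g (μ : Measure S) := fun μ =>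
    ((integrable_of_mem_Icc hV hb).neg).div_const _
  have hint : ∀ μ : ProbabilityMeasure S, ∫ s, V s ∂(μ : Measure S) =
      -lam * ∫ s, g s ∂(μ : Measure S) := fun μ => by
    rw [← integral_const_mul]
    refine integral_congr_ae (Filter.Eventually.of_forall fun s => ?_)
    simp only [hg]; field_simp
  have hei : Integrable (fun s => Real.exp (g s)) (ν : Measure S) := by
    refine integrable_of_mem_Icc hgm.exp (a := 0) (b := 1) fun s => ⟨(Real.exp_pos _).le, ?_⟩
    rw [Real.exp_le_one_iff]
    exact div_nonpos_of_nonpos_of_nonneg (by linarith [(hb s).1]) hlam.le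
  have hprob : IsProbabilityMeasure ((ν : Measure S).tilted g) := isProbabilityMeasure_tilted hei
  refine ⟨fun μ hμ => ?_, fun ε hε => ?_⟩
  · obtain ⟨hac, hllr⟩ := InformationTheory.klDiv_ne_top_iff.1 hμ
    have h1 := integral_llr_tilted_right hac (hgi μ) hei hllr
    have h2 := InformationTheory.integral_llr_add_sub_measure_univ_nonneg
      (hac.trans (absolutelyContinuous_tilted hei))
      (integrable_llr_tilted_right hac (hgi μ) hllr hei)
    have h3 : (Divergence.kl.eval (μ : Measure S) ν).toReal =
        ∫ s, llr (μ : Measure S) ν s ∂(μ : Measure S) :=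
      InformationTheory.toReal_klDiv_of_measure_eq hac (by simp)
    simp only [probReal_univ, add_sub_cancel_right] at h2
    rw [h3, hint]
    nlinarith
  · set μ : ProbabilityMeasure S := ⟨(ν : Measure S).tilted g, hprob⟩ with hμ
    have hac : (μ : Measure S) ≪ ν := tilted_absolutelyContinuous _ _
    have hl : llr (μ : Measure S) ν =ᵐ[(μ : Measure S)]
        fun s => g s - Real.log (∫ s, Real.exp (g s) ∂(ν : Measure S)) :=
      hac.ae_le (log_rnDeriv_tilted_left_self hei)
    have hli : Integrable (llr (μ : Measure S) ν) (μ : Measure S) := by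
      rw [integrable_congr hl]
      exact (hgi μ).sub (integrable_const _)
    refine ⟨μ, InformationTheory.klDiv_ne_top hac hli, ?_⟩
    have h3 : (Divergence.kl.eval (μ : Measure S) ν).toReal =
        ∫ s, llr (μ : Measure S) ν s ∂(μ : Measure S) :=
      InformationTheory.toReal_klDiv_of_measure_eq hac (by simp)
    rw [h3, integral_congr_ae hl, integral_sub (hgi μ) (integrable_const _), hint]
    simp only [integral_const, probReal_univ, smul_eq_mul, one_mul]
    have : (fun s => Real.exp (g s)) = fun s => Real.exp (-V s / lam) := rfl
    nlinarith

/-- The `χ²` dual objective at truncation level `α`. -/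
noncomputable def chiObjective (lam : ℝ) (ν : Measure S) (V : S → ℝ) (α : ℝ) : ℝ :=
  ∫ s, min (V s) α ∂ν + 1 / (4 * lam) * (∫ s, min (V s) α ∂ν) ^ 2 -
    1 / (4 * lam) * ∫ s, min (V s) α ^ 2 ∂ν

/-- Weak duality for `χ²`: with `f = dμ/dν`, `Y = min V α` and `e = E Y`, integrate the inequality
`(f - 1) (Y - e) + lam (f - 1)² + (Y - e)² / (4 lam) ≥ 0`, a completed square. -/
lemma chiObjective_le {lam : ℝ} (hlam : 0 < lam) (μ ν : ProbabilityMeasure S)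
    {V : S → ℝ} (hV : Measurable V) {b : ℝ} (hb : ∀ s, V s ∈ Set.Icc 0 b)
    (hμ : chiSqDiv (μ : Measure S) ν ≠ ⊤) {α : ℝ} (hα : 0 ≤ α) :
    chiObjective lam ν V α ≤
      ∫ s, V s ∂(μ : Measure S) + lam * (chiSqDiv (μ : Measure S) ν).toReal := by
  have hac : (μ : Measure S) ≪ ν := by
    by_contra h; exact hμ (by simp [chiSqDiv, h])
  set f : S → ℝ := fun s => ((μ : Measure S).rnDeriv ν s).toReal with hf
  have hfm : Measurable f := (Measure.measurable_rnDeriv _ _).ennreal_toReal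
  have hchi : chiSqDiv (μ : Measure S) ν =
      ∫⁻ x, ENNReal.ofReal ((f x - 1) ^ 2) ∂(ν : Measure S) := by
    simp [chiSqDiv, hac, hf]
  have hsqm : Measurable fun s => (f s - 1) ^ 2 := (hfm.sub measurable_const).pow_const 2
  have hsq : Integrable (fun s => (f s - 1) ^ 2) (ν : Measure S) := by
    refine ⟨hsqm.aestronglyMeasurable, ?_⟩
    rw [hasFiniteIntegral_iff_ofReal (Filter.Eventually.of_forall fun s => sq_nonneg _)]
    exact lt_top_iff_ne_top.2 (hchi ▸ hμ)
  have hchi' : (chiSqDiv (μ : Measure S) ν).toReal = ∫ s, (f s - 1) ^ 2 ∂(ν : Measure S) := by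
    rw [hchi, integral_eq_lintegral_of_nonneg_ae (Filter.Eventually.of_forall fun s => sq_nonneg _)
      hsqm.aestronglyMeasurable]
  have hfi : Integrable f (ν : Measure S) := Measure.integrable_toReal_rnDeriv
  have hf1 : ∫ s, f s ∂(ν : Measure S) = 1 := by
    have := Measure.integral_toReal_rnDeriv hac
    simpa using this
  set Y : S → ℝ := fun s => min (V s) α with hY
  have hYm : Measurable Y := hV.min measurable_const
  have hYI : ∀ s, Y s ∈ Set.Icc 0 b := fun s =>
    ⟨le_min (hb s).1 hα, (min_le_left _ _).trans (hb s).2⟩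
  have hYi : Integrable Y (ν : Measure S) := integrable_of_mem_Icc hYm hYI
  have hY2i : Integrable (fun s => Y s ^ 2) (ν : Measure S) :=
    integrable_of_mem_Icc (hYm.pow_const 2) (a := 0) (b := b ^ 2) fun s =>
      ⟨sq_nonneg _, pow_le_pow_left₀ (hYI s).1 (hYI s).2 2⟩
  have hfYi : Integrable (fun s => f s * Y s) (ν : Measure S) := by
    refine hfi.mul_bdd (c := b) hYm.aestronglyMeasurable (Filter.Eventually.of_forall fun s => ?_)
    rw [Real.norm_eq_abs, abs_of_nonneg (hYI s).1]; exact (hYI s).2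
  have hμY : ∫ s, Y s ∂(μ : Measure S) = ∫ s, f s * Y s ∂(ν : Measure S) := by
    rw [← integral_rnDeriv_smul hac]; rfl
  have hμV : ∫ s, Y s ∂(μ : Measure S) ≤ ∫ s, V s ∂(μ : Measure S) :=
    integral_mono (integrable_of_mem_Icc hYm hYI) (integrable_of_mem_Icc hV hb)
      fun s => min_le_left _ _
  set e := ∫ s, Y s ∂(ν : Measure S) with he
  have hpt : ∀ s, 0 ≤ f s * Y s - Y s - e * f s + e + lam * (f s - 1) ^ 2
      + 1 / (4 * lam) * (Y s ^ 2 - 2 * e * Y s + e ^ 2) := by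
    intro s
    have : f s * Y s - Y s - e * f s + e + lam * (f s - 1) ^ 2
      + 1 / (4 * lam) * (Y s ^ 2 - 2 * e * Y s + e ^ 2) =
      lam * ((f s - 1) + (Y s - e) / (2 * lam)) ^ 2 := by
      field_simp; ring
    rw [this]; positivity
  have hnn : 0 ≤ ∫ s, (f s * Y s - Y s - e * f s + e + lam * (f s - 1) ^ 2
      + 1 / (4 * lam) * (Y s ^ 2 - 2 * e * Y s + e ^ 2)) ∂(ν : Measure S) := integral_nonneg hpt
  have i1 := (hfYi.sub hYi).sub (hfi.const_mul e)
  have i2 := i1.add (integrable_const e)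
  have i3 := i2.add (hsq.const_mul lam)
  have i4 := (hY2i.sub (hYi.const_mul (2 * e))).add (integrable_const (e ^ 2))
  have hcalc : ∫ s, (f s * Y s - Y s - e * f s + e + lam * (f s - 1) ^ 2
      + 1 / (4 * lam) * (Y s ^ 2 - 2 * e * Y s + e ^ 2)) ∂(ν : Measure S) =
      (∫ s, f s * Y s ∂(ν : Measure S)) - e - e * 1 + e +
        lam * (∫ s, (f s - 1) ^ 2 ∂(ν : Measure S)) +
        1 / (4 * lam) * ((∫ s, Y s ^ 2 ∂(ν : Measure S)) - 2 * e * e + e ^ 2) := by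
    rw [integral_add (by exact i3) (by exact i4.const_mul _),
      integral_add (by exact i2) (by exact hsq.const_mul lam),
      integral_add (by exact i1) (integrable_const e),
      integral_sub (by exact hfYi.sub hYi) (by exact hfi.const_mul e),
      integral_sub hfYi hYi, integral_const_mul, integral_const_mul, integral_const_mul,
      integral_add (by exact hY2i.sub (hYi.const_mul (2 * e))) (integrable_const _),
      integral_sub hY2i (by exact hYi.const_mul _), integral_const_mul, hf1]
    simp [he]
  rw [hcalc] at hnn
  rw [hchi', chiObjective]
  change e + 1 / (4 * lam) * e ^ 2 - 1 / (4 * lam) * ∫ s, Y s ^ 2 ∂(ν : Measure S) ≤ _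
  nlinarith

lemma continuous_integral_min (ν : ProbabilityMeasure S) {V : S → ℝ} (hV : Measurable V) {b : ℝ}
    (hb : ∀ s, V s ∈ Set.Icc 0 b) : Continuous fun α => ∫ s, min (V s) α ∂(ν : Measure S) := by
  have hi : ∀ α, Integrable (fun s => min (V s) α) (ν : Measure S) := fun α =>
    (integrable_of_mem_Icc hV hb).inf (integrable_const α)
  refine (LipschitzWith.of_dist_le_mul (K := 1) fun α β => ?_).continuous
  rw [Real.dist_eq, Real.dist_eq, ← integral_sub (hi α) (hi β)]
  have := norm_integral_le_of_norm_le_const (μ := (ν : Measure S)) (C := |α - β|)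
    (f := fun s => min (V s) α - min (V s) β) (Filter.Eventually.of_forall fun s => ?_)
  · simpa using this
  · have := abs_min_sub_min_le_max (V s) α (V s) β
    simpa using this

/-- Dual formula for `χ²`. The worst-case density is `1 - (min V α - E min V α) / (2 lam)`, where
the level `α` is found by the intermediate value theorem so that it vanishes on `{V > α}`. -/
lemma isRobustMean_chiSq [Nonempty S] {lam : ℝ} (hlam : 0 < lam) (ν : ProbabilityMeasure S)
    {V : S → ℝ} (hV : Measurable V) {b : ℝ} (hb : ∀ s, V s ∈ Set.Icc 0 b) :
    IsRobustMean .chiSq lam ν V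
      (sSup (chiObjective lam (ν : Measure S) V '' Set.Icc (⨅ s, V s) (⨆ s, V s))) := by
  have hbelow : BddBelow (Set.range V) := ⟨0, by rintro _ ⟨s, rfl⟩; exact (hb s).1⟩
  have habove : BddAbove (Set.range V) := ⟨b, by rintro _ ⟨s, rfl⟩; exact (hb s).2⟩
  set m := ⨅ s', V s' with hm
  set M := ⨆ s', V s' with hM
  have hmV : ∀ s, m ≤ V s := fun s => ciInf_le hbelow s
  have hVM : ∀ s, V s ≤ M := fun s => le_ciSup habove s
  have hm0 : 0 ≤ m := le_ciInf fun s => (hb s).1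
  have hmM : m ≤ M := (hmV (Classical.arbitrary S)).trans (hVM _)
  have hle : ∀ μ : ProbabilityMeasure S, chiSqDiv (μ : Measure S) ν ≠ ⊤ →
      ∀ α ∈ Set.Icc m M, chiObjective lam ν V α ≤
        ∫ s, V s ∂(μ : Measure S) + lam * (chiSqDiv (μ : Measure S) ν).toReal :=
    fun μ hμ α hα => chiObjective_le hlam μ ν hV hb hμ (hm0.trans hα.1)
  refine ⟨fun μ hμ => ?_, fun ε hε => ?_⟩
  · refine csSup_le ((Set.nonempty_Icc.2 hmM).image _) ?_
    rintro _ ⟨α, hα, rfl⟩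
    exact hle μ hμ α hα
  · have hbdd : BddAbove (chiObjective lam (ν : Measure S) V '' Set.Icc m M) := by
      refine ⟨∫ s, V s ∂(ν : Measure S) + lam * (chiSqDiv (ν : Measure S) ν).toReal, ?_⟩
      rintro _ ⟨α, hα, rfl⟩
      exact hle ν (by simp [chiSqDiv_self]) α hα
    have hcont := continuous_integral_min ν hV hb
    obtain ⟨α, hα, hα1, hα2⟩ : ∃ α ∈ Set.Icc m M,
        α - ∫ s, min (V s) α ∂(ν : Measure S) ≤ 2 * lam ∧
        (α - ∫ s, min (V s) α ∂(ν : Measure S) = 2 * lam ∨ ∀ s, V s ≤ α) := by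
      by_cases hcase : M - ∫ s, min (V s) M ∂(ν : Measure S) ≤ 2 * lam
      · exact ⟨M, ⟨hmM, le_rfl⟩, hcase, Or.inr hVM⟩
      · have h0 : m - ∫ s, min (V s) m ∂(ν : Measure S) = 0 := by
          simp [hmV]
        obtain ⟨α, hα, hα'⟩ := intermediate_value_Icc hmM
          (f := fun α => α - ∫ s, min (V s) α ∂(ν : Measure S))
          (continuous_id.sub hcont).continuousOn
          (show 2 * lam ∈ _ from ⟨by rw [h0]; positivity, (not_le.1 hcase).le⟩)
        exact ⟨α, hα, le_of_eq hα', Or.inl hα'⟩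
    set Y : S → ℝ := fun s => min (V s) α with hY
    set e := ∫ s, Y s ∂(ν : Measure S) with he
    have hYm : Measurable Y := hV.min measurable_const
    have hYI : ∀ s, Y s ∈ Set.Icc 0 b := fun s =>
      ⟨le_min (hb s).1 (hm0.trans hα.1), (min_le_left _ _).trans (hb s).2⟩
    have hYi : Integrable Y (ν : Measure S) := integrable_of_mem_Icc hYm hYI
    have hY2i : Integrable (fun s => Y s ^ 2) (ν : Measure S) :=
      integrable_of_mem_Icc (hYm.pow_const 2) (a := 0) (b := b ^ 2) fun s =>
        ⟨sq_nonneg _, pow_le_pow_left₀ (hYI s).1 (hYI s).2 2⟩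
    set f : S → ℝ := fun s => 1 - (Y s - e) / (2 * lam) with hf
    have hfm : Measurable f := by fun_prop
    have hf0 : ∀ s, 0 ≤ f s := fun s => by
      have h1 : Y s ≤ α := min_le_right _ _
      have h2 : (Y s - e) / (2 * lam) ≤ 1 := by
        rw [div_le_one (by positivity)]
        have : α - e ≤ 2 * lam := hα1
        linarith
      simp only [hf]; linarith
    have hfV : ∀ s, f s * V s = f s * Y s := fun s => by
      rcases le_or_gt (V s) α with h | h
      · simp only [hY, min_eq_left h]
      · rcases hα2 with h' | h'
        · have h'' : α - e = 2 * lam := h'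
          have hY' : Y s = α := min_eq_right h.le
          have : f s = 0 := by
            simp only [hf, hY', h'']
            rw [div_self (by positivity), sub_self]
          simp [this]
        · exact absurd (h' s) (not_le.2 h)
    have hfi : Integrable f (ν : Measure S) :=
      (integrable_const _).sub ((hYi.sub (integrable_const _)).div_const _)
    have hf1 : ∫ s, f s ∂(ν : Measure S) = 1 := by
      simp only [hf]
      rw [integral_sub (integrable_const _)
          (by exact (hYi.sub (integrable_const _)).div_const _),
        integral_div, integral_sub hYi (integrable_const _)]
      simp [he]
    set μ0 : Measure S := (ν : Measure S).withDensity fun s => ENNReal.ofReal (f s) with hμ0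
    have hfm' : Measurable fun s => ENNReal.ofReal (f s) := hfm.ennreal_ofReal
    have hprob : IsProbabilityMeasure μ0 := ⟨by
      rw [hμ0, withDensity_apply _ MeasurableSet.univ, setLIntegral_univ,
        ← ofReal_integral_eq_lintegral_ofReal hfi (Filter.Eventually.of_forall hf0), hf1,
        ENNReal.ofReal_one]⟩
    have hac : μ0 ≪ ν := withDensity_absolutelyContinuous _ _
    have hrn : μ0.rnDeriv ν =ᵐ[(ν : Measure S)] fun s => ENNReal.ofReal (f s) :=
      Measure.rnDeriv_withDensity _ hfm'
    have hsqi : Integrable (fun s => (f s - 1) ^ 2) (ν : Measure S) := by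
      have : (fun s => (f s - 1) ^ 2) =
          fun s => 1 / (4 * lam ^ 2) * (Y s ^ 2 - 2 * e * Y s + e ^ 2) := by
        ext s; simp only [hf]; field_simp; ring
      rw [this]
      exact ((hY2i.sub (hYi.const_mul _)).add (integrable_const _)).const_mul _
    have hchi : chiSqDiv μ0 ν = ENNReal.ofReal (∫ s, (f s - 1) ^ 2 ∂(ν : Measure S)) := by
      rw [chiSqDiv, if_pos hac,
        ofReal_integral_eq_lintegral_ofReal hsqi (Filter.Eventually.of_forall fun s => sq_nonneg _)]
      refine lintegral_congr_ae ?_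
      filter_upwards [hrn] with s hs
      rw [hs, ENNReal.toReal_ofReal (hf0 s)]
    have hchiI : ∫ s, (f s - 1) ^ 2 ∂(ν : Measure S) =
        1 / (4 * lam ^ 2) * ((∫ s, Y s ^ 2 ∂(ν : Measure S)) - e ^ 2) := by
      have : (fun s => (f s - 1) ^ 2) =
          fun s => 1 / (4 * lam ^ 2) * (Y s ^ 2 - 2 * e * Y s + e ^ 2) := by
        ext s; simp only [hf]; field_simp; ring
      rw [this, integral_const_mul, integral_add (by exact hY2i.sub (hYi.const_mul _))
        (integrable_const _), integral_sub hY2i (by exact hYi.const_mul _), integral_const_mul]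
      simp only [integral_const, probReal_univ, smul_eq_mul, one_mul]
      ring
    have hEV : ∫ s, V s ∂μ0 = e - 1 / (2 * lam) * ((∫ s, Y s ^ 2 ∂(ν : Measure S)) - e ^ 2) := by
      rw [hμ0, integral_withDensity_eq_integral_toReal_smul hfm'
        (Filter.Eventually.of_forall fun s => ENNReal.ofReal_lt_top)]
      have : (fun s => (ENNReal.ofReal (f s)).toReal • V s) =
          fun s => Y s - 1 / (2 * lam) * (Y s ^ 2 - e * Y s) := by
        ext s
        rw [ENNReal.toReal_ofReal (hf0 s), smul_eq_mul, hfV s]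
        simp only [hf]; field_simp
      rw [this, integral_sub hYi (by exact (hY2i.sub (hYi.const_mul _)).const_mul _),
        integral_const_mul, integral_sub hY2i (by exact hYi.const_mul _), integral_const_mul,
        ← pow_two]
    refine ⟨⟨μ0, hprob⟩, ?_, ?_⟩
    · change chiSqDiv μ0 ν ≠ ⊤
      rw [hchi]; exact ENNReal.ofReal_ne_top
    · change ∫ s, V s ∂μ0 + lam * (chiSqDiv μ0 ν).toReal ≤ _
      have hsup : chiObjective lam ν V α ≤ sSup (chiObjective lam (ν : Measure S) V '' Set.Icc m M) :=
        le_csSup hbdd ⟨α, hα, rfl⟩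
      rw [hchi, ENNReal.toReal_ofReal (integral_nonneg fun s => sq_nonneg _), hchiI, hEV]
      have : chiObjective lam ν V α =
        e + 1 / (4 * lam) * e ^ 2 - 1 / (4 * lam) * ∫ s, Y s ^ 2 ∂(ν : Measure S) := rfl
      rw [this] at hsup
      have e1 : e - 1 / (2 * lam) * ((∫ s, Y s ^ 2 ∂(ν : Measure S)) - e ^ 2) +
          lam * (1 / (4 * lam ^ 2) * ((∫ s, Y s ^ 2 ∂(ν : Measure S)) - e ^ 2)) =
          e + 1 / (4 * lam) * e ^ 2 - 1 / (4 * lam) * ∫ s, Y s ^ 2 ∂(ν : Measure S) := by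
        field_simp; ring
      linarith

namespace IsRobustMean

variable {D : Divergence} {lam : ℝ} {ν : ProbabilityMeasure S} {V : S → ℝ} {w : ℝ}

lemma le_integral (hw : IsRobustMean D lam ν V w) : w ≤ ∫ s, V s ∂(ν : Measure S) := by
  simpa [Divergence.eval_self] using hw.le_add ν (by simp [Divergence.eval_self])

lemma nonneg (hlam : 0 ≤ lam) (hw : IsRobustMean D lam ν V w) (hV : ∀ s, 0 ≤ V s) : 0 ≤ w := by
  refine le_of_forall_pos_le_add fun ε hε => ?_
  obtain ⟨μ, -, hμ⟩ := hw.exists_le ε hε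
  exact le_trans (add_nonneg (integral_nonneg hV)
    (mul_nonneg hlam ENNReal.toReal_nonneg)) hμ

/-- Near-minimizers can be chosen with `lam * D(μ‖ν)` at most the mean of `V` under `ν`: either `ν`
itself is a near-minimizer, or a better one has a regularized mean at most that of `ν`. -/
lemma exists_near (hw : IsRobustMean D lam ν V w) (hV : ∀ s, 0 ≤ V s) {ε : ℝ} (hε : 0 < ε) :
    ∃ μ : ProbabilityMeasure S, D.eval (μ : Measure S) ν ≠ ⊤ ∧
      ∫ s, V s ∂(μ : Measure S) + lam * (D.eval (μ : Measure S) ν).toReal ≤ w + ε ∧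
      lam * (D.eval (μ : Measure S) ν).toReal ≤ ∫ s, V s ∂(ν : Measure S) := by
  by_cases h : ∫ s, V s ∂(ν : Measure S) ≤ w + ε
  · refine ⟨ν, by simp [Divergence.eval_self], by simpa [Divergence.eval_self] using h, ?_⟩
    simpa [Divergence.eval_self] using integral_nonneg hV
  · obtain ⟨μ, hμ, hμ'⟩ := hw.exists_le ε hε
    refine ⟨μ, hμ, hμ', ?_⟩
    have : 0 ≤ ∫ s, V s ∂(μ : Measure S) := integral_nonneg hV
    linarith [not_le.1 h]

end IsRobustMean

end RobustMean

/-! ### Ridge regression with a fixed design -/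

section Ridge

variable {d K : ℕ}

/-- The regularized Gram matrix `∑ τ, x τ (x τ)ᵀ + I` of a design `x`. -/
def designGram (x : Fin K → Fin d → ℝ) : Matrix (Fin d) (Fin d) ℝ :=
  ∑ τ, Matrix.vecMulVec (x τ) (x τ) + (1 : ℝ) • (1 : Matrix (Fin d) (Fin d) ℝ)

/-- The `i`-th diagonal entry of the inverse Gram matrix. -/
noncomputable def invDiag (x : Fin K → Fin d → ℝ) (i : Fin d) : ℝ := (designGram x)⁻¹ i i

/-- The weight with which observation `τ` enters the `i`-th ridge coefficient. -/
noncomputable def ridgeWeight (x : Fin K → Fin d → ℝ) (i : Fin d) (τ : Fin K) : ℝ :=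
  ((designGram x)⁻¹.mulVec (x τ)) i

lemma designGram_posDef (x : Fin K → Fin d → ℝ) : (designGram x).PosDef := by
  unfold designGram
  rw [one_smul]
  refine Matrix.PosDef.posSemidef_add (Matrix.posSemidef_sum _ fun τ _ => ?_) Matrix.PosDef.one
  simpa using Matrix.posSemidef_vecMulVec_self_star (x τ)

lemma designGram_isUnit (x : Fin K → Fin d → ℝ) : IsUnit (designGram x).det :=
  (Matrix.isUnit_iff_isUnit_det _).1 (designGram_posDef x).isUnit

lemma invGram_symm (x : Fin K → Fin d → ℝ) (i j : Fin d) :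
    (designGram x)⁻¹ i j = (designGram x)⁻¹ j i := by
  have := (designGram_posDef x).inv.isHermitian.apply i j
  simpa using this.symm

lemma invDiag_pos (x : Fin K → Fin d → ℝ) (i : Fin d) : 0 < invDiag x i :=
  (designGram_posDef x).inv.diag_pos

lemma invGram_mulVec (x : Fin K → Fin d → ℝ) (w : Fin d → ℝ) (i : Fin d) :
    ∑ τ, ridgeWeight x i τ * (x τ ⬝ᵥ w) + ((designGram x)⁻¹.mulVec w) i = w i := by
  have h : (designGram x)⁻¹.mulVec ((designGram x).mulVec w) = w := by
    rw [Matrix.mulVec_mulVec, Matrix.nonsing_inv_mul _ (designGram_isUnit x), Matrix.one_mulVec]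
  have h2 : (designGram x).mulVec w = ∑ τ, (x τ ⬝ᵥ w) • x τ + w := by
    unfold designGram
    rw [one_smul, Matrix.add_mulVec, Matrix.one_mulVec, Matrix.sum_mulVec]
    congr 1
    refine Finset.sum_congr rfl fun τ _ => ?_
    rw [Matrix.vecMulVec_mulVec]
    ext; simp [mul_comm]
  rw [h2, Matrix.mulVec_add, Matrix.mulVec_sum] at h
  have := congrFun h i
  simp only [Pi.add_apply, Finset.sum_apply, Matrix.mulVec_smul, Pi.smul_apply, smul_eq_mul] at this
  rw [← this]
  simp [ridgeWeight, mul_comm]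

/-- The identity `Λ⁻¹ = Λ⁻¹ (Λ - I) Λ⁻¹ + Λ⁻²` on the diagonal: it bounds both the variance proxy
and the bias of ridge regression by `(Λ⁻¹)_ii`. -/
lemma sum_sq_ridgeWeight_add (x : Fin K → Fin d → ℝ) (i : Fin d) :
    ∑ τ, ridgeWeight x i τ ^ 2 + ∑ j, (designGram x)⁻¹ i j ^ 2 = invDiag x i := by
  have h := invGram_mulVec x (fun j => (designGram x)⁻¹ j i) i
  rw [invDiag, ← h]
  congr 1
  · refine Finset.sum_congr rfl fun τ _ => ?_
    rw [pow_two]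
    congr 1
    simp only [ridgeWeight, Matrix.mulVec, dotProduct]
    refine Finset.sum_congr rfl fun j _ => ?_
    rw [invGram_symm, mul_comm]
  · simp only [Matrix.mulVec, dotProduct]
    refine Finset.sum_congr rfl fun j _ => ?_
    rw [invGram_symm x j i, pow_two]

lemma sum_sq_ridgeWeight_le (x : Fin K → Fin d → ℝ) (i : Fin d) :
    ∑ τ, ridgeWeight x i τ ^ 2 ≤ invDiag x i := by
  have := sum_sq_ridgeWeight_add x i
  have : 0 ≤ ∑ j, (designGram x)⁻¹ i j ^ 2 := Finset.sum_nonneg fun _ _ => sq_nonneg _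
  linarith

lemma sum_sq_invGram_le (x : Fin K → Fin d → ℝ) (i : Fin d) :
    ∑ j, (designGram x)⁻¹ i j ^ 2 ≤ invDiag x i := by
  have := sum_sq_ridgeWeight_add x i
  have : 0 ≤ ∑ τ, ridgeWeight x i τ ^ 2 := Finset.sum_nonneg fun _ _ => sq_nonneg _
  linarith

lemma invDiag_le_one (x : Fin K → Fin d → ℝ) (i : Fin d) : invDiag x i ≤ 1 := by
  have h1 := sum_sq_invGram_le x i
  have h2 : invDiag x i ^ 2 ≤ ∑ j, (designGram x)⁻¹ i j ^ 2 :=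
    Finset.single_le_sum (f := fun j => (designGram x)⁻¹ i j ^ 2)
      (fun _ _ => sq_nonneg _) (Finset.mem_univ i)
  nlinarith [invDiag_pos x i]

lemma sqrt_invDiag_le_one (x : Fin K → Fin d → ℝ) (i : Fin d) : √(invDiag x i) ≤ 1 := by
  exact Real.sqrt_le_one.2 (invDiag_le_one x i)

lemma abs_invGram_mulVec_le (x : Fin K → Fin d → ℝ) (i : Fin d) {w : Fin d → ℝ} {b : ℝ}
    (hb : 0 ≤ b) (hw : ∀ j, |w j| ≤ b) :
    |((designGram x)⁻¹.mulVec w) i| ≤ b * √(d : ℝ) * √(invDiag x i) := by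
  have h1 := Finset.sum_mul_sq_le_sq_mul_sq Finset.univ (fun j => (designGram x)⁻¹ i j) w
  have h2 : ∑ j, w j ^ 2 ≤ d * b ^ 2 := by
    calc ∑ j, w j ^ 2 ≤ ∑ _j : Fin d, b ^ 2 :=
          Finset.sum_le_sum fun j _ => sq_le_sq' (abs_le.1 (hw j)).1 (abs_le.1 (hw j)).2
      _ = _ := by simp
  have h3 := sum_sq_invGram_le x i
  have hq := (invDiag_pos x i).le
  refine abs_le_of_sq_le_sq ?_ (by positivity)
  rw [mul_pow, mul_pow, Real.sq_sqrt hq, Real.sq_sqrt (Nat.cast_nonneg d)]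
  calc _ ≤ (∑ j, (designGram x)⁻¹ i j ^ 2) * ∑ j, w j ^ 2 := h1
    _ ≤ invDiag x i * (d * b ^ 2) :=
        mul_le_mul h3 h2 (Finset.sum_nonneg fun _ _ => sq_nonneg _) hq
    _ = _ := by ring

lemma sum_abs_ridgeWeight_le (x : Fin K → Fin d → ℝ) (i : Fin d) :
    ∑ τ, |ridgeWeight x i τ| ≤ √(K : ℝ) * √(invDiag x i) := by
  have hq := (invDiag_pos x i).le
  refine le_of_sq_le_sq ?_ (by positivity)
  rw [mul_pow, Real.sq_sqrt hq, Real.sq_sqrt (Nat.cast_nonneg K)]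
  have h := sq_sum_le_card_mul_sum_sq (s := Finset.univ) (f := fun τ => |ridgeWeight x i τ|)
  simp only [sq_abs, Finset.card_univ, Fintype.card_fin] at h
  exact h.trans (mul_le_mul_of_nonneg_left (sum_sq_ridgeWeight_le x i) (Nat.cast_nonneg K))

lemma abs_sum_ridgeWeight_mul_le (x : Fin K → Fin d → ℝ) (i : Fin d) {y : Fin K → ℝ} {b : ℝ}
    (hb : 0 ≤ b) (hy : ∀ τ, |y τ| ≤ b) :
    |∑ τ, ridgeWeight x i τ * y τ| ≤ b * √(K : ℝ) * √(invDiag x i) := by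
  calc |∑ τ, ridgeWeight x i τ * y τ| ≤ ∑ τ, |ridgeWeight x i τ * y τ| :=
        Finset.abs_sum_le_sum_abs _ _
    _ ≤ ∑ τ, |ridgeWeight x i τ| * b := Finset.sum_le_sum fun τ _ => by
        rw [abs_mul]; exact mul_le_mul_of_nonneg_left (hy τ) (abs_nonneg _)
    _ = (∑ τ, |ridgeWeight x i τ|) * b := by rw [Finset.sum_mul]
    _ ≤ (√(K : ℝ) * √(invDiag x i)) * b :=
        mul_le_mul_of_nonneg_right (sum_abs_ridgeWeight_le x i) hb
    _ = _ := by ring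

/-- Loewner lower bounds on the Gram matrix turn into upper bounds on the inverse diagonal. -/
lemma invDiag_le_of_posSemidef (x : Fin K → Fin d → ℝ) (i : Fin d) {a : ℝ}
    (h : (designGram x - ((1 : ℝ) • (1 : Matrix (Fin d) (Fin d) ℝ) +
      a • Matrix.vecMulVec (Pi.single i 1) (Pi.single i 1))).PosSemidef) :
    (1 + a) * invDiag x i ≤ 1 := by
  set v : Fin d → ℝ := fun j => (designGram x)⁻¹ j i with hv
  have hΛv : (designGram x).mulVec v = Pi.single i 1 := by
    have h1 : v = (designGram x)⁻¹.mulVec (Pi.single i 1) := by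
      ext j; simp [hv]
    rw [h1, Matrix.mulVec_mulVec, Matrix.mul_nonsing_inv _ (designGram_isUnit x),
      Matrix.one_mulVec]
  have h2 := h.dotProduct_mulVec_nonneg v
  rw [Matrix.sub_mulVec, hΛv, one_smul, Matrix.add_mulVec, Matrix.one_mulVec, Matrix.smul_mulVec,
    Matrix.vecMulVec_mulVec] at h2
  simp only [star_trivial, dotProduct_sub, dotProduct_add, dotProduct_single_one,
    single_one_dotProduct, dotProduct_smul, smul_eq_mul, op_smul_eq_smul] at h2
  have h3 : invDiag x i ^ 2 ≤ v ⬝ᵥ v := by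
    have := Finset.single_le_sum (f := fun j => v j * v j)
      (fun _ _ => mul_self_nonneg _) (Finset.mem_univ i)
    rw [pow_two]; exact this
  have h4 : v i = invDiag x i := rfl
  rw [h4] at h2
  have hq := invDiag_pos x i
  by_contra hcon
  nlinarith

lemma weightedNorm_single (x : Fin K → Fin d → ℝ) (i : Fin d) {v : ℝ} (hv : 0 ≤ v) :
    weightedNorm (designGram x)⁻¹ (Pi.single i v) = v * √(invDiag x i) := by
  unfold weightedNorm
  rw [Matrix.mulVec_single, single_dotProduct]
  simp only [Matrix.col_apply, Pi.smul_apply, MulOpposite.smul_eq_mul_unop, MulOpposite.unop_op]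
  rw [show v * ((designGram x)⁻¹ i i * v) = v ^ 2 * invDiag x i by rw [invDiag]; ring,
    Real.sqrt_mul (sq_nonneg v), Real.sqrt_sq hv]

lemma measurable_invGram (i j : Fin d) :
    Measurable fun x : Fin K → Fin d → ℝ => (designGram x)⁻¹ i j := by
  have hG : Continuous fun x : Fin K → Fin d → ℝ => designGram x := by
    unfold designGram
    refine (continuous_finsetSum _ fun τ _ => ?_).add continuous_const
    exact (continuous_apply τ).matrix_vecMulVec (continuous_apply τ)
  have hadj : Measurable fun x : Fin K → Fin d → ℝ => (designGram x).adjugate i j :=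
    ((hG.matrix_adjugate).matrix_elem i j).measurable
  have hdet : Measurable fun x : Fin K → Fin d → ℝ => (designGram x).det :=
    hG.matrix_det.measurable
  have : (fun x : Fin K → Fin d → ℝ => (designGram x)⁻¹ i j) =
      fun x => (designGram x).det⁻¹ * (designGram x).adjugate i j := by
    ext x
    rw [Matrix.inv_def, Ring.inverse_eq_inv', Matrix.smul_apply, smul_eq_mul]
  rw [this]
  exact hdet.inv.mul hadj

lemma measurable_invDiag (i : Fin d) :
    Measurable fun x : Fin K → Fin d → ℝ => invDiag x i := measurable_invGram i i

lemma measurable_ridgeWeight (i : Fin d) (τ : Fin K) :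
    Measurable fun x : Fin K → Fin d → ℝ => ridgeWeight x i τ := by
  unfold ridgeWeight Matrix.mulVec dotProduct
  refine Finset.measurable_fun_sum _ fun j _ => (measurable_invGram i j).mul ?_
  exact (measurable_pi_apply j).comp (measurable_pi_apply τ)

end Ridge

/-! ### Concentration of ridge noise, conditionally on the design -/

section Concentration

variable {X Y : Type*} [MeasurableSpace X] [MeasurableSpace Y] {K : ℕ}

/-- Independent draws `y τ ∼ κ (x τ)`, as a kernel in the design `x`. -/
noncomputable def piKernel (K : ℕ) (κ : Kernel X Y) [IsMarkovKernel κ] :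
    Kernel (Fin K → X) (Fin K → Y) where
  toFun x := Measure.pi fun τ => κ (x τ)
  measurable' := by
    refine Measurable.measure_of_isPiSystem_of_isProbabilityMeasure generateFrom_pi.symm
      isPiSystem_pi ?_
    rintro _ ⟨E, hE, rfl⟩
    simp only [Measure.pi_pi]
    refine Finset.measurable_fun_prod _ fun τ _ => ?_
    exact (κ.measurable_coe (hE τ (Set.mem_univ τ))).comp (measurable_pi_apply τ)

instance (κ : Kernel X Y) [IsMarkovKernel κ] : IsMarkovKernel (piKernel K κ) :=
  ⟨fun x => inferInstanceAs (IsProbabilityMeasure (Measure.pi fun τ => κ (x τ)))⟩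

/-- A sample of i.i.d. pairs can be drawn by sampling the design first and then, independently,
the responses. -/
lemma map_compProd_piKernel (m : Measure X) [IsProbabilityMeasure m] (κ : Kernel X Y)
    [IsMarkovKernel κ] :
    ((Measure.pi fun _ : Fin K => m) ⊗ₘ piKernel K κ).map (fun p τ => (p.1 τ, p.2 τ)) =
      Measure.pi fun _ : Fin K => m ⊗ₘ κ := by
  symm
  refine Measure.pi_eq fun E hE => ?_
  have hE' : MeasurableSet (Set.univ.pi E) := MeasurableSet.univ_pi hE
  have hmeas : Measurable fun (p : (Fin K → X) × (Fin K → Y)) (τ : Fin K) => (p.1 τ, p.2 τ) := by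
    fun_prop
  rw [Measure.map_apply hmeas hE', Measure.compProd_apply (hmeas hE')]
  have h1 : ∀ x : Fin K → X, piKernel K κ x (Prod.mk x ⁻¹'
      ((fun (p : (Fin K → X) × (Fin K → Y)) (τ : Fin K) => (p.1 τ, p.2 τ)) ⁻¹' Set.univ.pi E)) =
      ∏ τ, κ (x τ) (Prod.mk (x τ) ⁻¹' E τ) := by
    intro x
    have : (Prod.mk x ⁻¹' ((fun (p : (Fin K → X) × (Fin K → Y)) (τ : Fin K) =>
        (p.1 τ, p.2 τ)) ⁻¹' Set.univ.pi E)) = Set.univ.pi fun τ => Prod.mk (x τ) ⁻¹' E τ := by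
      ext y; simp
    rw [this]
    exact Measure.pi_pi _ _
  simp only [h1]
  have hf : ∀ τ, Measurable fun a : X => κ a (Prod.mk a ⁻¹' E τ) := fun τ =>
    Kernel.measurable_kernel_prodMk_left (hE τ)
  rw [lintegral_prod_eq_prod_lintegral_of_indepFun Finset.univ
    (fun τ (x : Fin K → X) => κ (x τ) (Prod.mk (x τ) ⁻¹' E τ))
    (iIndepFun_pi (X := fun τ a => κ a (Prod.mk a ⁻¹' E τ)) fun τ => (hf τ).aemeasurable)
    (fun τ => (hf τ).comp (measurable_pi_apply τ))]
  refine Finset.prod_congr rfl fun τ _ => ?_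
  rw [Measure.compProd_apply (hE τ)]
  exact (measurePreserving_eval (fun _ : Fin K => m) τ).lintegral_comp (hf τ)

/-- A bound on the probability of an event that holds conditionally on every design holds
unconditionally. -/
lemma pi_compProd_apply_le (m : Measure X) [IsProbabilityMeasure m] (κ : Kernel X Y)
    [IsMarkovKernel κ] {B : Set (Fin K → X × Y)} (hB : MeasurableSet B) {p : ℝ≥0∞}
    (h : ∀ x : Fin K → X, Measure.pi (fun τ => κ (x τ)) {y | (fun τ => (x τ, y τ)) ∈ B} ≤ p) :
    (Measure.pi fun _ : Fin K => m ⊗ₘ κ) B ≤ p := by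
  have hmeas : Measurable fun (p : (Fin K → X) × (Fin K → Y)) (τ : Fin K) => (p.1 τ, p.2 τ) := by
    fun_prop
  rw [← map_compProd_piKernel, Measure.map_apply hmeas hB, Measure.compProd_apply (hmeas hB)]
  calc _ ≤ ∫⁻ _x, p ∂(Measure.pi fun _ : Fin K => m) := lintegral_mono fun x => h x
    _ = p := by simp

/-- Hoeffding's inequality for weighted sums of independent bounded variables. -/
lemma measure_abs_weighted_sum_ge_le (μ : Fin K → Measure Y) [∀ τ, IsProbabilityMeasure (μ τ)]
    {f : Y → ℝ} (hf : Measurable f) {b : ℝ} (hb : ∀ y, f y ∈ Set.Icc 0 b) (hb0 : 0 < b)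
    (c : Fin K → ℝ) {q : ℝ} (hq : 0 < q) (hc : ∑ τ, c τ ^ 2 ≤ q) {t : ℝ} (ht : 0 ≤ t) :
    (Measure.pi μ).real {y | t * √q ≤ |∑ τ, c τ * (f (y τ) - ∫ z, f z ∂(μ τ))|} ≤
      2 * Real.exp (-2 * t ^ 2 / b ^ 2) := by
  set Z : Fin K → Y → ℝ := fun τ y => c τ * (f y - ∫ z, f z ∂(μ τ)) with hZ
  have hZm : ∀ τ, Measurable (Z τ) := fun τ => (hf.sub_const _).const_mul _
  set v : ℝ := q * (b / 2) ^ 2 with hv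
  have hv0 : 0 < v := by positivity
  have hsub : HasSubgaussianMGF (fun y : Fin K → Y => ∑ τ, Z τ (y τ)) ⟨v, hv0.le⟩
      (Measure.pi μ) := by
    have hind : iIndepFun (fun τ (y : Fin K → Y) => Z τ (y τ)) (Measure.pi μ) :=
      iIndepFun_pi fun τ => (hZm τ).aemeasurable
    let cc : Fin K → NNReal := fun τ => ⟨c τ ^ 2, sq_nonneg _⟩
    have h1 : ∀ τ, HasSubgaussianMGF (fun y : Fin K → Y => Z τ (y τ))
        (cc τ * (‖b - 0‖₊ / 2) ^ 2) (Measure.pi μ) := by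
      intro τ
      have h2 := (hasSubgaussianMGF_of_mem_Icc (μ := μ τ) hf.aemeasurable
        (Filter.Eventually.of_forall hb)).const_mul (c τ)
      refine HasSubgaussianMGF.of_map (Y := fun y : Fin K → Y => y τ) (X := Z τ)
        (measurable_pi_apply τ).aemeasurable ?_
      rw [(measurePreserving_eval μ τ).map_eq]
      exact h2
    have h3 := HasSubgaussianMGF.sum_of_iIndepFun hind (s := Finset.univ) fun τ _ => h1 τ
    refine ⟨h3.integrable_exp_mul, fun s => (h3.mgf_le s).trans ?_⟩
    rw [Real.exp_le_exp]
    have h4 : ((∑ τ, cc τ * (‖b - 0‖₊ / 2) ^ 2 : NNReal) : ℝ) =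
        (∑ τ, c τ ^ 2) * (b / 2) ^ 2 := by
      push_cast
      rw [Finset.sum_mul]
      refine Finset.sum_congr rfl fun τ _ => ?_
      have h5 : (cc τ : ℝ) = c τ ^ 2 := rfl
      simp [h5, abs_of_pos hb0]
    rw [h4]
    change _ ≤ v * s ^ 2 / 2
    gcongr
    exact mul_le_mul_of_nonneg_right hc (sq_nonneg _)
  have hε : 0 ≤ t * √q := by positivity
  have hexp : Real.exp (-(t * √q) ^ 2 / (2 * v)) = Real.exp (-2 * t ^ 2 / b ^ 2) := by
    congr 1
    rw [mul_pow, Real.sq_sqrt hq.le, hv]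
    field_simp
  have hp := hsub.measure_ge_le hε
  have hn := hsub.neg.measure_ge_le hε
  change _ ≤ Real.exp (-(t * √q) ^ 2 / (2 * v)) at hp
  change _ ≤ Real.exp (-(t * √q) ^ 2 / (2 * v)) at hn
  rw [hexp] at hp hn
  calc _ ≤ (Measure.pi μ).real ({y | t * √q ≤ ∑ τ, Z τ (y τ)} ∪
        {y | t * √q ≤ (-fun y : Fin K → Y => ∑ τ, Z τ (y τ)) y}) := by
        refine measureReal_mono fun y hy => ?_
        rcases le_abs.1 (show t * √q ≤ |∑ τ, Z τ (y τ)| from hy) with h | h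
        · exact Or.inl h
        · exact Or.inr h
    _ ≤ _ := measureReal_union_le _ _
    _ ≤ _ := by linarith

end Concentration

section DataLaw

variable {S A : Type*} [MeasurableSpace S] [MeasurableSpace A] {d H K : ℕ}

lemma stepKernel_map_fst (P : Transition S A) (π : Policy S A) (h : ℕ) (x : S × A) :
    (stepKernel P π h x).map Prod.fst = P.toKernel h x := by
  ext E hE
  rw [Measure.map_apply measurable_fst hE, stepKernel, Kernel.comp_apply' _ _ _ (measurable_fst hE)]
  have : ∀ s, (Kernel.id ×ₖ π.toKernel (h + 1)) s (Prod.fst ⁻¹' E) = E.indicator 1 s := by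
    intro s
    rw [Kernel.prod_apply, Kernel.id_apply,
      show (Prod.fst ⁻¹' E : Set (S × A)) = E ×ˢ Set.univ by ext; simp, Measure.prod_prod]
    simp [Measure.dirac_apply' _ hE]
  simp only [this]
  rw [lintegral_indicator_one hE]

lemma trajLaw_map_transition (P : Transition S A) (π : Policy S A) (h : ℕ) (ρ : Measure S)
    [IsProbabilityMeasure ρ] (k : ℕ) :
    (trajLaw P π h ρ).map (fun ω => (ω k, (ω (k + 1)).1)) =
      (trajLaw P π h ρ).map (fun ω => ω k) ⊗ₘ P.toKernel (h + k) := by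
  have h0 : (fun ω : ℕ → S × A => (ω k, (ω (k + 1)).1)) =
      (fun p : (S × A) × (S × A) => (p.1, p.2.1)) ∘ fun ω => (ω k, ω (k + 1)) := rfl
  have hg : Measurable fun p : (S × A) × (S × A) => (p.1, p.2.1) := by fun_prop
  rw [h0, ← Measure.map_map hg (by fun_prop), trajLaw_map_pair]
  ext E hE
  rw [Measure.map_apply hg hE, Measure.compProd_apply (hg hE), Measure.compProd_apply hE]
  refine lintegral_congr fun x => ?_
  rw [← stepKernel_map_fst P π (h + k) x,
    Measure.map_apply measurable_fst (measurable_prodMk_left hE)]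
  rfl

namespace LinearMDP

lemma integral_linearTransition (M : LinearMDP S A d H) (μ : Factors S d) (h : ℕ) (x : S × A)
    {f : S → ℝ} (hf : ∀ i, Integrable f (μ h i : Measure S)) :
    ∫ s, f s ∂((M.linearTransition μ).toKernel h x) =
      M.φ x ⬝ᵥ fun i => ∫ s, f s ∂(μ h i : Measure S) := by
  change ∫ s, f s ∂(∑ i, ENNReal.ofReal (M.φ x i) • (μ h i : Measure S)) = _
  rw [integral_finsetSum_measure fun i _ => (hf i).smul_measure ENNReal.ofReal_ne_top]
  simp only [integral_smul_measure, dotProduct, smul_eq_mul]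
  exact Finset.sum_congr rfl fun i _ => by rw [ENNReal.toReal_ofReal (M.φ_nonneg x i)]

/-- The features observed at step `h`. -/
def design (M : LinearMDP S A d H) (data : Dataset S A K) (h : ℕ) : Fin K → Fin d → ℝ :=
  fun τ => M.φ (data.pair τ h)

/-- The nominal means of `f` under the factor distributions at step `h`. -/
noncomputable def nominalMean (M : LinearMDP S A d H) (h : ℕ) (f : S → ℝ) (i : Fin d) : ℝ :=
  ∫ s, f s ∂(M.μ₀ h i : Measure S)

/-- The noise in the `i`-th ridge coefficient when regressing `f(s_{h+1})` at step `h`. -/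
noncomputable def ridgeNoise (M : LinearMDP S A d H) (data : Dataset S A K) (h : ℕ) (f : S → ℝ)
    (i : Fin d) : ℝ :=
  ∑ τ, ridgeWeight (M.design data h) i τ *
    (f (data.pair τ (h + 1)).1 - M.design data h τ ⬝ᵥ M.nominalMean h f)

lemma measurable_design (M : LinearMDP S A d H) (h : ℕ) :
    Measurable fun data : Dataset S A K => M.design data h := by
  refine measurable_pi_lambda _ fun τ => M.measurable_φ.comp ?_
  exact (measurable_pi_apply (h - 1)).comp (measurable_pi_apply τ)

lemma measurable_ridgeNoise (M : LinearMDP S A d H) (h : ℕ) {f : S → ℝ} (hf : Measurable f)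
    (i : Fin d) : Measurable fun data : Dataset S A K => M.ridgeNoise data h f i := by
  unfold ridgeNoise
  refine Finset.measurable_fun_sum _ fun τ _ => ?_
  refine ((measurable_ridgeWeight i τ).comp (M.measurable_design h)).mul (Measurable.sub ?_ ?_)
  · exact hf.comp (measurable_fst.comp
      ((measurable_pi_apply (h + 1 - 1)).comp (measurable_pi_apply τ)))
  · unfold dotProduct
    refine Finset.measurable_fun_sum _ fun j _ => Measurable.mul_const ?_ _
    exact (measurable_pi_apply j).comp ((measurable_pi_apply τ).comp (M.measurable_design h))

/-- The event that the noise in the `i`-th coefficient exceeds `t √(Λ_h⁻¹)_ii`. -/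
def noiseEvent (M : LinearMDP S A d H) (K h : ℕ) (f : S → ℝ) (i : Fin d) (t : ℝ) :
    Set (Dataset S A K) :=
  {data | t * √(invDiag (M.design data h) i) ≤ |M.ridgeNoise data h f i|}

lemma measurableSet_noiseEvent (M : LinearMDP S A d H) (h : ℕ) {f : S → ℝ} (hf : Measurable f)
    (i : Fin d) (t : ℝ) : MeasurableSet (M.noiseEvent K h f i t) :=
  measurableSet_le
    (((measurable_invDiag i).comp (M.measurable_design h)).sqrt.const_mul t)
    (M.measurable_ridgeNoise h hf i).abs

/-- Given the design, the weights in the noise are fixed and sum up in squares to at most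
`(Λ_h⁻¹)_ii`, while the next states are independent; so Hoeffding's inequality applies directly. -/
lemma dataLaw_noiseEvent_le (M : LinearMDP S A d H) (ρ : ProbabilityMeasure S) (πb : Policy S A)
    {h : ℕ} (hh : 1 ≤ h) {f : S → ℝ} (hf : Measurable f) {b : ℝ} (hb0 : 0 < b)
    (hb : ∀ s, f s ∈ Set.Icc 0 b) (i : Fin d) {t : ℝ} (ht : 0 ≤ t) :
    (M.dataLaw ρ πb K).real (M.noiseEvent K h f i t) ≤ 2 * Real.exp (-2 * t ^ 2 / b ^ 2) := by
  obtain ⟨k, rfl⟩ : ∃ k, h = k + 1 := ⟨h - 1, by omega⟩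
  set m := (trajLaw M.nominal πb 1 (ρ : Measure S)).map (fun ω => ω k) with hm
  have : IsProbabilityMeasure m := Measure.isProbabilityMeasure_map (measurable_pi_apply k).aemeasurable
  set B : Set (Fin K → (S × A) × S) := {z | t * √(invDiag (fun τ => M.φ (z τ).1) i) ≤
    |∑ τ, ridgeWeight (fun τ => M.φ (z τ).1) i τ *
      (f (z τ).2 - M.φ (z τ).1 ⬝ᵥ M.nominalMean (k + 1) f)|} with hB
  have hφ : Measurable fun (z : Fin K → (S × A) × S) (τ : Fin K) => M.φ (z τ).1 :=
    measurable_pi_lambda _ fun τ => M.measurable_φ.comp (by fun_prop)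
  have hBm : MeasurableSet B := by
    refine measurableSet_le (((measurable_invDiag i).comp hφ).sqrt.const_mul t)
      (Measurable.abs (Finset.measurable_fun_sum _ fun τ _ => ?_))
    refine ((measurable_ridgeWeight i τ).comp hφ).mul ((hf.comp (by fun_prop)).sub ?_)
    unfold dotProduct
    refine Finset.measurable_fun_sum _ fun j _ => Measurable.mul_const ?_ _
    exact (measurable_pi_apply j).comp ((measurable_pi_apply τ).comp hφ)
  have hpush : (M.dataLaw ρ πb K).map (fun data τ => (data τ k, (data τ (k + 1)).1)) =
      Measure.pi fun _ : Fin K => m ⊗ₘ M.nominal.toKernel (k + 1) := by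
    rw [dataLaw, Measure.pi_map_pi (f := fun _ (ω : ℕ → S × A) => (ω k, (ω (k + 1)).1))
      (by fun_prop), trajLaw_map_transition, add_comm 1 k]
  have hset : M.noiseEvent K (k + 1) f i t =
      (fun (data : Dataset S A K) τ => (data τ k, (data τ (k + 1)).1)) ⁻¹' B := rfl
  rw [hset, measureReal_def, ← Measure.map_apply (by fun_prop) hBm, hpush]
  refine ENNReal.toReal_le_of_le_ofReal (by positivity) (pi_compProd_apply_le _ _ hBm fun x => ?_)
  have key := measure_abs_weighted_sum_ge_le (fun τ => M.nominal.toKernel (k + 1) (x τ)) hf hb hb0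
    (ridgeWeight (fun τ => M.φ (x τ)) i) (invDiag_pos (fun τ => M.φ (x τ)) i)
    (sum_sq_ridgeWeight_le _ i) ht
  rw [measureReal_def] at key
  refine le_trans (le_of_eq ?_) ((ENNReal.le_ofReal_iff_toReal_le (measure_ne_top _ _)
    (by positivity)).2 key)
  congr 1
  ext y
  simp only [hB, Set.mem_ofPred_eq]
  have : ∀ τ, ∫ z, f z ∂(M.nominal.toKernel (k + 1) (x τ)) =
      M.φ (x τ) ⬝ᵥ M.nominalMean (k + 1) f := fun τ =>
    M.integral_linearTransition M.μ₀ (k + 1) (x τ) fun j => integrable_of_mem_Icc hf hb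
  simp only [this]

end LinearMDP

end DataLaw

/-! ### Uniform concentration over value functions -/

section Uniform

variable {S A : Type*} [MeasurableSpace S] [MeasurableSpace A] {d H K : ℕ}

lemma clip_mem_Icc {b : ℝ} (hb : 0 ≤ b) (x : ℝ) : clip b x ∈ Set.Icc 0 b :=
  ⟨le_max_left _ _, max_le hb (min_le_right _ _)⟩

lemma abs_clip_sub_clip_le (b x y : ℝ) : |clip b x - clip b y| ≤ |x - y| := by
  unfold clip
  refine (abs_max_sub_max_le_max _ _ _ _).trans ?_
  simp only [sub_self, abs_zero]
  refine max_le (abs_nonneg _) ((abs_min_sub_min_le_max _ _ _ _).trans ?_)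
  simp

lemma clip_of_mem {b x : ℝ} (h : x ∈ Set.Icc 0 b) : clip b x = x := by
  rw [clip, min_eq_left h.2, max_eq_right h.1]

lemma abs_ciSup_sub_ciSup_le {ι : Type*} [Nonempty ι] {f g : ι → ℝ} (hf : BddAbove (Set.range f))
    (hg : BddAbove (Set.range g)) {ε : ℝ} (h : ∀ i, |f i - g i| ≤ ε) :
    |(⨆ i, f i) - ⨆ i, g i| ≤ ε := by
  rw [abs_le]
  constructor
  · have : (⨆ i, g i) ≤ (⨆ i, f i) + ε := ciSup_le fun i => by
      linarith [(abs_le.1 (h i)).1, le_ciSup hf i]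
    linarith
  · have : (⨆ i, f i) ≤ (⨆ i, g i) + ε := ciSup_le fun i => by
      linarith [(abs_le.1 (h i)).2, le_ciSup hg i]
    linarith

lemma abs_ciInf_sub_ciInf_le {ι : Type*} [Nonempty ι] {f g : ι → ℝ} (hf : BddBelow (Set.range f))
    (hg : BddBelow (Set.range g)) {ε : ℝ} (h : ∀ i, |f i - g i| ≤ ε) :
    |(⨅ i, f i) - ⨅ i, g i| ≤ ε := by
  rw [abs_le]
  constructor
  · have : (⨅ i, g i) - ε ≤ (⨅ i, f i) := le_ciInf fun i => by
      linarith [(abs_le.1 (h i)).1, ciInf_le hg i]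
    linarith
  · have : (⨅ i, f i) - ε ≤ (⨅ i, g i) := le_ciInf fun i => by
      linarith [(abs_le.1 (h i)).2, ciInf_le hf i]
    linarith

/-- The cell of mesh `η` of the interval `[-B, B]` that contains `x`; only meaningful on that
interval. -/
noncomputable def gridCell (B η x : ℝ) : Fin (⌊2 * B / η⌋₊ + 1) :=
  Fin.ofNat _ ⌊(x + B) / η⌋₊

lemma abs_sub_le_of_gridCell_eq {B η x y : ℝ} (hη : 0 < η) (hx : |x| ≤ B) (hy : |y| ≤ B)
    (h : gridCell B η x = gridCell B η y) : |x - y| ≤ η := by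
  have aux : ∀ z, |z| ≤ B → ⌊(z + B) / η⌋₊ < ⌊2 * B / η⌋₊ + 1 := fun z hz =>
    Nat.lt_succ_of_le (Nat.floor_le_floor
      (div_le_div_of_nonneg_right (by linarith [(abs_le.1 hz).2]) hη.le))
  have h1 : ⌊(x + B) / η⌋₊ = ⌊(y + B) / η⌋₊ := by
    have := congrArg Fin.val h
    simpa [gridCell, Fin.ofNat, Nat.mod_eq_of_lt (aux x hx), Nat.mod_eq_of_lt (aux y hy)] using this
  have px : 0 ≤ (x + B) / η := div_nonneg (by linarith [(abs_le.1 hx).1]) hη.le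
  have py : 0 ≤ (y + B) / η := div_nonneg (by linarith [(abs_le.1 hy).1]) hη.le
  have a1 := Nat.floor_le px
  have a2 := Nat.lt_floor_add_one ((x + B) / η)
  have b1 := Nat.floor_le py
  have b2 := Nat.lt_floor_add_one ((y + B) / η)
  rw [h1] at a1 a2
  have e : (x + B) / η - (y + B) / η = (x - y) / η := by ring
  have : |(x - y) / η| ≤ 1 := by
    rw [← e, abs_le]; constructor <;> linarith
  rwa [abs_div, abs_of_pos hη, div_le_one hη] at this

namespace LinearMDP

variable (M : LinearMDP S A d H)

lemma sum_φ_mul_le (x : S × A) {u : Fin d → ℝ} {c : ℝ} (hu : ∀ i, u i ≤ c) :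
    M.φ x ⬝ᵥ u ≤ c := by
  calc M.φ x ⬝ᵥ u ≤ ∑ i, M.φ x i * c :=
        Finset.sum_le_sum fun i _ => mul_le_mul_of_nonneg_left (hu i) (M.φ_nonneg x i)
    _ = c := by rw [← Finset.sum_mul, M.φ_sum, one_mul]

lemma abs_φ_dotProduct_le (x : S × A) {u : Fin d → ℝ} {c : ℝ} (hu : ∀ i, |u i| ≤ c) :
    |M.φ x ⬝ᵥ u| ≤ c := by
  rw [abs_le']
  refine ⟨M.sum_φ_mul_le x fun i => (abs_le'.1 (hu i)).1, ?_⟩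
  rw [← dotProduct_neg]
  exact M.sum_φ_mul_le x fun i => (abs_le'.1 (hu i)).2

lemma ridgeNext_apply (data : Dataset S A K) (h : ℕ) (f : S → ℝ) (i : Fin d) :
    M.ridgeNext 1 data h f i =
      ∑ τ, ridgeWeight (M.design data h) i τ * f (data.pair τ (h + 1)).1 := by
  change ((designGram (M.design data h))⁻¹.mulVec
    (∑ τ, f (data.pair τ (h + 1)).1 • M.design data h τ)) i = _
  rw [Matrix.mulVec_sum, Finset.sum_apply]
  refine Finset.sum_congr rfl fun τ _ => ?_
  rw [Matrix.mulVec_smul, Pi.smul_apply, smul_eq_mul, mul_comm]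
  rfl

/-- Bias-noise decomposition of the ridge estimate. -/
lemma ridgeNext_sub_nominalMean (data : Dataset S A K) (h : ℕ) (f : S → ℝ) (i : Fin d) :
    M.ridgeNext 1 data h f i - M.nominalMean h f i = M.ridgeNoise data h f i -
      ((designGram (M.design data h))⁻¹.mulVec (M.nominalMean h f)) i := by
  rw [ridgeNext_apply, ridgeNoise, ← invGram_mulVec (M.design data h) (M.nominalMean h f) i]
  simp only [mul_sub, Finset.sum_sub_distrib]
  ring

lemma abs_ridgeNext_le (data : Dataset S A K) (h : ℕ) {f : S → ℝ} {b : ℝ} (hb : 0 ≤ b)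
    (hf : ∀ s, |f s| ≤ b) (i : Fin d) : |M.ridgeNext 1 data h f i| ≤ b * √(K : ℝ) := by
  rw [ridgeNext_apply]
  refine (abs_sum_ridgeWeight_mul_le _ i hb fun τ => hf _).trans ?_
  exact mul_le_of_le_one_right (by positivity) (sqrt_invDiag_le_one _ i)

lemma nominalMean_mem_Icc (h : ℕ) {f : S → ℝ} (hf : Measurable f) {b : ℝ}
    (hb : ∀ s, f s ∈ Set.Icc 0 b) (i : Fin d) : M.nominalMean h f i ∈ Set.Icc 0 b := by
  refine ⟨integral_nonneg fun s => (hb s).1, ?_⟩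
  have := integral_mono (μ := (M.μ₀ h i : Measure S)) (integrable_of_mem_Icc hf hb)
    (integrable_const b) fun s => (hb s).2
  simpa [nominalMean] using this

/-- The noise is Lipschitz in the regressed function. -/
lemma abs_ridgeNoise_sub_le (data : Dataset S A K) (h : ℕ) {f g : S → ℝ} (hf : Measurable f)
    (hg : Measurable g) {b : ℝ} (hfb : ∀ s, f s ∈ Set.Icc 0 b) (hgb : ∀ s, g s ∈ Set.Icc 0 b)
    {ε : ℝ} (hε : 0 ≤ ε) (hfg : ∀ s, |f s - g s| ≤ ε) (i : Fin d) :
    |M.ridgeNoise data h f i - M.ridgeNoise data h g i| ≤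
      2 * ε * √(K : ℝ) * √(invDiag (M.design data h) i) := by
  have hmean : ∀ j, |M.nominalMean h f j - M.nominalMean h g j| ≤ ε := fun j => by
    rw [nominalMean, nominalMean, ← integral_sub (integrable_of_mem_Icc hf hfb)
      (integrable_of_mem_Icc hg hgb)]
    simpa using norm_integral_le_of_norm_le_const (μ := (M.μ₀ h j : Measure S))
      (f := fun s => f s - g s) (Filter.Eventually.of_forall hfg)
  rw [ridgeNoise, ridgeNoise, ← Finset.sum_sub_distrib]
  simp only [← mul_sub]
  refine abs_sum_ridgeWeight_mul_le _ i (by positivity) fun τ => ?_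
  have h2 : |M.design data h τ ⬝ᵥ M.nominalMean h f - M.design data h τ ⬝ᵥ M.nominalMean h g| ≤ ε := by
    rw [← dotProduct_sub]
    exact M.abs_φ_dotProduct_le _ hmean
  have h1 := hfg (data.pair τ (h + 1)).1
  rw [abs_le] at *
  constructor <;> linarith

/-- Uniform concentration over a class of functions with a finite cover: `cell` assigns the same
index only to functions at uniform distance at most `ε`. One representative is taken per nonempty
cell, so that only functions of the class, which are measurable, are used. -/
theorem exists_good_event (ρ : ProbabilityMeasure S) (πb : Policy S A) {U : ℕ → Type*}
    (F : ∀ h, U h → S → ℝ) {b : ℝ} (hb0 : 0 < b) (hFm : ∀ h u, Measurable (F h u))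
    (hFb : ∀ h u s, F h u s ∈ Set.Icc 0 b) {ι : Type*} [Fintype ι] (cell : ∀ h, U h → ι) {ε : ℝ}
    (hε : 0 ≤ ε) (hcell : ∀ h u u', cell h u = cell h u' → ∀ s, |F h u s - F h u' s| ≤ ε)
    {t : ℝ} (ht : 0 ≤ t) {δ : ℝ}
    (hδ : (H * d * Fintype.card ι : ℝ) * (2 * Real.exp (-2 * t ^ 2 / b ^ 2)) ≤ δ) :
    ∃ G : Set (Dataset S A K), MeasurableSet G ∧ 1 - δ ≤ (M.dataLaw ρ πb K).real G ∧
      ∀ data ∈ G, ∀ h ∈ Finset.Icc 1 H, ∀ u i,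
        |M.ridgeNext 1 data h (F h u) i - M.nominalMean h (F h u) i| ≤
          (t + b * √(d : ℝ) + 2 * ε * √(K : ℝ)) * √(invDiag (M.design data h) i) := by
  classical
  let E : ℕ × Fin d × ι → Set (Dataset S A K) := fun p =>
    if hp : ∃ u, cell p.1 u = p.2.2 then M.noiseEvent K p.1 (F p.1 hp.choose) p.2.1 t else ∅
  have hEm : ∀ p, MeasurableSet (E p) := fun p => by
    by_cases hp : ∃ u, cell p.1 u = p.2.2
    · simp only [E, dif_pos hp]; exact M.measurableSet_noiseEvent _ (hFm _ _) _ _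
    · simp only [E, dif_neg hp]; exact MeasurableSet.empty
  set I : Finset (ℕ × Fin d × ι) := Finset.Icc 1 H ×ˢ Finset.univ with hI
  have : IsProbabilityMeasure (M.dataLaw ρ πb K) := by unfold dataLaw; infer_instance
  have hEp : ∀ p ∈ I, (M.dataLaw ρ πb K).real (E p) ≤ 2 * Real.exp (-2 * t ^ 2 / b ^ 2) := by
    intro p hp'
    have hp1 : 1 ≤ p.1 := by
      simp only [hI, Finset.mem_product, Finset.mem_Icc] at hp'; exact hp'.1.1
    by_cases hp : ∃ u, cell p.1 u = p.2.2
    · simp only [E, dif_pos hp]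
      exact M.dataLaw_noiseEvent_le ρ πb hp1 (hFm _ _) hb0 (hFb _ _) _ ht
    · simp only [E, dif_neg hp, measureReal_empty]; positivity
  have hbad : (M.dataLaw ρ πb K).real (⋃ p ∈ I, E p) ≤ δ := by
    refine (measureReal_biUnion_finset_le I E).trans ((Finset.sum_le_sum hEp).trans ?_)
    rw [Finset.sum_const, nsmul_eq_mul]
    refine le_trans (le_of_eq ?_) hδ
    congr 1
    rw [hI, Finset.card_product, Finset.card_univ, Fintype.card_prod, Fintype.card_fin,
      Nat.card_Icc, Nat.add_sub_cancel]
    push_cast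
    ring
  have hUm : MeasurableSet (⋃ p ∈ I, E p) := I.measurableSet_biUnion fun p _ => hEm p
  refine ⟨(⋃ p ∈ I, E p)ᶜ, hUm.compl, ?_, fun data hdata h hh u i => ?_⟩
  · rw [measureReal_compl hUm, probReal_univ]; linarith
  · have hp : ∃ u', cell h u' = cell h u := ⟨u, rfl⟩
    have hnot : data ∉ E (h, i, cell h u) := fun hmem => hdata (by
      simp only [Set.mem_iUnion]
      exact ⟨(h, i, cell h u), by simp only [hI, Finset.mem_product]; exact ⟨hh, Finset.mem_univ _⟩, hmem⟩)
    simp only [E, dif_pos hp] at hnot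
    have h1 : |M.ridgeNoise data h (F h hp.choose) i| ≤
        t * √(invDiag (M.design data h) i) := (not_le.1 hnot).le
    have h2 := M.abs_ridgeNoise_sub_le data h (hFm h u) (hFm h hp.choose) (hFb h u)
      (hFb h hp.choose) hε (hcell h u hp.choose hp.choose_spec.symm) i
    have h3 := abs_invGram_mulVec_le (M.design data h) i (w := M.nominalMean h (F h u)) hb0.le
      fun j => by
        have := M.nominalMean_mem_Icc h (hFm h u) (hFb h u) j
        rw [abs_of_nonneg this.1]; exact this.2
    rw [ridgeNext_sub_nominalMean]
    rw [abs_le] at *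
    constructor <;> nlinarith

/-- Value functions that the algorithm can produce at step `h + 1`: since the penalty is linear in
the features, they are determined by a single vector `u`, here in a box of radius `B`. -/
def InValueClass (B : ℝ) (h : ℕ) (V : S → ℝ) : Prop :=
  Measurable V ∧ ∃ u : Fin d → ℝ, (∀ i, |u i| ≤ B) ∧
    ∀ s, V s = ⨆ a, clip ((H : ℝ) - h) (M.φ (s, a) ⬝ᵥ u)

lemma InValueClass.mem_Icc {M : LinearMDP S A d H} [Nonempty A] {B : ℝ} {h : ℕ} (hh : h ≤ H)
    {V : S → ℝ} (hV : M.InValueClass B h V) (s : S) : V s ∈ Set.Icc 0 (H : ℝ) := by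
  obtain ⟨-, u, -, hu⟩ := hV
  have hb : (0 : ℝ) ≤ (H : ℝ) - h := by
    have : (h : ℝ) ≤ H := by exact_mod_cast hh
    linarith
  rw [hu]
  have hbdd : BddAbove (Set.range fun a => clip ((H : ℝ) - h) (M.φ (s, a) ⬝ᵥ u)) :=
    ⟨(H : ℝ) - h, by rintro _ ⟨a, rfl⟩; exact (clip_mem_Icc hb _).2⟩
  refine ⟨(clip_mem_Icc hb _).1.trans (le_ciSup hbdd (Classical.arbitrary A)), ?_⟩
  refine ciSup_le fun a => (clip_mem_Icc hb _).2.trans ?_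
  linarith [(Nat.cast_nonneg h : (0 : ℝ) ≤ h)]

/-- Uniform concentration over transforms `T V α` of value functions, `α` an auxiliary level. -/
theorem exists_good_event_value [Nonempty A] (ρ : ProbabilityMeasure S) (πb : Policy S A)
    (T : (S → ℝ) → ℝ → S → ℝ) {b B η ε t δ : ℝ} (hb0 : 0 < b) (hB : H ≤ B) (hη : 0 < η)
    (hε : 0 ≤ ε) (ht : 0 ≤ t)
    (hTm : ∀ V α, Measurable V → Measurable (T V α))
    (hTb : ∀ V α, (∀ s, V s ∈ Set.Icc 0 (H : ℝ)) → α ∈ Set.Icc 0 (H : ℝ) →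
      ∀ s, T V α s ∈ Set.Icc 0 b)
    (hTL : ∀ V V' α α', (∀ s, V s ∈ Set.Icc 0 (H : ℝ)) → (∀ s, V' s ∈ Set.Icc 0 (H : ℝ)) →
      α ∈ Set.Icc 0 (H : ℝ) → α' ∈ Set.Icc 0 (H : ℝ) →
      (∀ s, |V s - V' s| ≤ η) → |α - α'| ≤ η → ∀ s, |T V α s - T V' α' s| ≤ ε)
    (hδ : (H * d * (2 * B / η + 1) ^ (d + 1) : ℝ) * (2 * Real.exp (-2 * t ^ 2 / b ^ 2)) ≤ δ) :
    ∃ G : Set (Dataset S A K), MeasurableSet G ∧ 1 - δ ≤ (M.dataLaw ρ πb K).real G ∧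
      ∀ data ∈ G, ∀ h ∈ Finset.Icc 1 H, ∀ V, M.InValueClass B h V →
        ∀ α ∈ Set.Icc 0 (H : ℝ), ∀ i,
        |M.ridgeNext 1 data h (T V α) i - M.nominalMean h (T V α) i| ≤
          (t + b * √(d : ℝ) + 2 * ε * √(K : ℝ)) * √(invDiag (M.design data h) i) := by
  classical
  have hB0 : 0 ≤ B := (Nat.cast_nonneg H).trans hB
  let U : ℕ → Type _ := fun h =>
    {p : (S → ℝ) × ℝ // M.InValueClass B h p.1 ∧ p.2 ∈ Set.Icc 0 (H : ℝ) ∧ h ≤ H}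
  let F : ∀ h, U h → S → ℝ := fun h p => T p.1.1 p.1.2
  let par : ∀ h, U h → Fin d → ℝ := fun h p => p.2.1.2.choose
  have hpar : ∀ h (p : U h), (∀ i, |par h p i| ≤ B) ∧
      ∀ s, p.1.1 s = ⨆ a, clip ((H : ℝ) - h) (M.φ (s, a) ⬝ᵥ par h p) := fun h p =>
    p.2.1.2.choose_spec
  let cell : ∀ h, U h → (Fin d → Fin (⌊2 * B / η⌋₊ + 1)) × Fin (⌊2 * B / η⌋₊ + 1) := fun h p =>
    (fun i => gridCell B η (par h p i), gridCell B η p.1.2)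
  have hbox : ∀ h (p : U h), |p.1.2| ≤ B := fun h p => by
    rw [abs_of_nonneg p.2.2.1.1]; exact p.2.2.1.2.trans hB
  have hmem : ∀ h (p : U h) s, p.1.1 s ∈ Set.Icc 0 (H : ℝ) := fun h p s =>
    p.2.1.mem_Icc p.2.2.2 s
  have hcell : ∀ h u u', cell h u = cell h u' → ∀ s, |F h u s - F h u' s| ≤ ε := by
    intro h p p' hpp
    simp only [cell, Prod.mk.injEq] at hpp
    refine hTL _ _ _ _ (hmem h p) (hmem h p') p.2.2.1 p'.2.2.1 (fun s => ?_)
      (abs_sub_le_of_gridCell_eq hη (hbox h p) (hbox h p') hpp.2)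
    have hb : (0 : ℝ) ≤ (H : ℝ) - h := by
      have : (h : ℝ) ≤ H := by exact_mod_cast p.2.2.2
      linarith
    have hbdd : ∀ u : Fin d → ℝ,
        BddAbove (Set.range fun a => clip ((H : ℝ) - h) (M.φ (s, a) ⬝ᵥ u)) := fun u =>
      ⟨(H : ℝ) - h, by rintro _ ⟨a, rfl⟩; exact (clip_mem_Icc hb _).2⟩
    rw [(hpar h p).2, (hpar h p').2]
    refine abs_ciSup_sub_ciSup_le (hbdd _) (hbdd _) fun a => ?_
    refine (abs_clip_sub_clip_le _ _ _).trans ?_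
    rw [← dotProduct_sub]
    exact M.abs_φ_dotProduct_le _ fun i =>
      abs_sub_le_of_gridCell_eq hη ((hpar h p).1 i) ((hpar h p').1 i) (congrFun hpp.1 i)
  obtain ⟨G, hGm, hGp, hG⟩ := M.exists_good_event (K := K) ρ πb F hb0
    (fun h p => hTm _ _ p.2.1.1) (fun h p => hTb _ _ (hmem h p) p.2.2.1) cell hε hcell ht (δ := δ)
    (by
      refine le_trans ?_ hδ
      refine mul_le_mul_of_nonneg_right ?_ (by positivity)
      refine mul_le_mul_of_nonneg_left ?_ (by positivity)
      simp only [Fintype.card_prod, Fintype.card_fun, Fintype.card_fin]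
      push_cast
      rw [← pow_succ]
      refine pow_le_pow_left₀ (by positivity) ?_ _
      have := Nat.floor_le (show 0 ≤ 2 * B / η by positivity)
      linarith)
  refine ⟨G, hGm, hGp, fun data hdata h hh V hV α hα i => ?_⟩
  exact hG data hdata h hh ⟨(V, α), hV, hα, (Finset.mem_Icc.1 hh).2⟩ i

end LinearMDP

end Uniform

/-! ### Pessimistic value iteration: from estimation errors to suboptimality -/

section ValueIteration

variable {S A : Type*} [MeasurableSpace S] [MeasurableSpace A] {d H K : ℕ}

namespace LinearMDP

variable (M : LinearMDP S A d H)

/-- The vector `u` with `Q̂_h = clip ⟨φ, u⟩`: reward parameter plus estimate minus penalty. -/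
noncomputable def qParam (D : Divergence) (lam β : ℝ) (data : Dataset S A K) (h : ℕ) (V : S → ℝ)
    (i : Fin d) : ℝ :=
  M.θ h i + M.wHat D lam 1 data h V i - β * √(invDiag (M.design data h) i)

lemma penalty_eq (β : ℝ) (data : Dataset S A K) (h : ℕ) (x : S × A) :
    M.penalty 1 β data h x = β * ∑ i, M.φ x i * √(invDiag (M.design data h) i) := by
  unfold penalty
  congr 1
  refine Finset.sum_congr rfl fun i _ => ?_
  exact weightedNorm_single (M.design data h) i (M.φ_nonneg x i)

lemma qHat_eq (D : Divergence) (lam β : ℝ) (data : Dataset S A K) (h : ℕ) (V : S → ℝ) (x : S × A) :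
    M.qHat D lam 1 β data h V x =
      clip ((H : ℝ) - h + 1) (M.φ x ⬝ᵥ M.qParam D lam β data h V) := by
  unfold qHat
  rw [penalty_eq, Finset.mul_sum, ← Finset.sum_sub_distrib]
  congr 1
  refine Finset.sum_congr rfl fun i _ => ?_
  rw [qParam]; ring

lemma measurable_qHat (D : Divergence) (lam β : ℝ) (data : Dataset S A K) (h : ℕ) (V : S → ℝ) :
    Measurable (M.qHat D lam 1 β data h V) := by
  have : M.qHat D lam 1 β data h V = fun x =>
      clip ((H : ℝ) - h + 1) (M.φ x ⬝ᵥ M.qParam D lam β data h V) := funext fun x =>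
    M.qHat_eq D lam β data h V x
  rw [this]
  unfold clip dotProduct
  refine measurable_const.max ((Finset.measurable_fun_sum _ fun i _ => ?_).min measurable_const)
  exact ((measurable_pi_apply i).comp M.measurable_φ).mul_const _

lemma qHat_mem_Icc (D : Divergence) (lam β : ℝ) (data : Dataset S A K) {h : ℕ} (hh : h ≤ H)
    (V : S → ℝ) (x : S × A) : M.qHat D lam 1 β data h V x ∈ Set.Icc 0 ((H : ℝ) - h + 1) := by
  have : (h : ℝ) ≤ H := by exact_mod_cast hh
  exact clip_mem_Icc (by linarith) _

/-- `V` is the sequence of value estimates produced along with the policy `πhat`. -/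
def IsValueIteration (D : Divergence) (lam β : ℝ) (data : Dataset S A K) (πhat : Policy S A)
    (V : ℕ → S → ℝ) : Prop :=
  (∀ s, V (H + 1) s = 0) ∧ ∀ h ∈ Finset.Icc 1 H, ∀ s,
    (∀ q : ProbabilityMeasure A,
      ∫ a, M.qHat D lam 1 β data h (V (h + 1)) (s, a) ∂(q : Measure A) ≤
        ∫ a, M.qHat D lam 1 β data h (V (h + 1)) (s, a) ∂(πhat.toKernel h s)) ∧
    V h s = ∫ a, M.qHat D lam 1 β data h (V (h + 1)) (s, a) ∂(πhat.toKernel h s)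

/-- Every parameter estimate is within `β √(Λ_h⁻¹)_ii` of the robust regularized mean. -/
def IsAccurate (D : Divergence) (lam β : ℝ) (data : Dataset S A K) (V : ℕ → S → ℝ) : Prop :=
  ∀ h ∈ Finset.Icc 1 H, ∀ i, ∃ w, IsRobustMean D lam (M.μ₀ h i) (V (h + 1)) w ∧
    |M.wHat D lam 1 data h (V (h + 1)) i - w| ≤ β * √(invDiag (M.design data h) i)

section

variable {M} {D : Divergence} {lam β : ℝ} {data : Dataset S A K} {πhat : Policy S A}
  {V : ℕ → S → ℝ}

lemma integrable_qHat {h : ℕ} (hh : h ≤ H) (W : S → ℝ) (s : S) (q : Measure A)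
    [IsProbabilityMeasure q] :
    Integrable (fun a => M.qHat D lam 1 β data h W (s, a)) q :=
  integrable_of_mem_Icc ((M.measurable_qHat D lam β data h W).comp measurable_prodMk_left)
    fun a => M.qHat_mem_Icc D lam β data hh W (s, a)

lemma IsValueIteration.mem_Icc (hV : M.IsValueIteration D lam β data πhat V) {h : ℕ}
    (h1 : 1 ≤ h) (hh : h ≤ H + 1) (s : S) : V h s ∈ Set.Icc 0 ((H : ℝ) - h + 1) := by
  rcases Nat.lt_or_ge H h with h2 | h2
  · obtain rfl : h = H + 1 := by omega
    rw [hV.1]; constructor <;> simp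
  · rw [(hV.2 h (Finset.mem_Icc.2 ⟨h1, h2⟩) s).2]
    have hq := fun a => M.qHat_mem_Icc D lam β data h2 (V (h + 1)) (s, a)
    refine ⟨integral_nonneg fun a => (hq a).1, ?_⟩
    simpa using integral_mono (integrable_qHat h2 (V (h + 1)) s (πhat.toKernel h s))
      (integrable_const _) fun a => (hq a).2

lemma IsValueIteration.mem_Icc_horizon (hV : M.IsValueIteration D lam β data πhat V) {h : ℕ}
    (h1 : 1 ≤ h) (hh : h ≤ H + 1) (s : S) : V h s ∈ Set.Icc 0 (H : ℝ) := by
  have := hV.mem_Icc h1 hh s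
  have h2 : (1 : ℝ) ≤ h := by exact_mod_cast h1
  exact ⟨this.1, this.2.trans (by linarith)⟩

lemma IsValueIteration.measurable (hV : M.IsValueIteration D lam β data πhat V) {h : ℕ}
    (h1 : 1 ≤ h) (hh : h ≤ H + 1) : Measurable (V h) := by
  rcases Nat.lt_or_ge H h with h2 | h2
  · obtain rfl : h = H + 1 := by omega
    rw [funext hV.1]; exact measurable_const
  · rw [funext fun s => (hV.2 h (Finset.mem_Icc.2 ⟨h1, h2⟩) s).2]
    exact (StronglyMeasurable.integral_kernel_prod_right'
      (M.measurable_qHat D lam β data h (V (h + 1))).stronglyMeasurable).measurable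

/-- Maximizing over action distributions, Dirac masses included, gives the supremum over actions. -/
lemma IsValueIteration.eq_iSup [Nonempty A] (hV : M.IsValueIteration D lam β data πhat V) {h : ℕ}
    (hh : h ∈ Finset.Icc 1 H) (s : S) :
    V h s = ⨆ a, M.qHat D lam 1 β data h (V (h + 1)) (s, a) := by
  obtain ⟨hmax, hval⟩ := hV.2 h hh s
  have h2 := (Finset.mem_Icc.1 hh).2
  have hq := fun a => M.qHat_mem_Icc D lam β data h2 (V (h + 1)) (s, a)
  have hbdd : BddAbove (Set.range fun a => M.qHat D lam 1 β data h (V (h + 1)) (s, a)) :=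
    ⟨(H : ℝ) - h + 1, by rintro _ ⟨a, rfl⟩; exact (hq a).2⟩
  apply le_antisymm
  · rw [hval]
    simpa using integral_mono (integrable_qHat h2 (V (h + 1)) s (πhat.toKernel h s))
      (integrable_const _) fun a => le_ciSup hbdd a
  · refine ciSup_le fun a => ?_
    have := hmax ⟨Measure.dirac a, inferInstance⟩
    rw [hval]
    refine le_trans (le_of_eq ?_) this
    exact (integral_dirac' _ a ((M.measurable_qHat D lam β data h (V (h + 1))).comp
      measurable_prodMk_left).stronglyMeasurable).symm

/-- If the parameter estimates are bounded by `W`, the value estimates stay in a fixed class. -/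
lemma IsValueIteration.inValueClass [Nonempty A] (hV : M.IsValueIteration D lam β data πhat V)
    (hβ : 0 ≤ β) {W B : ℝ} (hW : ∀ h, ∀ U : S → ℝ, (∀ s, U s ∈ Set.Icc 0 (H : ℝ)) →
      ∀ i, |M.wHat D lam 1 data h U i| ≤ W)
    (hB0 : 0 ≤ B) (hB : √(d : ℝ) + W + β ≤ B) {h : ℕ} (hh : h ∈ Finset.Icc 1 H) :
    M.InValueClass B h (V (h + 1)) := by
  obtain ⟨h1, h2⟩ := Finset.mem_Icc.1 hh
  refine ⟨hV.measurable (by omega) (by omega), ?_⟩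
  rcases Nat.lt_or_ge h H with h3 | h3
  · have hh' : h + 1 ∈ Finset.Icc 1 H := Finset.mem_Icc.2 ⟨by omega, by omega⟩
    refine ⟨M.qParam D lam β data (h + 1) (V (h + 1 + 1)), fun i => ?_, fun s => ?_⟩
    · have hθ : |M.θ (h + 1) i| ≤ √(d : ℝ) :=
        (PiLp.norm_apply_le (M.θ (h + 1)) i).trans (M.θ_norm _ hh')
      have hw := hW (h + 1) (V (h + 1 + 1))
        (fun s => hV.mem_Icc_horizon (by omega) (by omega) s) i
      have hq := sqrt_invDiag_le_one (M.design data (h + 1)) i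
      have hq0 := Real.sqrt_nonneg (invDiag (M.design data (h + 1)) i)
      have hp : β * √(invDiag (M.design data (h + 1)) i) ≤ β := mul_le_of_le_one_right hβ hq
      have hp0 : 0 ≤ β * √(invDiag (M.design data (h + 1)) i) := mul_nonneg hβ hq0
      rw [qParam]
      rw [abs_le] at *
      constructor <;> linarith
    · rw [hV.eq_iSup hh' s]
      refine iSup_congr fun a => ?_
      rw [qHat_eq]
      congr 1
      push_cast; ring
  · obtain rfl : h = H := le_antisymm h2 h3
    refine ⟨0, fun i => by simpa using hB0, fun s => ?_⟩
    rw [hV.1]; simp [clip]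

lemma lintegral_linearTransition (μ : Factors S d) (h : ℕ) (x : S × A) (f : S → ℝ≥0∞) :
    ∫⁻ s, f s ∂((M.linearTransition μ).toKernel h x) =
      ∑ i, ENNReal.ofReal (M.φ x i) * ∫⁻ s, f s ∂(μ h i : Measure S) := by
  change ∫⁻ s, f s ∂(∑ i, ENNReal.ofReal (M.φ x i) • (μ h i : Measure S)) = _
  rw [lintegral_finsetSum_measure]
  simp only [lintegral_smul_measure, smul_eq_mul]

lemma regReward_add_lintegral (μ : Factors S d) (h : ℕ) (x : S × A) (f : S → ℝ≥0∞) :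
    M.regReward D lam μ h x + ∫⁻ s, f s ∂((M.linearTransition μ).toKernel h x) =
      ENNReal.ofReal (M.reward h x) + ∑ i, ENNReal.ofReal (M.φ x i) *
        (∫⁻ s, f s ∂(μ h i : Measure S) +
          ENNReal.ofReal lam * D.eval (μ h i : Measure S) (M.μ₀ h i)) := by
  rw [lintegral_linearTransition, regReward, Finset.mul_sum, add_assoc, ← Finset.sum_add_distrib]
  congr 1
  refine Finset.sum_congr rfl fun i _ => ?_
  rw [mul_add, add_comm]
  congr 1
  rw [← mul_assoc, ← mul_assoc, mul_comm (ENNReal.ofReal lam)]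

lemma ofReal_mixture {r : ℝ} (hr : 0 ≤ r) (x : S × A) {w : Fin d → ℝ} (hw : ∀ i, 0 ≤ w i) :
    ENNReal.ofReal (r + M.φ x ⬝ᵥ w) =
      ENNReal.ofReal r + ∑ i, ENNReal.ofReal (M.φ x i) * ENNReal.ofReal (w i) := by
  have h0 : ∀ i, 0 ≤ M.φ x i * w i := fun i => mul_nonneg (M.φ_nonneg x i) (hw i)
  rw [dotProduct, ENNReal.ofReal_add hr (Finset.sum_nonneg fun i _ => h0 i),
    ENNReal.ofReal_sum_of_nonneg fun i _ => h0 i]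
  simp only [ENNReal.ofReal_mul (M.φ_nonneg x _)]

/-- Pessimism in one step: whatever the factor distributions, `Q̂_h` is at most the regularized
reward plus the expected value estimate at the next step. -/
lemma IsValueIteration.qHat_le (hV : M.IsValueIteration D lam β data πhat V)
    (hacc : M.IsAccurate D lam β data V) (hlam : 0 < lam) {h : ℕ} (hh : h ∈ Finset.Icc 1 H)
    (μ : Factors S d) (x : S × A) :
    ENNReal.ofReal (M.qHat D lam 1 β data h (V (h + 1)) x) ≤ M.regReward D lam μ h x +
      ∫⁻ s, ENNReal.ofReal (V (h + 1) s) ∂((M.linearTransition μ).toKernel h x) := by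
  obtain ⟨h1, h2⟩ := Finset.mem_Icc.1 hh
  choose w hw herr using hacc h hh
  have hV0 : ∀ s, V (h + 1) s ∈ Set.Icc 0 (H : ℝ) := fun s =>
    hV.mem_Icc_horizon (by omega) (by omega) s
  have hVm := hV.measurable (h := h + 1) (by omega) (by omega)
  have hw0 : ∀ i, 0 ≤ w i := fun i => (hw i).nonneg hlam.le fun s => (hV0 s).1
  have hr0 : 0 ≤ M.reward h x := (M.reward_mem h hh x).1
  have hle : M.qHat D lam 1 β data h (V (h + 1)) x ≤ M.reward h x + M.φ x ⬝ᵥ w := by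
    rw [qHat_eq]
    refine max_le (add_nonneg hr0 (Finset.sum_nonneg fun i _ =>
      mul_nonneg (M.φ_nonneg x i) (hw0 i))) ((min_le_left _ _).trans ?_)
    rw [reward, dotProduct, dotProduct, ← Finset.sum_add_distrib]
    refine Finset.sum_le_sum fun i _ => ?_
    rw [← mul_add]
    refine mul_le_mul_of_nonneg_left ?_ (M.φ_nonneg x i)
    rw [qParam]
    linarith [(abs_le.1 (herr i)).2]
  rw [regReward_add_lintegral]
  refine (ENNReal.ofReal_le_ofReal hle).trans ?_
  rw [ofReal_mixture hr0 x hw0]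
  gcongr with i _
  by_cases hD : D.eval (μ h i : Measure S) (M.μ₀ h i) = ⊤
  · rw [hD, ENNReal.mul_top (by simpa using hlam)]; simp
  · rw [← ofReal_integral_eq_lintegral_ofReal (integrable_of_mem_Icc hVm hV0)
      (Filter.Eventually.of_forall fun s => (hV0 s).1), ← ENNReal.ofReal_toReal hD,
      ← ENNReal.ofReal_mul hlam.le, ← ENNReal.ofReal_add (integral_nonneg fun s => (hV0 s).1)
        (mul_nonneg hlam.le ENNReal.toReal_nonneg)]
    exact ENNReal.ofReal_le_ofReal ((hw i).le_add (μ h i) hD)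

/-- Under near-minimizing factor distributions, the one-step pessimism is tight up to twice the
penalty. -/
lemma IsValueIteration.le_qHat_add (hV : M.IsValueIteration D lam β data πhat V)
    (hlam : 0 < lam) {h : ℕ} (hh : h ∈ Finset.Icc 1 H) {w : Fin d → ℝ}
    (hw : ∀ i, IsRobustMean D lam (M.μ₀ h i) (V (h + 1)) (w i))
    (herr : ∀ i, |M.wHat D lam 1 data h (V (h + 1)) i - w i| ≤
      β * √(invDiag (M.design data h) i))
    {ε : ℝ} (hε : 0 ≤ ε) {μ : Factors S d}
    (hμ : ∀ i, D.eval (μ h i : Measure S) (M.μ₀ h i) ≠ ⊤ ∧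
      ∫ s, V (h + 1) s ∂(μ h i : Measure S) +
        lam * (D.eval (μ h i : Measure S) (M.μ₀ h i)).toReal ≤ w i + ε) (x : S × A) :
    M.regReward D lam μ h x +
      ∫⁻ s, ENNReal.ofReal (V (h + 1) s) ∂((M.linearTransition μ).toKernel h x) ≤
    ENNReal.ofReal (M.qHat D lam 1 β data h (V (h + 1)) x + 2 * M.penalty 1 β data h x + ε) := by
  obtain ⟨h1, h2⟩ := Finset.mem_Icc.1 hh
  have hV0 : ∀ s, V (h + 1) s ∈ Set.Icc 0 ((H : ℝ) - h) := fun s => by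
    have := hV.mem_Icc (h := h + 1) (by omega) (by omega) s
    push_cast at this
    rwa [show (H : ℝ) - (h + 1) + 1 = H - h by ring] at this
  have hVm := hV.measurable (h := h + 1) (by omega) (by omega)
  have hw0 : ∀ i, 0 ≤ w i := fun i => (hw i).nonneg hlam.le fun s => (hV0 s).1
  have hwH : ∀ i, w i ≤ (H : ℝ) - h := fun i => (hw i).le_integral.trans
    (M.nominalMean_mem_Icc h hVm hV0 i).2
  obtain ⟨hr0, hr1⟩ := M.reward_mem h hh x
  change 0 ≤ M.reward h x at hr0
  change M.reward h x ≤ 1 at hr1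
  rw [regReward_add_lintegral]
  have hstep : ENNReal.ofReal (M.reward h x) + ∑ i, ENNReal.ofReal (M.φ x i) *
        (∫⁻ s, ENNReal.ofReal (V (h + 1) s) ∂(μ h i : Measure S) +
          ENNReal.ofReal lam * D.eval (μ h i : Measure S) (M.μ₀ h i)) ≤
      ENNReal.ofReal (M.reward h x + M.φ x ⬝ᵥ fun i => w i + ε) := by
    rw [ofReal_mixture hr0 x fun i => add_nonneg (hw0 i) hε]
    gcongr with i _
    rw [← ofReal_integral_eq_lintegral_ofReal (integrable_of_mem_Icc hVm hV0)
      (Filter.Eventually.of_forall fun s => (hV0 s).1), ← ENNReal.ofReal_toReal (hμ i).1,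
      ← ENNReal.ofReal_mul hlam.le, ← ENNReal.ofReal_add (integral_nonneg fun s => (hV0 s).1)
        (mul_nonneg hlam.le ENNReal.toReal_nonneg)]
    exact ENNReal.ofReal_le_ofReal (hμ i).2
  refine hstep.trans (ENNReal.ofReal_le_ofReal ?_)
  have hsum : M.φ x ⬝ᵥ (fun i => w i + ε) = M.φ x ⬝ᵥ w + ε := by
    simp only [dotProduct, mul_add, Finset.sum_add_distrib, ← Finset.sum_mul, M.φ_sum, one_mul]
  set pre := M.φ x ⬝ᵥ M.qParam D lam β data h (V (h + 1)) with hpre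
  have hpen : 2 * M.penalty 1 β data h x =
      M.φ x ⬝ᵥ fun i => 2 * (β * √(invDiag (M.design data h) i)) := by
    rw [penalty_eq, Finset.mul_sum, Finset.mul_sum]
    exact Finset.sum_congr rfl fun i _ => by ring
  -- By pessimism the upper clipping level is never exceeded.
  have hup : pre ≤ (H : ℝ) - h + 1 := by
    have e1 : pre ≤ M.reward h x + M.φ x ⬝ᵥ w := by
      rw [hpre, reward, dotProduct, dotProduct, ← Finset.sum_add_distrib]
      refine Finset.sum_le_sum fun i _ => ?_
      rw [← mul_add]
      refine mul_le_mul_of_nonneg_left ?_ (M.φ_nonneg x i)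
      rw [qParam]
      linarith [(abs_le.1 (herr i)).2]
    have e2 : M.φ x ⬝ᵥ w ≤ (H : ℝ) - h := M.sum_φ_mul_le x hwH
    linarith
  have hlow : M.reward h x + M.φ x ⬝ᵥ w ≤ pre + 2 * M.penalty 1 β data h x := by
    rw [hpen, hpre, reward, dotProduct, dotProduct, dotProduct, ← Finset.sum_add_distrib,
      ← Finset.sum_add_distrib]
    refine Finset.sum_le_sum fun i _ => ?_
    rw [← mul_add, ← mul_add]
    refine mul_le_mul_of_nonneg_left ?_ (M.φ_nonneg x i)
    rw [qParam]
    linarith [(abs_le.1 (herr i)).1]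
  have hq : pre ≤ M.qHat D lam 1 β data h (V (h + 1)) x := by
    rw [qHat_eq, clip, min_eq_left hup]; exact le_max_right _ _
  rw [hsum]; linarith

lemma measurable_regReward (μ : Factors S d) (h : ℕ) : Measurable (M.regReward D lam μ h) := by
  have hφ : ∀ i, Measurable fun x : S × A => M.φ x i := fun i =>
    (measurable_pi_apply i).comp M.measurable_φ
  unfold regReward reward
  refine Measurable.add (Measurable.ennreal_ofReal
    (Finset.measurable_fun_sum _ fun i _ => (hφ i).mul_const _)) (Measurable.const_mul ?_ _)
  exact Finset.measurable_fun_sum _ fun i _ => (hφ i).ennreal_ofReal.mul_const _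

lemma measurable_penalty (h : ℕ) : Measurable (M.penalty 1 β data h) := by
  rw [funext fun x => M.penalty_eq β data h x]
  refine Measurable.const_mul (Finset.measurable_fun_sum _ fun i _ => ?_) _
  exact ((measurable_pi_apply i).comp M.measurable_φ).mul_const _

lemma penalty_nonneg (hβ : 0 ≤ β) (h : ℕ) (x : S × A) : 0 ≤ M.penalty 1 β data h x := by
  rw [penalty_eq]
  exact mul_nonneg hβ (Finset.sum_nonneg fun i _ =>
    mul_nonneg (M.φ_nonneg x i) (Real.sqrt_nonneg _))

lemma IsValueIteration.lintegral_qHat (hV : M.IsValueIteration D lam β data πhat V) {h : ℕ}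
    (hh : h ∈ Finset.Icc 1 H) (s : S) :
    ∫⁻ a, ENNReal.ofReal (M.qHat D lam 1 β data h (V (h + 1)) (s, a)) ∂(πhat.toKernel h s) =
      ENNReal.ofReal (V h s) := by
  have h2 := (Finset.mem_Icc.1 hh).2
  rw [(hV.2 h hh s).2, ofReal_integral_eq_lintegral_ofReal
    (integrable_qHat h2 (V (h + 1)) s (πhat.toKernel h s))
    (Filter.Eventually.of_forall fun a => (M.qHat_mem_Icc D lam β data h2 (V (h + 1)) (s, a)).1)]

lemma IsValueIteration.lintegral_qHat_le (hV : M.IsValueIteration D lam β data πhat V) {h : ℕ}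
    (hh : h ∈ Finset.Icc 1 H) (s : S) (q : Measure A) [hq : IsProbabilityMeasure q] :
    ∫⁻ a, ENNReal.ofReal (M.qHat D lam 1 β data h (V (h + 1)) (s, a)) ∂q ≤
      ENNReal.ofReal (V h s) := by
  have h2 := (Finset.mem_Icc.1 hh).2
  rw [← ofReal_integral_eq_lintegral_ofReal (integrable_qHat h2 (V (h + 1)) s q)
    (Filter.Eventually.of_forall fun a => (M.qHat_mem_Icc D lam β data h2 (V (h + 1)) (s, a)).1),
    (hV.2 h hh s).2]
  exact ENNReal.ofReal_le_ofReal ((hV.2 h hh s).1 ⟨q, hq⟩)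

/-- Pessimism: the value estimates are lower bounds of the robust values of the output policy. -/
lemma IsValueIteration.le_value (hV : M.IsValueIteration D lam β data πhat V)
    (hacc : M.IsAccurate D lam β data V) (hlam : 0 < lam) {h : ℕ} (h1 : 1 ≤ h) (hh : h ≤ H + 1)
    (s : S) : ENNReal.ofReal (V h s) ≤ M.value D lam πhat h s := by
  refine le_iInf fun μ => ?_
  set L := trajLaw (M.linearTransition μ) πhat h (Measure.dirac s) with hL
  have key : ∀ n, n ≤ H + 1 - h → ENNReal.ofReal (V h s) ≤
      ∑ k ∈ Finset.range n, ∫⁻ ω, M.regReward D lam μ (h + k) (ω k) ∂L +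
        ∫⁻ ω, ENNReal.ofReal (V (h + n) (ω n).1) ∂L := by
    intro n
    induction n with
    | zero =>
      intro _
      rw [hL]
      simp only [Finset.range_zero, Finset.sum_empty, zero_add, add_zero]
      rw [trajLaw_lintegral_start _ _ _ _ (hV.measurable h1 hh).ennreal_ofReal]
    | succ n ih =>
      intro hn
      refine (ih (by omega)).trans ?_
      rw [Finset.sum_range_succ, add_assoc]
      gcongr
      have hj : h + n ∈ Finset.Icc 1 H := Finset.mem_Icc.2 ⟨by omega, by omega⟩
      calc ∫⁻ ω, ENNReal.ofReal (V (h + n) (ω n).1) ∂L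
          = ∫⁻ ω, ENNReal.ofReal (M.qHat D lam 1 β data (h + n) (V (h + n + 1)) (ω n)) ∂L := by
            rw [hL, trajLaw_lintegral_action _ _ _ _ n
              (M.measurable_qHat D lam β data (h + n) (V (h + n + 1))).ennreal_ofReal]
            exact lintegral_congr fun ω => (hV.lintegral_qHat hj _).symm
        _ ≤ ∫⁻ ω, (M.regReward D lam μ (h + n) (ω n) +
              ∫⁻ s, ENNReal.ofReal (V (h + n + 1) s)
                ∂((M.linearTransition μ).toKernel (h + n) (ω n))) ∂L :=
            lintegral_mono fun ω => hV.qHat_le hacc hlam hj μ (ω n)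
        _ = _ := by
            rw [lintegral_add_left (by exact (measurable_regReward μ _).comp (measurable_pi_apply n)),
              hL, ← add_assoc, trajLaw_lintegral_next _ _ _ _ n
                (hV.measurable (h := h + n + 1) (by omega) (by omega)).ennreal_ofReal]
  have := key (H + 1 - h) le_rfl
  rw [show h + (H + 1 - h) = H + 1 by omega] at this
  simp only [hV.1, ENNReal.ofReal_zero, lintegral_zero, add_zero] at this
  rw [lintegral_finsetSum _ fun k _ => by
    exact (measurable_regReward μ _).comp (measurable_pi_apply k)]
  exact this

/-- The near-worst-case transitions for the value estimates are admissible, because the value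
estimates are dominated by the optimal robust values. -/
lemma IsValueIteration.linearTransition_mem_admissible
    (hV : M.IsValueIteration D lam β data πhat V)
    (hacc : M.IsAccurate D lam β data V) (hlam : 0 < lam) {μ : Factors S d}
    (hμ : ∀ h ∈ Finset.Icc 1 H, ∀ i, D.eval (μ h i : Measure S) (M.μ₀ h i) ≠ ⊤ ∧
      lam * (D.eval (μ h i : Measure S) (M.μ₀ h i)).toReal ≤
        ∫ s, V (h + 1) s ∂(M.μ₀ h i : Measure S)) :
    M.linearTransition μ ∈ M.admissible D lam := by
  intro h hh x
  obtain ⟨h1, h2⟩ := Finset.mem_Icc.1 hh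
  refine ⟨μ h, rfl, fun i => ?_⟩
  obtain ⟨hD, hle⟩ := hμ h hh i
  have hV0 : ∀ s, V (h + 1) s ∈ Set.Icc 0 (H : ℝ) := fun s =>
    hV.mem_Icc_horizon (by omega) (by omega) s
  have hVm := hV.measurable (h := h + 1) (by omega) (by omega)
  rw [ENNReal.le_div_iff_mul_le (Or.inl (by simpa using hlam)) (Or.inl ENNReal.ofReal_ne_top),
    ← ENNReal.ofReal_toReal hD, ← ENNReal.ofReal_mul ENNReal.toReal_nonneg, mul_comm]
  refine (ENNReal.ofReal_le_ofReal hle).trans ?_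
  rw [ofReal_integral_eq_lintegral_ofReal (integrable_of_mem_Icc hVm hV0)
    (Filter.Eventually.of_forall fun s => (hV0 s).1)]
  calc ∫⁻ s, ENNReal.ofReal (V (h + 1) s) ∂(M.μ₀ h i : Measure S)
      ≤ ∫⁻ _s, (⨆ s, M.optValue D lam (h + 1) s) ∂(M.μ₀ h i : Measure S) := by
        refine lintegral_mono fun s => ?_
        refine (hV.le_value hacc hlam (by omega) (by omega) s).trans ?_
        exact (le_iSup (fun π => M.value D lam π (h + 1) s) πhat).trans
          (le_iSup (fun s => M.optValue D lam (h + 1) s) s)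
    _ = _ := by simp

/-- Partial coverage bounds the expected penalty. -/
lemma integral_penalty_le (hβ : 0 ≤ β) (hK : 1 ≤ K) {c : ℝ} (hc : 0 < c) {πstar : Policy S A}
    (hcov : M.Coverage D lam 1 c πstar data) {P : Transition S A} (hP : P ∈ M.admissible D lam)
    (s : S) {h : ℕ} (hh : h ∈ Finset.Icc 1 H) :
    ∫ ω, M.penalty 1 β data h (ω (h - 1)) ∂(trajLaw P πstar 1 (Measure.dirac s)) ≤
      β * d / √(c * K) := by
  set L := trajLaw P πstar 1 (Measure.dirac s) with hL
  have hK0 : (0 : ℝ) < K := by exact_mod_cast hK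
  have hcK : 0 < c * K := by positivity
  have hφm : ∀ i, Measurable fun ω : ℕ → S × A => M.φ (ω (h - 1)) i := fun i =>
    (measurable_pi_apply i).comp (M.measurable_φ.comp (measurable_pi_apply (h - 1)))
  have hφI : ∀ i (x : S × A), M.φ x i ∈ Set.Icc (0 : ℝ) 1 := fun i x =>
    ⟨M.φ_nonneg x i, (Finset.single_le_sum (fun j _ => M.φ_nonneg x j)
      (Finset.mem_univ i)).trans (M.φ_sum x).le⟩
  have hφi : ∀ i, Integrable (fun ω : ℕ → S × A => M.φ (ω (h - 1)) i) L := fun i =>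
    integrable_of_mem_Icc (hφm i) fun ω => hφI i _
  have hterm : ∀ i, (∫ ω, M.φ (ω (h - 1)) i ∂L) * √(invDiag (M.design data h) i) ≤
      1 / √(c * K) := by
    intro i
    set e := ∫ ω, M.φ (ω (h - 1)) i ∂L with he
    set m2 := ∫ ω, M.φ (ω (h - 1)) i ^ 2 ∂L with hm2
    have hφ2i : Integrable (fun ω : ℕ → S × A => M.φ (ω (h - 1)) i ^ 2) L :=
      integrable_of_mem_Icc ((hφm i).pow_const 2) (a := 0) (b := 1) fun ω =>
        ⟨sq_nonneg _, pow_le_one₀ (hφI i _).1 (hφI i _).2⟩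
    have hJ : e ^ 2 ≤ m2 := by
      have h0 : 0 ≤ ∫ ω, (M.φ (ω (h - 1)) i ^ 2 - 2 * e * M.φ (ω (h - 1)) i + e ^ 2) ∂L :=
        integral_nonneg fun ω => by
          have : (0 : ℝ) ≤ (M.φ (ω (h - 1)) i - e) ^ 2 := sq_nonneg _
          have e' : (M.φ (ω (h - 1)) i - e) ^ 2 =
            M.φ (ω (h - 1)) i ^ 2 - 2 * e * M.φ (ω (h - 1)) i + e ^ 2 := by ring
          rw [e'] at this; exact this
      rw [integral_add (by exact hφ2i.sub ((hφi i).const_mul _)) (integrable_const _),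
        integral_sub hφ2i (by exact (hφi i).const_mul _), integral_const_mul] at h0
      simp only [integral_const, probReal_univ, smul_eq_mul, one_mul] at h0
      nlinarith
    have hq := invDiag_le_of_posSemidef (M.design data h) i (hcov h hh s P hP i)
    have hq0 := invDiag_pos (M.design data h) i
    have he0 : 0 ≤ e := integral_nonneg fun ω => M.φ_nonneg _ i
    rw [← hm2] at hq
    have hle : e ^ 2 * invDiag (M.design data h) i ≤ 1 / (c * K) := by
      rw [le_div_iff₀ hcK]
      have h3 : c * K * e ^ 2 * invDiag (M.design data h) i ≤
          c * K * m2 * invDiag (M.design data h) i := by gcongr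
      nlinarith
    rw [← Real.sqrt_sq he0, ← Real.sqrt_mul (sq_nonneg e), ← Real.sqrt_one,
      ← Real.sqrt_div zero_le_one]
    exact Real.sqrt_le_sqrt hle
  have hint : ∫ ω, M.penalty 1 β data h (ω (h - 1)) ∂L =
      β * ∑ i, (∫ ω, M.φ (ω (h - 1)) i ∂L) * √(invDiag (M.design data h) i) := by
    simp only [penalty_eq]
    rw [integral_const_mul, integral_finsetSum _ fun i _ => (hφi i).mul_const _]
    simp only [integral_mul_const]
  rw [hint, mul_div_assoc]
  refine mul_le_mul_of_nonneg_left ?_ hβ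
  calc _ ≤ ∑ _i : Fin d, 1 / √(c * K) := Finset.sum_le_sum fun i _ => hterm i
    _ = _ := by simp [div_eq_mul_inv]

/-- The optimal robust value exceeds the value estimate at step `1` by at most the accumulated
penalties along the optimal policy under near-worst-case transitions. -/
lemma IsValueIteration.value_le (hV : M.IsValueIteration D lam β data πhat V)
    (hacc : M.IsAccurate D lam β data V) (hlam : 0 < lam) (hβ : 0 ≤ β) (hK : 1 ≤ K)
    {c : ℝ} (hc : 0 < c) {πstar : Policy S A} (hcov : M.Coverage D lam 1 c πstar data) (s : S)
    {ε : ℝ} (hε : 0 < ε) :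
    M.value D lam πstar 1 s ≤
      ENNReal.ofReal (V 1 s + H * (2 * (β * d / √(c * K)) + ε)) := by
  classical
  choose! w hw herr using hacc
  have hnear : ∀ h ∈ Finset.Icc 1 H, ∀ i, ∃ ν : ProbabilityMeasure S,
      D.eval (ν : Measure S) (M.μ₀ h i) ≠ ⊤ ∧
      ∫ s, V (h + 1) s ∂(ν : Measure S) +
        lam * (D.eval (ν : Measure S) (M.μ₀ h i)).toReal ≤ w h i + ε ∧
      lam * (D.eval (ν : Measure S) (M.μ₀ h i)).toReal ≤
        ∫ s, V (h + 1) s ∂(M.μ₀ h i : Measure S) := fun h hh i =>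
    (hw h hh i).exists_near (fun s => (hV.mem_Icc (h := h + 1) (by omega)
      (by have := (Finset.mem_Icc.1 hh).2; omega) s).1) hε
  have : Nonempty (ProbabilityMeasure S) := ⟨⟨Measure.dirac s, inferInstance⟩⟩
  choose! μ hμ using hnear
  have hacc' : M.IsAccurate D lam β data V := fun h hh i => ⟨w h i, hw h hh i, herr h hh i⟩
  have hadm := hV.linearTransition_mem_admissible hacc' hlam (μ := μ) fun h hh i =>
    ⟨(hμ h hh i).1, (hμ h hh i).2.2⟩
  set p := β * d / √(c * K) with hp
  have hp0 : 0 ≤ p := by positivity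
  refine (iInf_le _ μ).trans ?_
  set L := trajLaw (M.linearTransition μ) πstar 1 (Measure.dirac s) with hL
  have hV1 : 0 ≤ V 1 s := (hV.mem_Icc le_rfl (by omega) s).1
  have key : ∀ n ≤ H, ∑ k ∈ Finset.range n, ∫⁻ ω, M.regReward D lam μ (1 + k) (ω k) ∂L +
        ∫⁻ ω, ENNReal.ofReal (V (1 + n) (ω n).1) ∂L ≤
      ENNReal.ofReal (V 1 s + n * (2 * p + ε)) := by
    intro n
    induction n with
    | zero =>
      intro _
      rw [hL]
      simp only [Finset.range_zero, Finset.sum_empty, zero_add, add_zero, Nat.cast_zero, zero_mul]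
      rw [trajLaw_lintegral_start _ _ _ _ (hV.measurable le_rfl (by omega)).ennreal_ofReal]
    | succ n ih =>
      intro hn
      have hj : 1 + n ∈ Finset.Icc 1 H := Finset.mem_Icc.2 ⟨by omega, by omega⟩
      have hqm := (M.measurable_qHat D lam β data (1 + n) (V (1 + n + 1)))
      have hpen : ∫⁻ ω, ENNReal.ofReal (2 * M.penalty 1 β data (1 + n) (ω n) + ε) ∂L ≤
          ENNReal.ofReal (2 * p + ε) := by
        have hb := integral_penalty_le (M := M) (D := D) (lam := lam) hβ hK hc hcov hadm s hj
        rw [show 1 + n - 1 = n by omega] at hb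
        have hi : Integrable (fun ω : ℕ → S × A => M.penalty 1 β data (1 + n) (ω n)) L := by
          refine integrable_of_mem_Icc (a := 0) (b := β * 1)
            ((measurable_penalty (1 + n)).comp (measurable_pi_apply n)) fun ω =>
            ⟨penalty_nonneg hβ _ _, ?_⟩
          rw [penalty_eq]
          refine mul_le_mul_of_nonneg_left ?_ hβ
          exact M.sum_φ_mul_le _ fun i => sqrt_invDiag_le_one _ i
        rw [← ofReal_integral_eq_lintegral_ofReal (by exact (hi.const_mul 2).add (integrable_const ε))
          (Filter.Eventually.of_forall fun ω => add_nonneg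
            (mul_nonneg zero_le_two (penalty_nonneg hβ _ _)) hε.le)]
        refine ENNReal.ofReal_le_ofReal ?_
        rw [integral_add (hi.const_mul 2) (integrable_const ε), integral_const_mul]
        simp only [integral_const, probReal_univ, smul_eq_mul, one_mul]
        linarith
      have hstep : ∫⁻ ω, M.regReward D lam μ (1 + n) (ω n) ∂L +
          ∫⁻ ω, ENNReal.ofReal (V (1 + (n + 1)) (ω (n + 1)).1) ∂L ≤
          ∫⁻ ω, ENNReal.ofReal (V (1 + n) (ω n).1) ∂L + ENNReal.ofReal (2 * p + ε) := by
        calc _ = ∫⁻ ω, (M.regReward D lam μ (1 + n) (ω n) +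
              ∫⁻ s, ENNReal.ofReal (V (1 + n + 1) s)
                ∂((M.linearTransition μ).toKernel (1 + n) (ω n))) ∂L := by
              rw [lintegral_add_left (by exact (measurable_regReward μ _).comp (measurable_pi_apply n)),
                hL, ← add_assoc, trajLaw_lintegral_next _ _ _ _ n
                (hV.measurable (h := 1 + n + 1) (by omega) (by omega)).ennreal_ofReal]
          _ ≤ ∫⁻ ω, (ENNReal.ofReal (M.qHat D lam 1 β data (1 + n) (V (1 + n + 1)) (ω n)) +
              ENNReal.ofReal (2 * M.penalty 1 β data (1 + n) (ω n) + ε)) ∂L := by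
              refine lintegral_mono fun ω => ?_
              refine (hV.le_qHat_add hlam hj (hw _ hj) (herr _ hj) hε.le
                (fun i => ⟨(hμ _ hj i).1, (hμ _ hj i).2.1⟩) (ω n)).trans ?_
              rw [add_assoc]
              exact ENNReal.ofReal_add_le
          _ = ∫⁻ ω, ENNReal.ofReal (M.qHat D lam 1 β data (1 + n) (V (1 + n + 1)) (ω n)) ∂L +
              ∫⁻ ω, ENNReal.ofReal (2 * M.penalty 1 β data (1 + n) (ω n) + ε) ∂L :=
              lintegral_add_left (hqm.ennreal_ofReal.comp (measurable_pi_apply n)) _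
          _ ≤ _ := by
              refine add_le_add ?_ hpen
              rw [hL, trajLaw_lintegral_action _ _ _ _ n hqm.ennreal_ofReal]
              exact lintegral_mono fun ω => hV.lintegral_qHat_le hj _ _
      rw [Finset.sum_range_succ, add_assoc]
      calc _ ≤ ∑ k ∈ Finset.range n, ∫⁻ ω, M.regReward D lam μ (1 + k) (ω k) ∂L +
            (∫⁻ ω, ENNReal.ofReal (V (1 + n) (ω n).1) ∂L + ENNReal.ofReal (2 * p + ε)) := by
            gcongr
        _ ≤ ENNReal.ofReal (V 1 s + n * (2 * p + ε)) + ENNReal.ofReal (2 * p + ε) := by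
            rw [← add_assoc]; gcongr; exact ih (by omega)
        _ = _ := by
            rw [← ENNReal.ofReal_add (by positivity) (by positivity)]
            congr 1; push_cast; ring
  have hfin := key H le_rfl
  rw [show 1 + H = H + 1 by omega] at hfin
  simp only [hV.1, ENNReal.ofReal_zero, lintegral_zero, add_zero] at hfin
  rw [lintegral_finsetSum _ fun k _ => by
    exact (measurable_regReward μ _).comp (measurable_pi_apply k)]
  exact hfin

/-- Accurate estimates and partial coverage bound the suboptimality. -/
theorem IsValueIteration.subOpt_le (hV : M.IsValueIteration D lam β data πhat V)
    (hacc : M.IsAccurate D lam β data V) (hlam : 0 < lam) (hβ : 0 ≤ β) (hK : 1 ≤ K)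
    {c : ℝ} (hc : 0 < c) {πstar : Policy S A} (hopt : M.IsOptimal D lam πstar)
    (hcov : M.Coverage D lam 1 c πstar data) (s : S) :
    M.subOpt D lam πhat s ≤ 2 * H * d * β / √(c * K) := by
  have hV1 : 0 ≤ V 1 s := (hV.mem_Icc le_rfl (by omega) s).1
  have hH : (0 : ℝ) ≤ H := Nat.cast_nonneg H
  refine le_of_forall_pos_le_add fun ε hε => ?_
  have hη : 0 < ε / (H + 1) := by positivity
  have hup := hV.value_le hacc hlam hβ hK hc hcov s hη
  have hp0 : 0 ≤ β * d / √(c * K) := by positivity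
  have hopt' : M.optValue D lam 1 s ≤
      ENNReal.ofReal (V 1 s + H * (2 * (β * d / √(c * K)) + ε / (H + 1))) := (hopt s) ▸ hup
  have hhat : M.value D lam πhat 1 s ≤ M.optValue D lam 1 s :=
    le_iSup (fun π => M.value D lam π 1 s) πhat
  have htop : M.value D lam πhat 1 s ≠ ⊤ :=
    ne_top_of_le_ne_top ENNReal.ofReal_ne_top (hhat.trans hopt')
  have h1 := ENNReal.toReal_le_of_le_ofReal (by positivity) hopt'
  have h2 : V 1 s ≤ (M.value D lam πhat 1 s).toReal :=
    (ENNReal.ofReal_le_iff_le_toReal htop).1 (hV.le_value hacc hlam le_rfl (by omega) s)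
  have h3 : (H : ℝ) * (ε / (H + 1)) ≤ ε := by
    rw [mul_div_assoc', div_le_iff₀ (by positivity)]; nlinarith
  have h4 : (H : ℝ) * (2 * (β * d / √(c * K))) = 2 * H * d * β / √(c * K) := by ring
  rw [subOpt]
  nlinarith

end

end LinearMDP

end ValueIteration

/-! ### High-probability bounds for the three divergences -/

section HighProbability

variable {S A : Type*} [MeasurableSpace S] [MeasurableSpace A] {d H K : ℕ}

/-- A union bound over `H * d * n ^ (d + 1)` events, absorbed by an exponent of order `d ^ 2`. -/
lemma union_bound_le {n L k δ : ℝ} {a : ℕ} (hd : 1 ≤ d) (hL : 0 ≤ L) (hn0 : 0 ≤ n)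
    (hn : n ≤ Real.exp L ^ a) (hpre : 2 * H * d ≤ δ * Real.exp L) (hk : 2 * a + 1 ≤ k) :
    (H * d * n ^ (d + 1) : ℝ) * (2 * Real.exp (-(k * d ^ 2 * L))) ≤ δ := by
  have hd1 : (1 : ℝ) ≤ d := by exact_mod_cast hd
  have hδ : 0 ≤ δ := by
    have h1 : (0 : ℝ) ≤ 2 * H * d := by positivity
    exact nonneg_of_mul_nonneg_left (h1.trans hpre) (by positivity)
  have ha : (0 : ℝ) ≤ a := Nat.cast_nonneg a
  rw [← Real.exp_nat_mul, mul_comm] at hn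
  have hpow : n ^ (d + 1) ≤ Real.exp (L * a * (d + 1)) := by
    calc n ^ (d + 1) ≤ Real.exp (L * a) ^ (d + 1) := pow_le_pow_left₀ hn0 hn _
      _ = _ := by rw [← Real.exp_nat_mul]; congr 1; push_cast; ring
  calc (H * d * n ^ (d + 1) : ℝ) * (2 * Real.exp (-(k * d ^ 2 * L)))
      = (2 * H * d) * n ^ (d + 1) * Real.exp (-(k * d ^ 2 * L)) := by ring
    _ ≤ (δ * Real.exp L) * Real.exp (L * a * (d + 1)) * Real.exp (-(k * d ^ 2 * L)) := by
        gcongr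
    _ = δ * Real.exp (L + L * a * (d + 1) + -(k * d ^ 2 * L)) := by
        rw [Real.exp_add, Real.exp_add]; ring
    _ ≤ δ * 1 := by
        refine mul_le_mul_of_nonneg_left (Real.exp_le_one_iff.2 ?_) hδ
        have h1 : 1 + a * (d + 1) ≤ k * d ^ 2 := by
          have e1 : (d : ℝ) + 1 ≤ 2 * d ^ 2 := by nlinarith
          have e2 : (1 : ℝ) ≤ d ^ 2 := by nlinarith
          nlinarith
        nlinarith
    _ = δ := mul_one δ

lemma abs_exp_neg_sub_exp_neg_le {x y : ℝ} (hx : 0 ≤ x) (hy : 0 ≤ y) :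
    |Real.exp (-x) - Real.exp (-y)| ≤ |x - y| := by
  have aux : ∀ {u v : ℝ}, 0 ≤ u → u ≤ v → |Real.exp (-u) - Real.exp (-v)| ≤ |u - v| := by
    intro u v hu huv
    have h1 : Real.exp (-v) ≤ Real.exp (-u) := Real.exp_le_exp.2 (by linarith)
    have h2 : Real.exp (-v) = Real.exp (-u) * Real.exp (-(v - u)) := by
      rw [← Real.exp_add]; congr 1; ring
    have h3 : 1 - (v - u) ≤ Real.exp (-(v - u)) := by
      have := Real.add_one_le_exp (-(v - u)); linarith
    have h4 : Real.exp (-u) ≤ 1 := Real.exp_le_one_iff.2 (by linarith)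
    have h5 := Real.exp_pos (-u)
    rw [abs_of_nonneg (by linarith), abs_of_nonpos (by linarith), h2]
    nlinarith
  rcases le_total x y with h | h
  · exact aux hx h
  · rw [abs_sub_comm, abs_sub_comm x]; exact aux hy h

lemma abs_log_sub_log_le {m x y : ℝ} (hm : 0 < m) (hx : m ≤ x) (hy : m ≤ y) :
    |Real.log x - Real.log y| ≤ |x - y| / m := by
  have aux : ∀ {u v : ℝ}, m ≤ u → m ≤ v → Real.log u - Real.log v ≤ |u - v| / m := by
    intro u v hu hv
    have hu0 := hm.trans_le hu
    have hv0 := hm.trans_le hv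
    rw [← Real.log_div hu0.ne' hv0.ne']
    calc Real.log (u / v) ≤ u / v - 1 := Real.log_le_sub_one_of_pos (div_pos hu0 hv0)
      _ = (u - v) / v := by field_simp
      _ ≤ |u - v| / v := by gcongr; exact le_abs_self _
      _ ≤ |u - v| / m := by gcongr
  rw [abs_le]
  refine ⟨?_, aux hx hy⟩
  have := aux hy hx
  rw [abs_sub_comm] at this
  linarith

lemma abs_sSup_image_sub_le {f g : ℝ → ℝ} {I : Set ℝ} (hI : I.Nonempty)
    (hf : BddAbove (f '' I)) (hg : BddAbove (g '' I)) {ε : ℝ} (h : ∀ x ∈ I, |f x - g x| ≤ ε) :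
    |sSup (f '' I) - sSup (g '' I)| ≤ ε := by
  have := hI.to_subtype
  rw [sSup_image', sSup_image']
  rw [Set.image_eq_range] at hf hg
  exact abs_ciSup_sub_ciSup_le hf hg fun i => h i i.2

lemma sqrt_le_self_of_one_le {x : ℝ} (hx : 1 ≤ x) : √x ≤ x := by
  rw [Real.sqrt_le_left (by linarith)]; nlinarith

lemma le_exp_self (x : ℝ) : x ≤ Real.exp x := by linarith [Real.add_one_le_exp x]

/-- A net of mesh `c / K` costs at most `c` after the factor `√K` in the regression error. -/
lemma div_mul_sqrt_le {c : ℝ} (hc : 0 ≤ c) (hK : 1 ≤ K) : c / K * √(K : ℝ) ≤ c := by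
  have hK1 : (1 : ℝ) ≤ K := by exact_mod_cast hK
  rw [div_mul_eq_mul_div, div_le_iff₀ (by linarith)]
  exact mul_le_mul_of_nonneg_left (sqrt_le_self_of_one_le hK1) hc

namespace LinearMDP

lemma one_le_dim [Nonempty S] [Nonempty A] (M : LinearMDP S A d H) : 1 ≤ d := by
  by_contra h
  obtain rfl : d = 0 := by omega
  have := M.φ_sum (Classical.arbitrary _)
  simp at this

lemma nonempty_action [Nonempty S] (π : Policy S A) : Nonempty A := by
  have : IsProbabilityMeasure (π.toKernel 0 (Classical.arbitrary S)) := inferInstance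
  exact nonempty_of_isProbabilityMeasure (π.toKernel 0 (Classical.arbitrary S))

variable {M : LinearMDP S A d H}

/-- The deterministic suboptimality bound holds on any event on which the regression targets are
within `β` widths of the true robust means. -/
lemma highProbBound_of_accurate {ρ : Measure S} {πb : Policy S A} {D : Divergence}
    {lam β δ : ℝ} {B : ℝ → ℝ} (hlam : 0 < lam) (hβ : 0 ≤ β) (hK : 1 ≤ K)
    (hB : ∀ c, 2 * H * d * β / √(c * K) ≤ B c) {G : Set (Dataset S A K)} (hGm : MeasurableSet G)
    (hG : 1 - δ ≤ (M.dataLaw ρ πb K).real G)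
    (hacc : ∀ data ∈ G, ∀ πhat V, M.IsValueIteration D lam β data πhat V →
      M.IsAccurate D lam β data V) :
    M.HighProbBound ρ πb K D lam β δ B := by
  refine ⟨G, hGm, hG, fun data hdata πhat hout πstar hopt c hc hcov s => ?_⟩
  obtain ⟨V, hV⟩ := hout
  have hV' : M.IsValueIteration D lam β data πhat V := hV
  exact (hV'.subOpt_le (hacc data hdata πhat V hV') hlam hβ hK hc hopt hcov s).trans (hB c)

/-! ### Total variation -/

theorem highProbBound_tv (ρ : ProbabilityMeasure S) (πb : Policy S A) (hH : 1 ≤ H) (hK : 1 ≤ K)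
    {lam : ℝ} (hlam : 0 < lam) {δ : ℝ} (hδ0 : 0 < δ) (hδ1 : δ < 1) {ξ : ℝ}
    (hξ : ξ = 2 * Real.log (1024 * H * √(d : ℝ) * K ^ 2 / δ)) :
    M.HighProbBound ρ πb K .tv lam (16 * H * d * √ξ) δ
      (fun c => 32 * H ^ 2 * d ^ 2 * √ξ / √(c * K)) := by
  have hS : Nonempty S := ρ.nonempty
  have hA : Nonempty A := nonempty_action πb
  have hd : 1 ≤ d := M.one_le_dim
  have hd1 : (1 : ℝ) ≤ d := by exact_mod_cast hd
  have hK1 : (1 : ℝ) ≤ K := by exact_mod_cast hK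
  have hH1 : (1 : ℝ) ≤ H := by exact_mod_cast hH
  have hsd1 : 1 ≤ √(d : ℝ) := Real.one_le_sqrt.2 hd1
  have hsd : √(d : ℝ) ≤ d := sqrt_le_self_of_one_le hd1
  have hsK1 : 1 ≤ √(K : ℝ) := Real.one_le_sqrt.2 hK1
  have hsK : √(K : ℝ) ≤ K := sqrt_le_self_of_one_le hK1
  have hexp : Real.exp ξ = 1024 ^ 2 * H ^ 2 * d * K ^ 4 / δ ^ 2 := by
    rw [hξ, mul_comm, Real.exp_mul, Real.exp_log (by positivity), Real.rpow_two]
    rw [div_pow, mul_pow, mul_pow, mul_pow, Real.sq_sqrt (Nat.cast_nonneg d)]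
    ring
  have hδE : δ * Real.exp ξ = 1024 ^ 2 * H ^ 2 * d * K ^ 4 / δ := by
    rw [hexp]; field_simp
  have hE : (1024 ^ 2 * H ^ 2 * d * K ^ 4 : ℝ) ≤ Real.exp ξ := by
    rw [hexp, le_div_iff₀ (by positivity)]
    exact mul_le_of_le_one_right (by positivity) (pow_le_one₀ hδ0.le hδ1.le)
  have hH2 : (1 : ℝ) ≤ H ^ 2 := one_le_pow₀ hH1
  have hK4 : (1 : ℝ) ≤ K ^ 4 := one_le_pow₀ hK1
  have hξ1 : 1 ≤ ξ := by
    rw [← Real.exp_le_exp]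
    refine le_trans ?_ hE
    calc Real.exp 1 ≤ 1024 ^ 2 * 1 * 1 * 1 := by linarith [Real.exp_one_lt_d9]
      _ ≤ _ := by gcongr
  have hsξ1 : 1 ≤ √ξ := Real.one_le_sqrt.2 hξ1
  have hsξE : √ξ ≤ Real.exp ξ := (sqrt_le_self_of_one_le hξ1).trans (le_exp_self ξ)
  set β : ℝ := 16 * H * d * √ξ with hβdef
  set B : ℝ := √(d : ℝ) + H * √(K : ℝ) + β with hBdef
  have hβ : 0 ≤ β := by positivity
  have hB0 : 0 ≤ B := by positivity
  have hHB : (H : ℝ) ≤ B := by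
    have : (H : ℝ) ≤ H * √(K : ℝ) := le_mul_of_one_le_right (by positivity) hsK1
    rw [hBdef]; linarith [Real.sqrt_nonneg (d : ℝ)]
  have hn : 2 * B / (H / K) + 1 ≤ Real.exp ξ ^ 2 := by
    have e1 : 2 * B / (H / K) + 1 =
        2 * K * (√(d : ℝ) / H + √(K : ℝ) + 16 * d * √ξ) + 1 := by
      rw [hBdef, hβdef]; field_simp
    have e2 : √(d : ℝ) / H ≤ d * K * √ξ := by
      calc √(d : ℝ) / H ≤ √(d : ℝ) := div_le_self (by positivity) hH1
        _ ≤ d * 1 * 1 := by linarith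
        _ ≤ _ := by gcongr
    have e3 : √(K : ℝ) ≤ d * K * √ξ := by
      calc √(K : ℝ) ≤ 1 * K * 1 := by linarith
        _ ≤ _ := by gcongr
    have e4 : 16 * d * √ξ ≤ 16 * (d * K * √ξ) := by
      calc 16 * d * √ξ = 16 * (d * 1 * √ξ) := by ring
        _ ≤ _ := by gcongr
    have e5 : (1 : ℝ) ≤ d * K ^ 2 * √ξ := by
      calc (1 : ℝ) = 1 * 1 ^ 2 * 1 := by ring
        _ ≤ _ := by gcongr
    have e6 : 2 * B / (H / K) + 1 ≤ 37 * (d * K ^ 2) * √ξ := by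
      rw [e1]
      calc _ ≤ 2 * K * (d * K * √ξ + d * K * √ξ + 16 * (d * K * √ξ)) + d * K ^ 2 * √ξ := by
            gcongr
        _ = _ := by ring
    have e7 : 37 * (d * K ^ 2 : ℝ) ≤ Real.exp ξ := by
      refine le_trans ?_ hE
      calc 37 * (d * K ^ 2 : ℝ) = 37 * 1 * d * K ^ 2 := by ring
        _ ≤ 1024 ^ 2 * H ^ 2 * d * K ^ 4 := by
          gcongr <;> norm_num
    refine e6.trans ?_
    rw [pow_two (Real.exp ξ)]
    gcongr
  -- The net has mesh `H / K`, fine enough to cost a constant in the regression error, and the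
  -- deviation `2 H d √ξ` has Hoeffding exponent `8 d ^ 2 ξ`, which absorbs the net's cardinality.
  obtain ⟨G, hGm, hG, hGood⟩ := M.exists_good_event_value (K := K) ρ πb
    (fun V _ s => min (V s) ((⨅ s', V s') + lam)) (b := H) (B := B) (η := H / K) (ε := H / K)
    (t := 2 * H * d * √ξ) (δ := δ) (by linarith) hHB (by positivity) (by positivity)
    (by positivity) (fun V α hV => hV.min measurable_const)
    (fun V α hV hα s => ⟨le_min (hV s).1 (by
        have : 0 ≤ ⨅ s', V s' := Real.iInf_nonneg fun s => (hV s).1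
        linarith), (min_le_left _ _).trans (hV s).2⟩)
    (fun V V' α α' hV hV' hα hα' hVV hαα s => by
      refine (abs_min_sub_min_le_max _ _ _ _).trans (max_le (hVV s) ?_)
      rw [add_sub_add_right_eq_sub]
      exact abs_ciInf_sub_ciInf_le ⟨0, by rintro _ ⟨s, rfl⟩; exact (hV s).1⟩
        ⟨0, by rintro _ ⟨s, rfl⟩; exact (hV' s).1⟩ hVV)
    (by
      have := union_bound_le (H := H) (n := 2 * B / (H / K) + 1) (a := 2) (k := 8)
        (δ := δ) hd (by linarith) (by positivity) hn
        (by
          rw [hδE, le_div_iff₀ hδ0]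
          calc 2 * H * d * δ ≤ 2 * H * d * 1 := by gcongr
            _ = 2 * H ^ 1 * d * 1 := by ring
            _ ≤ _ := by
              gcongr <;> norm_num) (by norm_num)
      convert this using 4
      rw [mul_pow, mul_pow, Real.sq_sqrt (by linarith)]
      field_simp
      norm_num)
  refine highProbBound_of_accurate hlam hβ hK (fun c => le_of_eq (by rw [hβdef]; ring)) hGm hG
    fun data hdata πhat V hV h hh i => ?_
  obtain ⟨h1, h2⟩ := Finset.mem_Icc.1 hh
  have hV0 : ∀ s, V (h + 1) s ∈ Set.Icc 0 (H : ℝ) := fun s =>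
    hV.mem_Icc_horizon (by omega) (by omega) s
  have hVc : M.InValueClass B h (V (h + 1)) :=
    hV.inValueClass hβ (W := H * √(K : ℝ)) (fun h U hU i => by
      change |M.ridgeNext 1 data h (fun s => min (U s) ((⨅ s', U s') + lam)) i| ≤ _
      refine M.abs_ridgeNext_le data h (by positivity) (fun s => ?_) i
      have : 0 ≤ ⨅ s', U s' := Real.iInf_nonneg fun s => (hU s).1
      rw [abs_of_nonneg (le_min (hU s).1 (by linarith))]
      exact (min_le_left _ _).trans (hU s).2) hB0 le_rfl hh
  refine ⟨_, isRobustMean_tv hlam (M.μ₀ h i) (hV.measurable (by omega) (by omega)) hV0, ?_⟩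
  have hest := hGood data hdata h hh (V (h + 1)) hVc 0 ⟨le_rfl, by linarith⟩ i
  refine hest.trans ?_
  refine mul_le_mul_of_nonneg_right ?_ (Real.sqrt_nonneg _)
  have e1 : 2 * (H / K : ℝ) * √(K : ℝ) ≤ 2 * H := by
    rw [mul_assoc]; gcongr; exact div_mul_sqrt_le (by positivity) hK
  have e2 : (H : ℝ) * √(d : ℝ) ≤ H * d * √ξ := by
    calc (H : ℝ) * √(d : ℝ) ≤ H * d * 1 := by rw [mul_one]; gcongr
      _ ≤ _ := by gcongr
  have e3 : (2 : ℝ) * H ≤ 2 * (H * d * √ξ) := by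
    calc (2 : ℝ) * H = 2 * (H * 1 * 1) := by ring
      _ ≤ _ := by gcongr
  have e4 : 0 ≤ H * d * √ξ := by positivity
  rw [hβdef]
  linarith

/-! ### Kullback-Leibler divergence -/

/-- The radius `H / lam + ξ` dominates `H / (4 lam)` plus a logarithm free of `lam`, for every
`lam > 0`: the possibly negative term `2 log lam` is compensated by `H / lam`. -/
lemma kl_radius_ge {lam δ ξ : ℝ} (hd : 1 ≤ d) (hH : 1 ≤ H) (hK : 1 ≤ K) (hlam : 0 < lam)
    (hδ0 : 0 < δ) (hξ : ξ = Real.log (1024 * d * lam ^ 2 * K ^ 3 * H / δ)) :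
    H / lam / 4 + Real.log (1024 * d * K ^ 3 * H / δ) ≤ H / lam + ξ := by
  have hd0 : (0 : ℝ) < d := by exact_mod_cast hd
  have hK0 : (0 : ℝ) < K := by exact_mod_cast hK
  have hH1 : (1 : ℝ) ≤ H := by exact_mod_cast hH
  have e1 : ξ = Real.log (1024 * d * K ^ 3 * H / δ) - 2 * Real.log (1 / lam) := by
    rw [hξ, show (1024 * d * lam ^ 2 * K ^ 3 * H / δ : ℝ) =
      (1024 * d * K ^ 3 * H / δ) * lam ^ 2 by ring,
      Real.log_mul (by positivity) (by positivity), Real.log_pow, one_div, Real.log_inv]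
    push_cast; ring
  have e2 : Real.log (1 / lam) ≤ 3 / 8 * (1 / lam) := by
    have h1 := Real.log_le_sub_one_of_pos (x := 3 / 8 * (1 / lam)) (by positivity)
    rw [Real.log_mul (by norm_num) (by positivity)] at h1
    have h2 : -1 ≤ Real.log (3 / 8) := by
      rw [Real.le_log_iff_exp_le (by norm_num), Real.exp_neg]
      rw [inv_le_comm₀ (Real.exp_pos 1) (by norm_num)]
      linarith [Real.exp_one_gt_d9]
    linarith
  have e3 : 1 / lam ≤ H / lam := by gcongr
  rw [e1]
  linarith

theorem highProbBound_kl (ρ : ProbabilityMeasure S) (πb : Policy S A) (hH : 1 ≤ H) (hK : 1 ≤ K)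
    {lam : ℝ} (hlam : 0 < lam) {δ : ℝ} (hδ0 : 0 < δ) (hδ1 : δ < 1) {ξ : ℝ}
    (hξ : ξ = Real.log (1024 * d * lam ^ 2 * K ^ 3 * H / δ)) :
    M.HighProbBound ρ πb K .kl lam (16 * d * lam * Real.exp (H / lam) * √(H / lam + ξ)) δ
      (fun c => 32 * lam * Real.exp (H / lam) * d ^ 2 * H * √(H / lam + ξ) / √(c * K)) := by
  have hS : Nonempty S := ρ.nonempty
  have hA : Nonempty A := nonempty_action πb
  have hd : 1 ≤ d := M.one_le_dim
  have hd1 : (1 : ℝ) ≤ d := by exact_mod_cast hd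
  have hK1 : (1 : ℝ) ≤ K := by exact_mod_cast hK
  have hH1 : (1 : ℝ) ≤ H := by exact_mod_cast hH
  have hsd1 : 1 ≤ √(d : ℝ) := Real.one_le_sqrt.2 hd1
  have hsd : √(d : ℝ) ≤ d := sqrt_le_self_of_one_le hd1
  have hsK1 : 1 ≤ √(K : ℝ) := Real.one_le_sqrt.2 hK1
  have hsK : √(K : ℝ) ≤ K := sqrt_le_self_of_one_le hK1
  have hrad := kl_radius_ge hd hH hK hlam hδ0 hξ
  set L : ℝ := H / lam + ξ with hLdef
  set P : ℝ := H / lam with hPdef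
  have hP0 : 0 < P := by positivity
  have hE' : Real.exp (P / 4) * (1024 * d * K ^ 3 * H / δ) ≤ Real.exp L := by
    rw [← Real.exp_log (show (0 : ℝ) < 1024 * d * K ^ 3 * H / δ by positivity), ← Real.exp_add]
    exact Real.exp_le_exp.2 hrad
  have hEδ : (1024 * d * K ^ 3 * H / δ : ℝ) ≤ Real.exp L :=
    (le_mul_of_one_le_left (by positivity) (Real.one_le_exp (by positivity))).trans hE'
  have hE : (1024 * d * K ^ 3 * H : ℝ) ≤ Real.exp L := by
    refine le_trans ?_ hEδ
    exact le_div_self (by positivity) hδ0 hδ1.le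
  have hK3 : (1 : ℝ) ≤ K ^ 3 := one_le_pow₀ hK1
  have h1024 : (1024 : ℝ) ≤ Real.exp L := by
    refine le_trans ?_ hE
    calc (1024 : ℝ) = 1024 * 1 * 1 * 1 := by ring
      _ ≤ _ := by gcongr
  have hL1 : 1 ≤ L := by
    rw [← Real.exp_le_exp]
    linarith [Real.exp_one_lt_d9]
  have hPE : Real.exp P ≤ Real.exp L ^ 4 := by
    have h1 : Real.exp (P / 4) ≤ Real.exp L := by
      refine le_trans (le_mul_of_one_le_right (Real.exp_pos _).le ?_) hE'
      rw [one_le_div hδ0]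
      calc δ ≤ 1024 * 1 * 1 * 1 := by linarith
        _ ≤ _ := by gcongr
    calc Real.exp P = Real.exp (P / 4) ^ 4 := by rw [← Real.exp_nat_mul]; congr 1; push_cast; ring
      _ ≤ _ := pow_le_pow_left₀ (Real.exp_pos _).le h1 4
  have heP1 : 1 ≤ Real.exp P := Real.one_le_exp hP0.le
  have hsL1 : 1 ≤ √L := Real.one_le_sqrt.2 hL1
  have hsLE : √L ≤ Real.exp L := (sqrt_le_self_of_one_le hL1).trans (le_exp_self L)
  set β : ℝ := 16 * d * lam * Real.exp P * √L with hβdef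
  set B : ℝ := √(d : ℝ) + (H + lam * √(K : ℝ)) + β with hBdef
  have hβ : 0 ≤ β := by positivity
  have hB0 : 0 ≤ B := by positivity
  have hHB : (H : ℝ) ≤ B := by
    have : 0 ≤ lam * √(K : ℝ) := by positivity
    rw [hBdef]; linarith [Real.sqrt_nonneg (d : ℝ)]
  have hn : 2 * B / (lam / K) + 1 ≤ Real.exp L ^ 6 := by
    have e1 : 2 * B / (lam / K) + 1 =
        2 * K * (√(d : ℝ) * (1 / lam) + P + √(K : ℝ) + 16 * d * Real.exp P * √L) + 1 := by
      rw [hBdef, hβdef, hPdef]; field_simp; ring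
    set Z : ℝ := d * K * (√L * Real.exp P) with hZ
    have hZ1 : (1 : ℝ) ≤ √L * Real.exp P := one_le_mul_of_one_le_of_one_le hsL1 heP1
    have hePZ : Real.exp P ≤ √L * Real.exp P := le_mul_of_one_le_left (by positivity) hsL1
    have e2 : √(d : ℝ) * (1 / lam) ≤ Z := by
      have h1 : 1 / lam ≤ P := by rw [hPdef]; gcongr
      calc √(d : ℝ) * (1 / lam) ≤ d * 1 * Real.exp P := by
            rw [mul_one]; gcongr; exact h1.trans (le_exp_self P)
        _ ≤ _ := by rw [hZ]; gcongr
    have e3 : P ≤ Z := by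
      calc P ≤ 1 * 1 * Real.exp P := by linarith [le_exp_self P]
        _ ≤ _ := by rw [hZ]; gcongr
    have e3' : √(K : ℝ) ≤ Z := by
      calc √(K : ℝ) ≤ 1 * K * 1 := by linarith
        _ ≤ _ := by rw [hZ]; gcongr
    have e4 : 16 * d * Real.exp P * √L ≤ 16 * Z := by
      calc 16 * d * Real.exp P * √L = 16 * (d * 1 * (√L * Real.exp P)) := by ring
        _ ≤ _ := by rw [hZ]; gcongr
    have e5 : (1 : ℝ) ≤ K * Z := by
      calc (1 : ℝ) = 1 * (1 * 1 * 1) := by ring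
        _ ≤ _ := by rw [hZ]; gcongr
    have e6 : 2 * B / (lam / K) + 1 ≤ 39 * (d * K ^ 2) * (√L * Real.exp P) := by
      rw [e1]
      calc _ ≤ 2 * K * (Z + Z + Z + 16 * Z) + K * Z := by gcongr
        _ = _ := by rw [hZ]; ring
    have e7 : 39 * (d * K ^ 2 : ℝ) ≤ Real.exp L := by
      refine le_trans ?_ hE
      calc 39 * (d * K ^ 2 : ℝ) = 39 * d * K ^ 2 * 1 := by ring
        _ ≤ 1024 * d * K ^ 3 * H := by
          gcongr <;> norm_num
    refine e6.trans ?_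
    calc 39 * (d * K ^ 2) * (√L * Real.exp P) ≤
          Real.exp L * (Real.exp L * Real.exp L ^ 4) := by gcongr
      _ = Real.exp L ^ 6 := by ring
  have hnn : ∀ {x : ℝ}, 0 ≤ x → Real.exp (-x / lam) ∈ Set.Icc (0 : ℝ) 1 := fun {x} hx =>
    ⟨(Real.exp_pos _).le, Real.exp_le_one_iff.2
      (div_nonpos_of_nonpos_of_nonneg (by linarith) hlam.le)⟩
  obtain ⟨G, hGm, hG, hGood⟩ := M.exists_good_event_value (K := K) ρ πb
    (fun V _ s => Real.exp (-V s / lam)) (b := 1) (B := B) (η := lam / K) (ε := 1 / K)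
    (t := 3 * d * √L) (δ := δ) one_pos hHB (by positivity) (by positivity)
    (by positivity) (fun V α hV => (hV.neg.div_const lam).exp)
    (fun V α hV hα s => hnn (hV s).1)
    (fun V V' α α' hV hV' hα hα' hVV hαα s => by
      rw [neg_div, neg_div]
      refine (abs_exp_neg_sub_exp_neg_le (div_nonneg (hV s).1 hlam.le)
        (div_nonneg (hV' s).1 hlam.le)).trans ?_
      rw [← sub_div, abs_div, abs_of_pos hlam, div_le_iff₀ hlam]
      exact (hVV s).trans (le_of_eq (by ring)))
    (by
      have := union_bound_le (H := H) (n := 2 * B / (lam / K) + 1) (a := 6) (k := 18)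
        (δ := δ) hd (by linarith) (by positivity) hn
        (by
          have h1 : 1024 * d * K ^ 3 * H ≤ δ * Real.exp L := by
            rw [mul_comm δ, ← div_le_iff₀ hδ0]; exact hEδ
          refine le_trans ?_ h1
          calc (2 * H * d : ℝ) = 2 * d * 1 * H := by ring
            _ ≤ _ := by gcongr; norm_num) (by norm_num)
      convert this using 4
      rw [mul_pow, mul_pow, Real.sq_sqrt (by linarith)]
      ring)
  refine highProbBound_of_accurate hlam hβ hK (fun c => le_of_eq (by rw [hβdef]; ring)) hGm hG
    fun data hdata πhat V hV h hh i => ?_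
  obtain ⟨h1, h2⟩ := Finset.mem_Icc.1 hh
  have hV0 : ∀ s, V (h + 1) s ∈ Set.Icc 0 (H : ℝ) := fun s =>
    hV.mem_Icc_horizon (by omega) (by omega) s
  have hVm := hV.measurable (h := h + 1) (by omega) (by omega)
  have hfloor : Real.exp (-(H : ℝ) / lam) ≤ 1 := (hnn (Nat.cast_nonneg H)).2
  have hVc : M.InValueClass B h (V (h + 1)) := by
    refine hV.inValueClass hβ (W := H + lam * √(K : ℝ)) (fun h U hU i => ?_) hB0 le_rfl hh
    have hR := M.abs_ridgeNext_le data h (f := fun s => Real.exp (-U s / lam)) zero_le_one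
      (fun s => by rw [abs_of_nonneg (hnn (hU s).1).1]; exact (hnn (hU s).1).2) i
    rw [one_mul] at hR
    set R := M.ridgeNext 1 data h (fun s => Real.exp (-U s / lam)) i with hRdef
    have hw : M.wHat .kl lam 1 data h U i =
      -lam * Real.log (max R (Real.exp (-(H : ℝ) / lam))) := rfl
    have hmax0 : 0 < max R (Real.exp (-(H : ℝ) / lam)) := lt_max_of_lt_right (Real.exp_pos _)
    have hlow : -(H : ℝ) / lam ≤ Real.log (max R (Real.exp (-(H : ℝ) / lam))) := by
      rw [Real.le_log_iff_exp_le hmax0]; exact le_max_right _ _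
    have hup : Real.log (max R (Real.exp (-(H : ℝ) / lam))) ≤ √(K : ℝ) := by
      refine (Real.log_le_sub_one_of_pos hmax0).trans ?_
      have : max R (Real.exp (-(H : ℝ) / lam)) ≤ √(K : ℝ) :=
        max_le (abs_le.1 hR).2 (hfloor.trans hsK1)
      linarith
    have hlow' : -(H : ℝ) ≤ lam * Real.log (max R (Real.exp (-(H : ℝ) / lam))) := by
      rw [div_le_iff₀ hlam] at hlow; linarith
    have hup' : lam * Real.log (max R (Real.exp (-(H : ℝ) / lam))) ≤ lam * √(K : ℝ) := by
      gcongr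
    have hpos : 0 ≤ lam * √(K : ℝ) := by positivity
    rw [hw, abs_le]
    constructor <;> linarith
  refine ⟨_, isRobustMean_kl hlam (M.μ₀ h i) hVm hV0, ?_⟩
  have hest := hGood data hdata h hh (V (h + 1)) hVc 0 ⟨le_rfl, by linarith⟩ i
  set R := M.ridgeNext 1 data h (fun s => Real.exp (-V (h + 1) s / lam)) i with hRdef
  set E := ∫ s, Real.exp (-V (h + 1) s / lam) ∂(M.μ₀ h i : Measure S) with hEdef
  set m := Real.exp (-(H : ℝ) / lam) with hm
  have hm0 : 0 < m := Real.exp_pos _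
  have hEm : m ≤ E := by
    have := integral_mono (μ := (M.μ₀ h i : Measure S)) (integrable_const m)
      (integrable_of_mem_Icc (hVm.neg.div_const lam).exp fun s => hnn (hV0 s).1) fun s => by
        refine Real.exp_le_exp.2 ?_
        exact div_le_div_of_nonneg_right (neg_le_neg (hV0 s).2) hlam.le
    simpa using this
  have hw : M.wHat .kl lam 1 data h (V (h + 1)) i = -lam * Real.log (max R m) := rfl
  have hlog : |Real.log (max R m) - Real.log E| ≤ |R - E| / m := by
    refine (abs_log_sub_log_le hm0 (le_max_right _ _) hEm).trans (div_le_div_of_nonneg_right ?_ hm0.le)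
    have := abs_max_sub_max_le_max R m E m
    rwa [max_eq_left hEm, sub_self, abs_zero, max_eq_left (abs_nonneg (R - E))] at this
  have hrew : |M.wHat .kl lam 1 data h (V (h + 1)) i - -lam * Real.log E| =
      lam * |Real.log (max R m) - Real.log E| := by
    rw [hw, ← mul_sub, abs_mul, abs_neg, abs_of_pos hlam]
  have hRE : R - E = M.ridgeNext 1 data h (fun s => Real.exp (-V (h + 1) s / lam)) i -
    M.nominalMean h (fun s => Real.exp (-V (h + 1) s / lam)) i := rfl
  rw [hrew]
  have hminv : m⁻¹ = Real.exp P := by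
    rw [hm, ← Real.exp_neg, hPdef]; congr 1; ring
  have hA' : 3 * d * √L + 1 * √(d : ℝ) + 2 * (1 / K) * √(K : ℝ) ≤ 16 * d * √L := by
    have e1 : 2 * (1 / K : ℝ) * √(K : ℝ) ≤ 2 * 1 := by
      rw [mul_assoc]; gcongr; exact div_mul_sqrt_le zero_le_one hK
    have e2 : √(d : ℝ) ≤ d * √L := by
      calc √(d : ℝ) ≤ d * 1 := by rw [mul_one]; exact hsd
        _ ≤ _ := by gcongr
    have e3 : (1 : ℝ) ≤ d * √L := one_le_mul_of_one_le_of_one_le hd1 hsL1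
    linarith
  calc lam * |Real.log (max R m) - Real.log E| ≤ lam * (|R - E| * Real.exp P) := by
        rw [← hminv, ← div_eq_mul_inv]; gcongr
    _ ≤ lam * (((3 * d * √L + 1 * √(d : ℝ) + 2 * (1 / K) * √(K : ℝ)) *
          √(invDiag (M.design data h) i)) * Real.exp P) := by rw [hRE]; gcongr
    _ ≤ lam * ((16 * d * √L * √(invDiag (M.design data h) i)) * Real.exp P) := by gcongr
    _ = β * √(invDiag (M.design data h) i) := by rw [hβdef]; ring

/-! ### Chi-square divergence -/

theorem highProbBound_chiSq (ρ : ProbabilityMeasure S) (πb : Policy S A) (hH : 1 ≤ H) (hK : 1 ≤ K)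
    {lam : ℝ} (hlam : 0 < lam) {δ : ℝ} (hδ0 : 0 < δ) (hδ1 : δ < 1) {ξ : ℝ}
    (hξ : ξ = Real.log (192 * K ^ 5 * H ^ 6 * d ^ 3 * (1 + H / (2 * lam)) ^ 3 / δ)) :
    M.HighProbBound ρ πb K .chiSq lam (8 * d * H * (1 + 3 * H / (4 * lam)) * √ξ) δ
      (fun c => 16 * d ^ 2 * H ^ 2 * (1 + 3 * H / (4 * lam)) * √ξ / √(c * K)) := by
  have hS : Nonempty S := ρ.nonempty
  have hA : Nonempty A := nonempty_action πb
  have hd : 1 ≤ d := M.one_le_dim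
  have hd1 : (1 : ℝ) ≤ d := by exact_mod_cast hd
  have hK1 : (1 : ℝ) ≤ K := by exact_mod_cast hK
  have hH1 : (1 : ℝ) ≤ H := by exact_mod_cast hH
  have hH0 : (0 : ℝ) ≤ H := by linarith
  have hsd : √(d : ℝ) ≤ d := sqrt_le_self_of_one_le hd1
  set y : ℝ := 1 + H / (2 * lam) with hy
  have hy1 : 1 ≤ y := by
    have : 0 ≤ H / (2 * lam) := by positivity
    linarith
  have hexp : Real.exp ξ = 192 * K ^ 5 * H ^ 6 * d ^ 3 * y ^ 3 / δ := by
    rw [hξ, Real.exp_log (by positivity)]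
  have hδE : δ * Real.exp ξ = 192 * K ^ 5 * H ^ 6 * d ^ 3 * y ^ 3 := by
    rw [hexp]; field_simp
  have hE : 192 * K ^ 5 * H ^ 6 * d ^ 3 * y ^ 3 ≤ Real.exp ξ := by
    rw [hexp]; exact le_div_self (by positivity) hδ0 hδ1.le
  have hK5 : (1 : ℝ) ≤ K ^ 5 := one_le_pow₀ hK1
  have hH6 : (1 : ℝ) ≤ H ^ 6 := one_le_pow₀ hH1
  have hd3 : (1 : ℝ) ≤ d ^ 3 := one_le_pow₀ hd1
  have hy3 : (1 : ℝ) ≤ y ^ 3 := one_le_pow₀ hy1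
  have hξ1 : 1 ≤ ξ := by
    rw [← Real.exp_le_exp]
    refine le_trans ?_ hE
    calc Real.exp 1 ≤ 192 * 1 * 1 * 1 * 1 := by linarith [Real.exp_one_lt_d9]
      _ ≤ _ := by gcongr
  have hsξ1 : 1 ≤ √ξ := Real.one_le_sqrt.2 hξ1
  have hsξE : √ξ ≤ Real.exp ξ := (sqrt_le_self_of_one_le hξ1).trans (le_exp_self ξ)
  set β : ℝ := 8 * d * H * (1 + 3 * H / (4 * lam)) * √ξ with hβdef
  set W : ℝ := H + 1 / (4 * lam) * (H : ℝ) ^ 2 with hW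
  set B : ℝ := √(d : ℝ) + W + β with hBdef
  have hβ : 0 ≤ β := by positivity
  have hW0 : 0 ≤ W := by positivity
  have hB0 : 0 ≤ B := by positivity
  have hHB : (H : ℝ) ≤ B := by
    have : 0 ≤ 1 / (4 * lam) * (H : ℝ) ^ 2 := by positivity
    rw [hBdef, hW]; linarith [Real.sqrt_nonneg (d : ℝ)]
  have hn : 2 * B / (H / K) + 1 ≤ Real.exp ξ ^ 2 := by
    have e1 : 2 * B / (H / K) + 1 = 2 * K * (√(d : ℝ) / H + (1 + H / (4 * lam)) +
        8 * d * (1 + 3 * H / (4 * lam)) * √ξ) + 1 := by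
      rw [hBdef, hβdef, hW]; field_simp
    have e2 : √(d : ℝ) / H ≤ d * y * √ξ := by
      calc √(d : ℝ) / H ≤ √(d : ℝ) := div_le_self (by positivity) hH1
        _ ≤ d * 1 * 1 := by linarith
        _ ≤ _ := by gcongr
    have hpos : 0 ≤ H / (4 * lam) := by positivity
    have hy2 : H / (2 * lam) = 2 * (H / (4 * lam)) := by field_simp; norm_num
    have e3 : 1 + H / (4 * lam) ≤ d * y * √ξ := by
      calc 1 + H / (4 * lam) ≤ 1 * y * 1 := by rw [hy, hy2]; linarith
        _ ≤ _ := by gcongr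
    have e4 : 8 * d * (1 + 3 * H / (4 * lam)) * √ξ ≤ 12 * (d * y * √ξ) := by
      have : 1 + 3 * H / (4 * lam) ≤ 3 / 2 * y := by
        rw [hy, hy2, mul_div_assoc]; linarith
      calc _ ≤ 8 * d * (3 / 2 * y) * √ξ := by gcongr
        _ = _ := by ring
    have e5 : (1 : ℝ) ≤ K * (d * y * √ξ) := by
      calc (1 : ℝ) = 1 * (1 * 1 * 1) := by ring
        _ ≤ _ := by gcongr
    have e6 : 2 * B / (H / K) + 1 ≤ 29 * (K * d * y) * √ξ := by
      rw [e1]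
      calc _ ≤ 2 * K * (d * y * √ξ + d * y * √ξ + 12 * (d * y * √ξ)) + K * (d * y * √ξ) := by
            gcongr
        _ = _ := by ring
    have e7 : 29 * (K * d * y) ≤ Real.exp ξ := by
      refine le_trans ?_ hE
      calc 29 * (K * d * y) = 29 * K ^ 1 * 1 * d ^ 1 * y ^ 1 := by ring
        _ ≤ 192 * K ^ 5 * H ^ 6 * d ^ 3 * y ^ 3 := by
          gcongr <;> norm_num
    refine e6.trans ?_
    rw [pow_two (Real.exp ξ)]
    gcongr
  have hunion : (H * d * (2 * B / (H / K) + 1) ^ (d + 1) : ℝ) *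
      (2 * Real.exp (-(8 * d ^ 2 * ξ))) ≤ δ / 2 := by
    refine union_bound_le (a := 2) hd (by linarith) (by positivity) hn ?_
      (by norm_num)
    have h1 : 2 * H * d * 2 ≤ δ * Real.exp ξ := by
      rw [hδE]
      calc (2 * H * d * 2 : ℝ) = 4 * 1 * H ^ 1 * d ^ 1 * 1 := by ring
        _ ≤ _ := by
          gcongr <;> norm_num
    linarith
  have hminI : ∀ {v α : ℝ}, v ∈ Set.Icc 0 (H : ℝ) → α ∈ Set.Icc 0 (H : ℝ) →
      min v α ∈ Set.Icc 0 (H : ℝ) := fun hv hα => ⟨le_min hv.1 hα.1, (min_le_left _ _).trans hv.2⟩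
  obtain ⟨G₁, hGm₁, hG₁, hGood₁⟩ := M.exists_good_event_value (K := K) ρ πb
    (fun V α s => min (V s) α) (b := H) (B := B) (η := H / K) (ε := H / K)
    (t := 2 * H * d * √ξ) (δ := δ / 2) (by linarith) hHB (by positivity) (by positivity)
    (by positivity) (fun V α hV => hV.min measurable_const)
    (fun V α hV hα s => hminI (hV s) hα)
    (fun V V' α α' hV hV' hα hα' hVV hαα s =>
      (abs_min_sub_min_le_max _ _ _ _).trans (max_le (hVV s) hαα))
    (by
      convert hunion using 4
      rw [mul_pow, mul_pow, Real.sq_sqrt (by linarith)]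
      field_simp
      norm_num)
  obtain ⟨G₂, hGm₂, hG₂, hGood₂⟩ := M.exists_good_event_value (K := K) ρ πb
    (fun V α s => min (V s) α ^ 2) (b := (H : ℝ) ^ 2) (B := B) (η := H / K)
    (ε := 2 * (H : ℝ) ^ 2 / K) (t := 2 * (H : ℝ) ^ 2 * d * √ξ) (δ := δ / 2) (by positivity) hHB
    (by positivity) (by positivity)
    (by positivity) (fun V α hV => (hV.min measurable_const).pow_const 2)
    (fun V α hV hα s => ⟨sq_nonneg _, pow_le_pow_left₀ (hminI (hV s) hα).1 (hminI (hV s) hα).2 2⟩)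
    (fun V V' α α' hV hV' hα hα' hVV hαα s => by
      have h1 := hminI (hV s) hα
      have h2 := hminI (hV' s) hα'
      have h3 : |min (V s) α - min (V' s) α'| ≤ H / K :=
        (abs_min_sub_min_le_max _ _ _ _).trans (max_le (hVV s) hαα)
      rw [sq_sub_sq, abs_mul, abs_of_nonneg (add_nonneg h1.1 h2.1)]
      calc _ ≤ (2 * H : ℝ) * (H / K) := by
            gcongr
            linarith [h1.2, h2.2]
        _ = _ := by ring)
    (by
      convert hunion using 4
      rw [mul_pow, mul_pow, Real.sq_sqrt (by linarith)]
      field_simp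
      norm_num)
  have hprob : IsProbabilityMeasure (M.dataLaw ρ πb K) := by unfold dataLaw; infer_instance
  have hG : 1 - δ ≤ (M.dataLaw ρ πb K).real (G₁ ∩ G₂) := by
    have h1 := measureReal_union_add_inter (μ := M.dataLaw ρ πb K) (s := G₁) hGm₂
    have h2 : (M.dataLaw ρ πb K).real (G₁ ∪ G₂) ≤ 1 := measureReal_le_one
    linarith
  refine highProbBound_of_accurate hlam hβ hK (fun c => le_of_eq (by rw [hβdef]; ring))
    (hGm₁.inter hGm₂) hG fun data hdata πhat V hV h hh i => ?_
  obtain ⟨h1, h2⟩ := Finset.mem_Icc.1 hh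
  have hV0 : ∀ s, V (h + 1) s ∈ Set.Icc 0 (H : ℝ) := fun s =>
    hV.mem_Icc_horizon (by omega) (by omega) s
  have hVm := hV.measurable (h := h + 1) (by omega) (by omega)
  have hlevel : ∀ {U : S → ℝ}, (∀ s, U s ∈ Set.Icc 0 (H : ℝ)) →
      (Set.Icc (⨅ s, U s) (⨆ s, U s)).Nonempty ∧
      ∀ α ∈ Set.Icc (⨅ s, U s) (⨆ s, U s), α ∈ Set.Icc 0 (H : ℝ) := by
    intro U hU
    have hb1 : BddBelow (Set.range U) := ⟨0, by rintro _ ⟨s, rfl⟩; exact (hU s).1⟩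
    have hb2 : BddAbove (Set.range U) := ⟨H, by rintro _ ⟨s, rfl⟩; exact (hU s).2⟩
    refine ⟨Set.nonempty_Icc.2 ((ciInf_le hb1 (Classical.arbitrary S)).trans (le_ciSup hb2 _)),
      fun α hα => ⟨le_trans (le_ciInf fun s => (hU s).1) hα.1,
        hα.2.trans (ciSup_le fun s => (hU s).2)⟩⟩
  have hobj : ∀ {e f : ℝ}, e ∈ Set.Icc 0 (H : ℝ) → f ∈ Set.Icc 0 ((H : ℝ) ^ 2) →
      |e + 1 / (4 * lam) * e ^ 2 - 1 / (4 * lam) * f| ≤ W := by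
    intro e f he hf
    have hl : 0 ≤ 1 / (4 * lam) := by positivity
    have a1 : 1 / (4 * lam) * e ^ 2 ≤ 1 / (4 * lam) * (H : ℝ) ^ 2 :=
      mul_le_mul_of_nonneg_left (pow_le_pow_left₀ he.1 he.2 2) hl
    have a2 : 1 / (4 * lam) * f ≤ 1 / (4 * lam) * (H : ℝ) ^ 2 :=
      mul_le_mul_of_nonneg_left hf.2 hl
    have a3 : 0 ≤ 1 / (4 * lam) * e ^ 2 := by positivity
    have a4 : 0 ≤ 1 / (4 * lam) * f := mul_nonneg hl hf.1
    rw [abs_le, hW]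
    constructor <;> linarith [he.1, he.2]
  have hclipI := fun (x : ℝ) => clip_mem_Icc (b := (H : ℝ)) hH0 x
  have hclipI2 := fun (x : ℝ) => clip_mem_Icc (b := (H : ℝ) ^ 2) (by positivity) x
  have hVc : M.InValueClass B h (V (h + 1)) := by
    refine hV.inValueClass hβ (W := W) (fun h U hU i => ?_) hB0 le_rfl hh
    obtain ⟨hne, -⟩ := hlevel hU
    change |sSup ((fun α : ℝ => _) '' _)| ≤ W
    rw [abs_le]
    obtain ⟨α₀, hα₀⟩ := hne
    constructor
    · refine le_csSup_of_le ⟨W, ?_⟩ ⟨α₀, hα₀, rfl⟩ (abs_le.1 (hobj (hclipI _) (hclipI2 _))).1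
      rintro _ ⟨α, -, rfl⟩
      exact (abs_le.1 (hobj (hclipI _) (hclipI2 _))).2
    · refine csSup_le ⟨_, α₀, hα₀, rfl⟩ ?_
      rintro _ ⟨α, -, rfl⟩
      exact (abs_le.1 (hobj (hclipI _) (hclipI2 _))).2
  refine ⟨_, isRobustMean_chiSq hlam (M.μ₀ h i) hVm hV0, ?_⟩
  obtain ⟨hne, hsub⟩ := hlevel hV0
  set q := √(invDiag (M.design data h) i) with hq
  have hq0 : 0 ≤ q := Real.sqrt_nonneg _
  have hEI : ∀ α ∈ Set.Icc (⨅ s, V (h + 1) s) (⨆ s, V (h + 1) s),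
      ∫ s, min (V (h + 1) s) α ∂(M.μ₀ h i : Measure S) ∈ Set.Icc 0 (H : ℝ) := fun α hα =>
    M.nominalMean_mem_Icc h (hVm.min measurable_const)
      (fun s => hminI (hV0 s) (hsub α hα)) i
  have hFI : ∀ α ∈ Set.Icc (⨅ s, V (h + 1) s) (⨆ s, V (h + 1) s),
      ∫ s, min (V (h + 1) s) α ^ 2 ∂(M.μ₀ h i : Measure S) ∈ Set.Icc 0 ((H : ℝ) ^ 2) :=
    fun α hα => M.nominalMean_mem_Icc h ((hVm.min measurable_const).pow_const 2)
      (fun s => ⟨sq_nonneg _, pow_le_pow_left₀ (hminI (hV0 s) (hsub α hα)).1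
        (hminI (hV0 s) (hsub α hα)).2 2⟩) i
  refine abs_sSup_image_sub_le hne ⟨W, ?_⟩ ⟨W, ?_⟩ fun α hα => ?_
  · rintro _ ⟨α, -, rfl⟩
    exact (abs_le.1 (hobj (hclipI _) (hclipI2 _))).2
  · rintro _ ⟨α, hα, rfl⟩
    exact (abs_le.1 (hobj (hEI α hα) (hFI α hα))).2
  have hest₁ := hGood₁ data hdata.1 h hh (V (h + 1)) hVc α (hsub α hα) i
  have hest₂ := hGood₂ data hdata.2 h hh (V (h + 1)) hVc α (hsub α hα) i
  have hE0 := hEI α hα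
  have hF0 := hFI α hα
  rw [chiObjective]
  set R₁ := M.ridgeNext 1 data h (fun s => min (V (h + 1) s) α) i with hR₁
  set R₂ := M.ridgeNext 1 data h (fun s => min (V (h + 1) s) α ^ 2) i with hR₂
  set E := ∫ s, min (V (h + 1) s) α ∂(M.μ₀ h i : Measure S) with hEdef
  set F := ∫ s, min (V (h + 1) s) α ^ 2 ∂(M.μ₀ h i : Measure S) with hFdef
  set Q : ℝ := 8 * d * √ξ * q with hQ
  have hds : (1 : ℝ) ≤ d * √ξ := one_le_mul_of_one_le_of_one_le hd1 hsξ1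
  have hsds : √(d : ℝ) ≤ d * √ξ := by
    calc √(d : ℝ) ≤ d * 1 := by rw [mul_one]; exact hsd
      _ ≤ _ := by gcongr
  have b1 : |clip H R₁ - E| ≤ H * Q := by
    rw [← clip_of_mem hE0]
    refine (abs_clip_sub_clip_le _ _ _).trans (hest₁.trans ?_)
    have e1 : 2 * (H / K : ℝ) * √(K : ℝ) ≤ 2 * H := by
      rw [mul_assoc]; gcongr; exact div_mul_sqrt_le (by positivity) hK
    rw [hQ, ← mul_assoc]
    refine mul_le_mul_of_nonneg_right ?_ hq0
    linarith [mul_le_mul_of_nonneg_left hsds hH0, mul_le_mul_of_nonneg_left hds hH0]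
  have b2 : |clip ((H : ℝ) ^ 2) R₂ - F| ≤ (H : ℝ) ^ 2 * Q := by
    rw [← clip_of_mem hF0]
    refine (abs_clip_sub_clip_le _ _ _).trans (hest₂.trans ?_)
    have e1 : 2 * (2 * (H : ℝ) ^ 2 / K) * √(K : ℝ) ≤ 2 * (2 * (H : ℝ) ^ 2) := by
      linarith [div_mul_sqrt_le (c := 2 * (H : ℝ) ^ 2) (by positivity) hK]
    have hH2 : (0 : ℝ) ≤ (H : ℝ) ^ 2 := by positivity
    rw [hQ, ← mul_assoc]
    refine mul_le_mul_of_nonneg_right ?_ hq0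
    linarith [mul_le_mul_of_nonneg_left hsds hH2, mul_le_mul_of_nonneg_left hds hH2]
  have b3 : |clip H R₁ ^ 2 - E ^ 2| ≤ 2 * H * (H * Q) := by
    rw [sq_sub_sq, abs_mul, abs_of_nonneg (add_nonneg (hclipI R₁).1 hE0.1)]
    gcongr
    linarith [(hclipI R₁).2, hE0.2]
  have hl : 0 ≤ 1 / (4 * lam) := by positivity
  have b4 : |1 / (4 * lam) * (clip H R₁ ^ 2 - E ^ 2)| ≤ 1 / (4 * lam) * (2 * H * (H * Q)) := by
    rw [abs_mul, abs_of_nonneg hl]; gcongr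
  have b5 : |1 / (4 * lam) * (clip ((H : ℝ) ^ 2) R₂ - F)| ≤ 1 / (4 * lam) * ((H : ℝ) ^ 2 * Q) := by
    rw [abs_mul, abs_of_nonneg hl]; gcongr
  have hsum : β * q = H * Q + 1 / (4 * lam) * (2 * H * (H * Q)) +
      1 / (4 * lam) * ((H : ℝ) ^ 2 * Q) := by
    rw [hβdef, hQ]; field_simp; ring
  rw [hsum]
  rw [abs_le] at b1 b4 b5 ⊢
  constructor <;> linarith

end LinearMDP

end HighProbability

end RRMDP

open RRMDP in
theorem mainTheorem3 {S A : Type*} [MeasurableSpace S] [MeasurableSpace A] {d H : ℕ}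
    (M : LinearMDP S A d H) (ρ : MeasureTheory.ProbabilityMeasure S) (πb : Policy S A)
    (K : ℕ) (hH : 1 ≤ H) (hK : 1 ≤ K) (lam : ℝ) (hlam : 0 < lam)
    (δ : ℝ) (hδ0 : 0 < δ) (hδ1 : δ < 1)
    (ξTV ξKL ξchi : ℝ)
    (hξTV : ξTV = 2 * Real.log (1024 * H * √(d : ℝ) * K ^ 2 / δ))
    (hξKL : ξKL = Real.log (1024 * d * lam ^ 2 * K ^ 3 * H / δ))
    (hξchi : ξchi = Real.log (192 * K ^ 5 * H ^ 6 * d ^ 3 * (1 + H / (2 * lam)) ^ 3 / δ)) :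
    M.HighProbBound ρ πb K .tv lam
        (16 * H * d * √ξTV) δ
        (fun c => 32 * H ^ 2 * d ^ 2 * √ξTV / √(c * K)) ∧
    M.HighProbBound ρ πb K .kl lam
        (16 * d * lam * Real.exp (H / lam) * √(H / lam + ξKL)) δ
        (fun c => 32 * lam * Real.exp (H / lam) * d ^ 2 * H * √(H / lam + ξKL) / √(c * K)) ∧
    M.HighProbBound ρ πb K .chiSq lam
        (8 * d * H * (1 + 3 * H / (4 * lam)) * √ξchi) δ
        (fun c => 16 * d ^ 2 * H ^ 2 * (1 + 3 * H / (4 * lam)) * √ξchi / √(c * K)) :=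
  ⟨LinearMDP.highProbBound_tv ρ πb hH hK hlam hδ0 hδ1 hξTV,
    LinearMDP.highProbBound_kl ρ πb hH hK hlam hδ0 hδ1 hξKL,
    LinearMDP.highProbBound_chiSq ρ πb hH hK hlam hδ0 hδ1 hξchi⟩
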